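/- For a domain (nonempty, connected, open set) $D\subset\mathbb C^d$ let $K_D$ be its Kobayashi pseudodistance, and let $\partial D$, $\overline D$ be its Euclidean boundary and closure. $D$ is *complete hyperbolic* if $(D,K_D)$ is a complete metric space. For complete hyperbolic bounded $D$ we say that $(D,K_D)$ is *Gromov hyperbolic* if there is $\delta>0$ such that every geodesic triangle of $(D,K_D)$ is $\delta$-thin, i.e. every point of a side has $K_D$-distance at most $\delta$ to the union of the two other sides; then $\overline D^G=D\cup\partial_G D$ denotes the Gromov closure with the Gromov topology, where $\partial_G D$ is the set of geodesic rays of $(D,K_D)$ modulo bounded distance. Two points $p\ne q$ of $\partial D$ have the *visibility condition with respect to $K_D$* if there are disjoint open neighborhoods $V_p$ of $p$ and $V_q$ of $q$ and a compact set $K\subset D$ such that every geodesic segment of $(D,K_D)$ joining a point of $V_p\cap D$ to a point of $V_q\cap D$ meets $K$. A *geodesic loop* for $K_D$ is a geodesic line $\gamma:(-\infty,+\infty)\to (D,K_D)$ that has the same cluster set $\Gamma$ in $\overline D$ at $+\infty$ and at $-\infty$; $\Gamma$ is called its *vertex*. Let $\Omega\subset\mathbb C^d$ be a bounded domain. * $\Omega$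 is a *Gromov model domain* if it is complete hyperbolic, $(\Omega,K_\Omega)$ is Gromov hyperbolic, and the identity map of $\Omega$ extends to a homeomorphism from $\overline\Omega^G$ onto $\overline\Omega$. * $\Omega$ is *locally Gromov hyperbolic* if every $p\in\partial\Omega$ has an open neighborhood $U$ such that $\Omega\cap U$ is connected and complete hyperbolic and $(\Omega\cap U,K_{\Omega\cap U})$ is Gromov hyperbolic. * $\Omega$ is *locally visible* if every $p\in\partial\Omega$ has open neighborhoods $V'\subseteq V$ such that $\Omega\cap V$ is connected and complete hyperbolic and any two distinct points of $\partial\Omega\cap V'$ have the visibility condition with respect to $K_{\Omega\cap V}$. * $\Omega$ *has no local geodesic loops* if every $p\in\partial\Omega$ has an open neighborhood $W$ such that $\Omega\cap W$ is connected and complete hyperbolic and there is no geodesic loop for $K_{\Omega\cap W}$ whose vertex contains $p$. **Theorem.** A bounded domain $\Omega\subset\mathbb C^d$ is a Gromov model domain if and only if it is locally Gromov hyperbolic, locally visible and has no local geodesic loops. -/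

import Mathlib

open Set Filter Topology Metric
open scoped ENNReal NNReal

noncomputable section

/-! Geodesics, Gromov hyperbolicity and the Gromov closure of a (pseudo-)metric space. -/

section MetricNotions

variable {X : Type*} [PseudoEMetricSpace X]

/-- `S` is (the image of) a geodesic segment joining `x` and `y`. -/
def IsGeodesicSegment (S : Set X) (x y : X) : Prop :=
  ∃ (L : ℝ) (c : ℝ → X), 0 ≤ L ∧ c 0 = x ∧ c L = y ∧
    (∀ s ∈ Icc 0 L, ∀ t ∈ Icc 0 L, edist (c s) (c t) = edist s t) ∧ S = c '' Icc 0 L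

variable (X) in
/-- There is `δ > 0` such that all geodesic triangles are `δ`-thin. -/
def IsGromovHyperbolic : Prop :=
  ∃ δ : ℝ, 0 < δ ∧ ∀ (x y z : X) (S₁ S₂ S₃ : Set X),
    IsGeodesicSegment S₁ x y → IsGeodesicSegment S₂ y z → IsGeodesicSegment S₃ z x →
      ∀ a ∈ S₁, infEDist a (S₂ ∪ S₃) ≤ ENNReal.ofReal δ

variable (X) in
/-- Geodesic rays `[0, ∞) → X`. -/
structure GeodesicRay where
  toFun : ℝ≥0 → X
  isometry : Isometry toFun

variable (X) in
/-- Two geodesic rays are asymptotic if they stay at bounded distance from each other. -/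
def asymptoticSetoid : Setoid (GeodesicRay X) where
  r c c' := ∃ C : ℝ≥0, ∀ t, edist (c.toFun t) (c'.toFun t) ≤ C
  iseqv :=
    { refl := fun c => ⟨0, fun t => by simp⟩
      symm := fun ⟨C, h⟩ => ⟨C, fun t => by rw [edist_comm]; exact h t⟩
      trans := fun {_ c₂ _} ⟨C, h⟩ ⟨C', h'⟩ => ⟨C + C', fun t => by
        rw [ENNReal.coe_add]
        exact (edist_triangle _ (c₂.toFun t) _).trans (add_le_add (h t) (h' t))⟩ }

variable (X) in
/-- The Gromov boundary `∂_G X`: asymptoty classes of geodesic rays. -/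
def GromovBoundary : Type _ := Quotient (asymptoticSetoid X)

/-- The point at infinity determined by a geodesic ray. -/
def GeodesicRay.endpoint (c : GeodesicRay X) : GromovBoundary X :=
  Quotient.mk (asymptoticSetoid X) c

variable (X) in
/-- The Gromov closure `X ∪ ∂_G X`. -/
inductive GromovClosure where
  | inner (x : X) : GromovClosure
  | ideal (ξ : GromovBoundary X) : GromovClosure

/-- `IsGeneralizedRay o c z`: the map `c` is a generalized ray issuing from `o` with
`c(∞) = z`, that is, either a geodesic segment `[0, R] → X` from `o` to `z ∈ X`, extended to
`[0, ∞)` by the constant `z`, or a geodesic ray from `o` in the class `z ∈ ∂_G X`. -/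
inductive IsGeneralizedRay (o : X) : (ℝ≥0 → X) → GromovClosure X → Prop
  | segment (c : ℝ≥0 → X) (R : ℝ≥0) (h0 : c 0 = o)
      (hiso : ∀ s ≤ R, ∀ t ≤ R, edist (c s) (c t) = edist s t)
      (hconst : ∀ t, R ≤ t → c t = c R) : IsGeneralizedRay o c (.inner (c R))
  | ray (c : GeodesicRay X) (h0 : c.toFun 0 = o) :
      IsGeneralizedRay o c.toFun (.ideal c.endpoint)

/-- `u n → z` in the Gromov closure, seen from `o`: there are generalized rays from `o` to the
points `u n` such that each of their subsequences has a further subsequence converging,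
uniformly on compact sets, to a generalized ray from `o` to `z`. -/
def GromovConverges (o : X) (u : ℕ → GromovClosure X) (z : GromovClosure X) : Prop :=
  ∃ c : ℕ → ℝ≥0 → X, (∀ n, IsGeneralizedRay o (c n) (u n)) ∧
    ∀ φ : ℕ → ℕ, StrictMono φ → ∃ ψ : ℕ → ℕ, StrictMono ψ ∧
      ∃ c' : ℝ≥0 → X, IsGeneralizedRay o c' z ∧
        ∀ T : ℝ≥0, TendstoUniformlyOn (fun n => c (φ (ψ n))) c' atTop (Iic T)

theorem GromovConverges.comp {o : X} {u : ℕ → GromovClosure X} {z : GromovClosure X}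
    (h : GromovConverges o u z) {θ : ℕ → ℕ} (hθ : StrictMono θ) :
    GromovConverges o (u ∘ θ) z := by
  obtain ⟨c, hc, hsub⟩ := h
  exact ⟨c ∘ θ, fun n => hc (θ n), fun φ hφ => hsub (θ ∘ φ) (hθ.comp hφ)⟩

/-- The Gromov topology on the Gromov closure with base point `o`: a set is closed if it
contains the limits of all its convergent sequences. (For proper geodesic Gromov hyperbolic
spaces it does not depend on `o`.) -/
@[reducible] def gromovTopology (o : X) : TopologicalSpace (GromovClosure X) :=
  TopologicalSpace.ofClosed
    {B | ∀ u z, (∀ n, u n ∈ B) → GromovConverges o u z → z ∈ B}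
    (fun _ _ hu _ => (hu 0).elim)
    (fun _ hA u z hu hz B hB => hA hB u z (fun n => hu n B hB) hz)
    (fun A hA B hB u z hu hz => by
      by_cases hfreq : ∃ᶠ n in atTop, u n ∈ A
      · obtain ⟨θ, hθ, hmem⟩ := extraction_of_frequently_atTop hfreq
        exact Or.inl (hA (u ∘ θ) z hmem (hz.comp hθ))
      · obtain ⟨N, hN⟩ := eventually_atTop.1 (not_frequently.1 hfreq)
        have hθ : StrictMono (fun n : ℕ => n + N) := fun a b hab => by simpa using hab
        refine Or.inr (hB (u ∘ fun n => n + N) z (fun n => ?_) (hz.comp hθ))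
        exact (hu (n + N)).resolve_left (hN (n + N) (Nat.le_add_left N n)))

end MetricNotions

/-! The Kobayashi pseudodistance. -/

/-- The Poincaré distance on the unit disc. -/
def poincareDist (a b : ℂ) : ℝ :=
  Real.artanh (‖a - b‖ / ‖1 - (starRingEnd ℂ) a * b‖)

theorem poincareDist_comm (a b : ℂ) : poincareDist a b = poincareDist b a := by
  have h : ‖1 - (starRingEnd ℂ) a * b‖ = ‖1 - (starRingEnd ℂ) b * a‖ := by
    rw [← Complex.norm_conj (1 - (starRingEnd ℂ) a * b)]
    simp [mul_comm]
  rw [poincareDist, poincareDist, norm_sub_rev, h]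

variable {E : Type*} [NormedAddCommGroup E] [NormedSpace ℂ E]

/-- `KobayashiChain Ω x y ℓ`: a finite chain of holomorphic discs in `Ω` joins `x` to `y`, and
`ℓ` is the sum of the Poincaré distances of the marked points of its discs. -/
inductive KobayashiChain (Ω : Set E) : E → E → ℝ≥0∞ → Prop
  | nil {x : E} (hx : x ∈ Ω) : KobayashiChain Ω x x 0
  | cons {f : ℂ → E} {a b : ℂ} {x x' y : E} {ℓ : ℝ≥0∞}
      (hf : DifferentiableOn ℂ f (ball 0 1)) (hmaps : MapsTo f (ball 0 1) Ω)
      (ha : a ∈ ball (0 : ℂ) 1) (hb : b ∈ ball (0 : ℂ) 1) (hx : f a = x) (hx' : f b = x')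
      (htail : KobayashiChain Ω x' y ℓ) :
      KobayashiChain Ω x y (ENNReal.ofReal (poincareDist a b) + ℓ)

theorem KobayashiChain.append {Ω : Set E} {x y z : E} {ℓ ℓ' : ℝ≥0∞}
    (h : KobayashiChain Ω x y ℓ) (h' : KobayashiChain Ω y z ℓ') :
    KobayashiChain Ω x z (ℓ + ℓ') := by
  induction h with
  | nil _ => simpa using h'
  | cons hf hm ha hb hx hx' _ ih =>
    rw [add_assoc]
    exact .cons hf hm ha hb hx hx' (ih h')

theorem KobayashiChain.reverse {Ω : Set E} {x y : E} {ℓ : ℝ≥0∞}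
    (h : KobayashiChain Ω x y ℓ) : KobayashiChain Ω y x ℓ := by
  induction h with
  | nil hx => exact .nil hx
  | cons hf hm ha hb hx hx' _ ih =>
    rw [add_comm]
    refine ih.append ?_
    rw [poincareDist_comm, ← add_zero (ENNReal.ofReal _)]
    exact .cons hf hm hb ha hx' hx (.nil (hx ▸ hm ha))

/-- The Kobayashi pseudodistance `K_Ω`; it is finite when `Ω` is a domain. -/
def kobayashiEDist (Ω : Set E) (x y : E) : ℝ≥0∞ :=
  ⨅ (ℓ : ℝ≥0∞) (_ : KobayashiChain Ω x y ℓ), ℓ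

/-- The set `Ω` as a space carrying the Kobayashi pseudodistance. -/
structure KobayashiSpace (Ω : Set E) where
  val : E
  property : val ∈ Ω

instance (Ω : Set E) : PseudoEMetricSpace (KobayashiSpace Ω) where
  edist x y := kobayashiEDist Ω x.val y.val
  edist_self x := le_antisymm (iInf₂_le 0 (.nil x.property)) bot_le
  edist_comm x y := le_antisymm
    (le_iInf₂ fun ℓ h => iInf₂_le ℓ h.reverse) (le_iInf₂ fun ℓ h => iInf₂_le ℓ h.reverse)
  edist_triangle x y z := by
    simp only [kobayashiEDist, ENNReal.iInf_add, ENNReal.add_iInf]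
    exact le_iInf₂ fun ℓ' h' => le_iInf₂ fun ℓ h => iInf₂_le _ (h.append h')

/-! Global and local properties of domains with respect to the Kobayashi distance. -/

/-- `(Ω, K_Ω)` is a complete metric space. -/
def IsCompleteHyperbolic (Ω : Set E) : Prop :=
  (∀ x y : KobayashiSpace Ω, edist x y = 0 → x = y) ∧ CompleteSpace (KobayashiSpace Ω)

/-- The identity of `Ω` extends to a homeomorphism from the Gromov closure of `(Ω, K_Ω)` onto
the Euclidean closure of `Ω`, and `(Ω, K_Ω)` is complete and Gromov hyperbolic. -/
def IsGromovModelDomain (Ω : Set E) : Prop :=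
  IsCompleteHyperbolic Ω ∧ IsGromovHyperbolic (KobayashiSpace Ω) ∧
    ∀ o : KobayashiSpace Ω, ∃ Φ : GromovClosure (KobayashiSpace Ω) → closure Ω,
      @IsHomeomorph _ _ (gromovTopology o) _ Φ ∧
        ∀ x : KobayashiSpace Ω, (Φ (.inner x) : E) = x.val

/-- The couple of boundary points `p, q` has the visibility condition with respect to the
geodesics of `K_Ω`. -/
def HasVisibility (Ω : Set E) (p q : E) : Prop :=
  ∃ Vp Vq K : Set E, IsOpen Vp ∧ p ∈ Vp ∧ IsOpen Vq ∧ q ∈ Vq ∧ Disjoint Vp Vq ∧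
    IsCompact K ∧ K ⊆ Ω ∧
    ∀ (x y : KobayashiSpace Ω) (S : Set (KobayashiSpace Ω)), x.val ∈ Vp → y.val ∈ Vq →
      IsGeodesicSegment S x y → ∃ z ∈ S, z.val ∈ K

/-- The cluster set in the Euclidean closure, along the filter `l` (`atTop` or `atBot`), of a
curve `γ` in `Ω`. -/
def clusterSetAlong {Ω : Set E} (γ : ℝ → KobayashiSpace Ω) (l : Filter ℝ) : Set E :=
  {z | MapClusterPt z l fun t => (γ t).val}

/-- `γ` is a geodesic loop in the closure of `Ω` with vertex `Γ`: a geodesic line of `K_Ω` that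
has the same cluster set `Γ` at `+∞` and at `-∞`. -/
def IsGeodesicLoop {Ω : Set E} (γ : ℝ → KobayashiSpace Ω) (Γ : Set E) : Prop :=
  Isometry γ ∧ clusterSetAlong γ atTop = Γ ∧ clusterSetAlong γ atBot = Γ

def IsLocallyGromovHyperbolic (Ω : Set E) : Prop :=
  ∀ p ∈ frontier Ω, ∃ U : Set E, IsOpen U ∧ p ∈ U ∧ IsConnected (Ω ∩ U) ∧
    IsCompleteHyperbolic (Ω ∩ U) ∧ IsGromovHyperbolic (KobayashiSpace (Ω ∩ U))

def IsLocallyVisible (Ω : Set E) : Prop :=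
  ∀ p ∈ frontier Ω, ∃ V : Set E, IsOpen V ∧ p ∈ V ∧ IsConnected (Ω ∩ V) ∧
    IsCompleteHyperbolic (Ω ∩ V) ∧
    ∃ V' : Set E, IsOpen V' ∧ p ∈ V' ∧ V' ⊆ V ∧
      ∀ q₁ ∈ frontier Ω ∩ V', ∀ q₂ ∈ frontier Ω ∩ V', q₁ ≠ q₂ → HasVisibility (Ω ∩ V) q₁ q₂

def HasNoLocalGeodesicLoops (Ω : Set E) : Prop :=
  ∀ p ∈ frontier Ω, ∃ W : Set E, IsOpen W ∧ p ∈ W ∧ IsConnected (Ω ∩ W) ∧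
    IsCompleteHyperbolic (Ω ∩ W) ∧
    ¬ ∃ (γ : ℝ → KobayashiSpace (Ω ∩ W)) (Γ : Set E), IsGeodesicLoop γ Γ ∧ p ∈ Γ

end

/-! On a bounded domain `K_Ω` is a length distance (`KobayashiChain.exists_split`) that induces the
Euclidean topology (`KobayashiSpace.isOpenEmbedding_val`). Completeness therefore gives properness
and geodesics by Hopf–Rinow, and limits of geodesics by Arzelà–Ascoli.

From local to global, the pivot is `HasBoundedProducts`: points at a definite Euclidean distance
have bounded Gromov product. The tool is Royden's localization: for nearby points, `K_{Ω ∩ U}` is at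
most `coth u` times `K_Ω`, where `u` is a margin to `Ω \ U`. Along a curve receding from `Ω \ U` at
a linear rate, `coth u - 1` decays exponentially and sums to a constant
(`exists_kobayashiDist_inter_le_add`). A geodesic that starts at a nearest point outside a small
ball recedes in this way, so local visibility passes to `Ω` and bounds the products
(`IsLocallyVisible.hasBoundedProducts`). Bounded products in turn make each geodesic near `p` recede
from `Ω \ U` on both sides of its point nearest to a base point. Hence `K_{Ω ∩ U}` and `K_Ω` differ
by a bounded amount near `p` (`HasBoundedProducts.exists_inter_le_add`).

This transfers the four point condition: triples violating it more and more would collapse to one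
boundary point, where the local condition applies. Bounded products also make rays from a fixed
origin converge uniformly in the Euclidean metric, so the identity extends to the Gromov closure,
and the extension is a homeomorphism once it is injective. If two non-asymptotic rays had the same
limit `p`, hyperbolicity would bound the products of their points; geodesics of `Ω ∩ W` joining
these points would then subconverge to a geodesic loop at `p`.

Conversely, in a model domain the whole space serves as neighborhood. The halves of a loop would
have the same limit and hence be asymptotic, which is impossible on a line. Geodesics escaping every
compact set between `p` and `q` would produce asymptotic rays with limits `p` and `q`. -/

/-! ### Hopf–Rinow for length spaces. -/

section LengthSpaces

/-- A metric space is a length space if the triangle inequality has approximate splittings. -/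
class IsLengthSpace (X : Type*) [PseudoMetricSpace X] : Prop where
  exists_split : ∀ (x y : X) (s t : ℝ), 0 < s → 0 < t → dist x y < s + t →
    ∃ z, dist x z < s ∧ dist z y < t

variable {X : Type*} [MetricSpace X]

/-- Splitting puts each point of a slightly larger ball within `δ` of the compact ball, hence inside
a compact neighborhood of it. -/
theorem IsLengthSpace.exists_isCompact_closedBall_add [IsLengthSpace X] [LocallyCompactSpace X]
    {x : X} {r : ℝ} (hr : 0 < r) (h : IsCompact (closedBall x r)) :
    ∃ ε > 0, IsCompact (closedBall x (r + ε)) := by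
  obtain ⟨K, hK, hKx⟩ := exists_compact_superset h
  obtain ⟨δ, hδ, hsub⟩ := h.exists_thickening_subset_open isOpen_interior hKx
  refine ⟨δ / 2, by positivity, hK.of_isClosed_subset isClosed_closedBall fun y hy => ?_⟩
  obtain ⟨z, hz, hzy⟩ := IsLengthSpace.exists_split x y r δ hr hδ
    (by rw [dist_comm]; have := mem_closedBall.1 hy; linarith)
  refine interior_subset (hsub (mem_thickening_iff.2 ⟨z, ?_, by rwa [dist_comm]⟩))
  rw [mem_closedBall, dist_comm]; exact hz.le

theorem IsLengthSpace.isCompact_closedBall_of_forall_lt [IsLengthSpace X] [CompleteSpace X]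
    {x : X} {R : ℝ} (hR : 0 < R) (h : ∀ r < R, IsCompact (closedBall x r)) :
    IsCompact (closedBall x R) := by
  refine TotallyBounded.isCompact_of_isClosed ?_ isClosed_closedBall
  refine totallyBounded_iff.2 fun ε hε => ?_
  -- `η ≤ ε / 4` gives `R < (R - η) + ε / 2`, and `η ≤ R / 2` keeps `R - η` positive; both are
  -- needed to split.
  set η := min (ε / 4) (R / 2) with hη
  have hη0 : 0 < η := by positivity
  have h1 : η ≤ ε / 4 := min_le_left _ _
  have h2 : η ≤ R / 2 := min_le_right _ _
  obtain ⟨t, ht, hcov⟩ := totallyBounded_iff.1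
    (h (R - η) (by linarith)).totallyBounded (ε / 2) (by positivity)
  refine ⟨t, ht, fun y hy => ?_⟩
  obtain ⟨z, hz, hzy⟩ := IsLengthSpace.exists_split x y (R - η) (ε / 2) (by linarith)
    (by positivity) (by rw [dist_comm]; have := mem_closedBall.1 hy; linarith)
  have hz' : z ∈ closedBall x (R - η) := by rw [mem_closedBall, dist_comm]; exact hz.le
  obtain ⟨w, hw, hzw⟩ := mem_iUnion₂.1 (hcov hz')
  refine mem_iUnion₂.2 ⟨w, hw, ?_⟩
  rw [mem_ball] at hzw ⊢
  calc dist y w ≤ dist y z + dist z w := dist_triangle _ _ _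
    _ < ε := by rw [dist_comm y z]; linarith

/-- **Hopf–Rinow–Cohn-Vossen**: complete locally compact length spaces are proper. -/
theorem IsLengthSpace.properSpace [IsLengthSpace X] [CompleteSpace X] [LocallyCompactSpace X] :
    ProperSpace X := by
  refine ⟨fun x => ?_⟩
  by_contra! hcon
  obtain ⟨r₀, hr₀⟩ := hcon
  obtain ⟨ρ, hρ, hρc⟩ : ∃ ρ > 0, IsCompact (closedBall x ρ) := by
    obtain ⟨K, hK, hxK⟩ := exists_compact_mem_nhds x
    obtain ⟨ρ, hρ, h⟩ := Metric.nhds_basis_closedBall.mem_iff.1 hxK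
    exact ⟨ρ, hρ, hK.of_isClosed_subset isClosed_closedBall h⟩
  set S := {r : ℝ | IsCompact (closedBall x r)} with hS
  have hmono : ∀ r ∈ S, ∀ s ≤ r, s ∈ S := fun r hr s hs =>
    IsCompact.of_isClosed_subset hr isClosed_closedBall (closedBall_subset_closedBall hs)
  have hbdd : BddAbove S := ⟨r₀, fun r hr => by
    by_contra! hlt
    exact hr₀ (hmono r hr r₀ hlt.le)⟩
  have hpos : 0 < sSup S := hρ.trans_le (le_csSup hbdd hρc)
  have hsup : IsCompact (closedBall x (sSup S)) := by
    refine IsLengthSpace.isCompact_closedBall_of_forall_lt hpos fun r hr => ?_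
    obtain ⟨s, hs, hrs⟩ := exists_lt_of_lt_csSup ⟨ρ, hρc⟩ hr
    exact hmono s hs r hrs.le
  obtain ⟨ε, hε, hc⟩ := IsLengthSpace.exists_isCompact_closedBall_add hpos hsup
  have := le_csSup hbdd hc
  linarith

theorem IsLengthSpace.exists_dist_le [IsLengthSpace X] [ProperSpace X] {x y : X} {s t : ℝ}
    (hs : 0 ≤ s) (ht : 0 ≤ t) (h : dist x y ≤ s + t) : ∃ z, dist x z ≤ s ∧ dist z y ≤ t := by
  have hstep (n : ℕ) : ∃ z, dist x z < s + 1 / (n + 1 : ℝ) ∧ dist z y < t + 1 / (n + 1 : ℝ) :=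
    IsLengthSpace.exists_split x y _ _ (by positivity) (by positivity) (by
      have : (0 : ℝ) < 1 / (n + 1 : ℝ) := by positivity
      linarith)
  choose z hz hzy using hstep
  have hle (n : ℕ) : 1 / (n + 1 : ℝ) ≤ 1 := by
    rw [div_le_one (by positivity)]; linarith [(n.cast_nonneg : (0 : ℝ) ≤ n)]
  obtain ⟨w, -, φ, hφ, hw⟩ := (isCompact_closedBall x (s + 1)).tendsto_subseq (x := z)
    (fun n => by rw [mem_closedBall, dist_comm]; linarith [hz n, hle n])
  have hlim : Tendsto (fun n => 1 / ((φ n : ℕ) + 1 : ℝ)) atTop (𝓝 0) :=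
    tendsto_one_div_add_atTop_nhds_zero_nat.comp hφ.tendsto_atTop
  refine ⟨w, ?_, ?_⟩
  · have h1 := (tendsto_const_nhds (x := x)).dist hw
    have h2 : Tendsto (fun n => s + 1 / ((φ n : ℕ) + 1 : ℝ)) atTop (𝓝 (s + 0)) :=
      tendsto_const_nhds.add hlim
    rw [add_zero] at h2
    exact le_of_tendsto_of_tendsto' h1 h2 fun n => (hz (φ n)).le
  · have h1 := hw.dist (tendsto_const_nhds (x := y))
    have h2 : Tendsto (fun n => t + 1 / ((φ n : ℕ) + 1 : ℝ)) atTop (𝓝 (t + 0)) :=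
      tendsto_const_nhds.add hlim
    rw [add_zero] at h2
    exact le_of_tendsto_of_tendsto' h1 h2 fun n => (hzy (φ n)).le

/-- Induction on the largest parameter `a`: choose the point at time `a` by an exact splitting, then
treat `[0, a]`. Only upper bounds are tracked; equality follows later from the total length. -/
theorem IsLengthSpace.exists_lipschitz_on_finset [IsLengthSpace X] [ProperSpace X]
    (F : Finset ℝ) : ∀ {x y : X} {L : ℝ}, (∀ s ∈ F, 0 < s ∧ s < L) → 0 < L → dist x y ≤ L →
      ∃ f : ℝ → X, f 0 = x ∧ f L = y ∧
        ∀ s ∈ insert 0 (insert L F), ∀ t ∈ insert 0 (insert L F), s ≤ t →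
          dist (f s) (f t) ≤ t - s := by
  induction F using Finset.induction_on_max with
  | empty =>
    intro x y L _ hL hxy
    refine ⟨fun s => if s ≤ 0 then x else y, by simp, by simp [hL.not_ge], ?_⟩
    simp only [insert_empty_eq, Finset.mem_insert, Finset.mem_singleton]
    rintro s (rfl | rfl) t (rfl | rfl) hst
    · simp
    · simp [hL.not_ge, hxy]
    · exact absurd hst hL.not_ge
    · simp
  | insert a F hmax ih =>
    intro x y L hF hL hxy
    obtain ⟨ha0, haL⟩ := hF a (by simp)
    obtain ⟨z, hxz, hzy⟩ := IsLengthSpace.exists_dist_le (x := x) (y := y) ha0.le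
      (sub_nonneg.2 haL.le) (by linarith)
    obtain ⟨f, hf0, hfa, hf⟩ := ih (x := x) (y := z) (L := a)
      (fun s hs => ⟨(hF s (by simp [hs])).1, hmax s hs⟩) ha0 hxz
    have hle : ∀ s ∈ insert 0 (insert L (insert a F)), s ≠ L → s ≤ a ∧ s ∈ insert 0 (insert a F) := by
      intro s hs hsL
      simp only [Finset.mem_insert] at hs ⊢
      rcases hs with rfl | rfl | rfl | hs
      · exact ⟨ha0.le, by simp⟩
      · exact absurd rfl hsL
      · simp
      · exact ⟨(hmax s hs).le, by simp [hs]⟩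
    have hsL : ∀ s ∈ insert 0 (insert L (insert a F)), s ≤ L := by
      intro s hs
      by_cases h : s = L
      · exact h.le
      · exact (hle s hs h).1.trans haL.le
    refine ⟨fun s => if s ≤ a then f s else y, by simp [ha0.le, hf0], by simp [haL.not_ge], ?_⟩
    intro s hs t ht hst
    by_cases htL : t = L
    · subst htL
      by_cases hsL' : s = t
      · subst hsL'; simp
      · obtain ⟨h1, h2⟩ := hle s hs hsL'
        simp only [h1, haL.not_ge, if_true, if_false]
        have := hf s h2 a (by simp) h1
        rw [hfa] at this
        linarith [dist_triangle (f s) z y]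
    · obtain ⟨h1, h2⟩ := hle t ht htL
      have h3 : s ≠ L := fun h => htL (le_antisymm (hsL t ht) (h ▸ hst))
      obtain ⟨h4, h5⟩ := hle s hs h3
      simp only [h1, h4, if_true]
      exact hf s h5 t h2 hst

/-- Proper length spaces are geodesic. -/
theorem IsLengthSpace.exists_geodesic [IsLengthSpace X] [ProperSpace X] (x y : X) :
    ∃ c : ℝ → X, c 0 = x ∧ c (dist x y) = y ∧
      ∀ s ∈ Icc 0 (dist x y), ∀ t ∈ Icc 0 (dist x y), dist (c s) (c t) = |s - t| := by
  rcases eq_or_ne x y with rfl | hxy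
  · refine ⟨fun _ => x, rfl, rfl, fun s hs t ht => ?_⟩
    simp only [dist_self, Icc_self, mem_singleton_iff] at hs ht
    simp [hs, ht]
  set L := dist x y with hL
  have hLpos : 0 < L := dist_pos.2 hxy
  have hfin (F : Finset ℝ) : ∃ f : ℝ → X, f 0 = x ∧ f L = y ∧
      ∀ s ∈ F, ∀ t ∈ F, s ∈ Icc 0 L → t ∈ Icc 0 L → s ≤ t → dist (f s) (f t) ≤ t - s := by
    obtain ⟨f, h0, h1, h⟩ := IsLengthSpace.exists_lipschitz_on_finset (x := x) (y := y) (L := L)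
      (F.filter fun s => 0 < s ∧ s < L) (fun s hs => (Finset.mem_filter.1 hs).2) hLpos le_rfl
    have hmem : ∀ s ∈ F, s ∈ Icc 0 L →
        s ∈ insert 0 (insert L (F.filter fun s => 0 < s ∧ s < L)) := by
      intro s hs hs'
      simp only [Finset.mem_insert, Finset.mem_filter]
      rcases hs'.1.eq_or_lt with h | h
      · exact Or.inl h.symm
      rcases hs'.2.eq_or_lt with h' | h'
      · exact Or.inr (Or.inl h')
      · exact Or.inr (Or.inr ⟨hs, h, h'⟩)
    exact ⟨f, h0, h1, fun s hs t ht hs' ht' hst => h s (hmem s hs hs') t (hmem t ht ht') hst⟩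
  choose f hf0 hfL hf using hfin
  -- An ultrafilter on the finite parameter sets selects limits at all parameters simultaneously.
  let u : Ultrafilter (Finset ℝ) := Ultrafilter.of atTop
  have hu : (u : Filter (Finset ℝ)) ≤ atTop := Ultrafilter.of_le _
  have hev (s : ℝ) : ∀ᶠ F in (u : Filter (Finset ℝ)), s ∈ F :=
    hu ((eventually_ge_atTop {s}).mono fun F hF => hF (by simp))
  have hlim (s : ℝ) : ∃ z, s ∈ Icc 0 L → Tendsto (fun F => f F s) u (𝓝 z) := by
    by_cases hs : s ∈ Icc 0 L
    · have hb : ∀ᶠ F in (u : Filter (Finset ℝ)), f F s ∈ closedBall x L := by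
        filter_upwards [hev s, hev 0] with F h1 h0
        have := hf F 0 h0 s h1 ⟨le_rfl, hLpos.le⟩ hs hs.1
        rw [hf0] at this
        rw [mem_closedBall, dist_comm]
        linarith [hs.2]
      obtain ⟨z, -, hz⟩ := (isCompact_closedBall x L).ultrafilter_le_nhds
        (u.map fun F => f F s) (le_principal_iff.2 hb)
      exact ⟨z, fun _ => hz⟩
    · exact ⟨x, fun h => absurd h hs⟩
  choose c hc using hlim
  have hc0 : c 0 = x := tendsto_nhds_unique (hc 0 ⟨le_rfl, hLpos.le⟩) (by simp [hf0])
  have hcL : c L = y := tendsto_nhds_unique (hc L ⟨hLpos.le, le_rfl⟩) (by simp [hfL])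
  have hlip : ∀ s ∈ Icc 0 L, ∀ t ∈ Icc 0 L, s ≤ t → dist (c s) (c t) ≤ t - s := by
    intro s hs t ht hst
    refine le_of_tendsto ((hc s hs).dist (hc t ht)) ?_
    filter_upwards [hev s, hev t] with F h1 h2 using hf F s h1 t h2 hs ht hst
  -- The endpoints are at distance exactly `L`, so no Lipschitz inequality can be strict.
  have hiso : ∀ s ∈ Icc 0 L, ∀ t ∈ Icc 0 L, s ≤ t → dist (c s) (c t) = t - s := by
    intro s hs t ht hst
    refine le_antisymm (hlip s hs t ht hst) ?_
    have h1 := hlip 0 ⟨le_rfl, hLpos.le⟩ s hs hs.1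
    have h2 := hlip t ht L ⟨hLpos.le, le_rfl⟩ ht.2
    have h3 := dist_triangle4 (c 0) (c s) (c t) (c L)
    rw [hc0, hcL] at h3
    rw [hc0] at h1
    rw [hcL] at h2
    linarith
  refine ⟨c, hc0, hcL, fun s hs t ht => ?_⟩
  rcases le_total s t with h | h
  · rw [hiso s hs t ht h, abs_sub_comm, abs_of_nonneg (sub_nonneg.2 h)]
  · rw [dist_comm, hiso t ht s hs h, abs_of_nonneg (sub_nonneg.2 h)]

/-- A metric space all of whose points are joined by geodesics. -/
class IsGeodesicSpace (X : Type*) [MetricSpace X] : Prop where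
  exists_geodesic : ∀ x y : X, ∃ c : ℝ → X, c 0 = x ∧ c (dist x y) = y ∧
      ∀ s ∈ Icc 0 (dist x y), ∀ t ∈ Icc 0 (dist x y), dist (c s) (c t) = |s - t|

instance [IsLengthSpace X] [ProperSpace X] : IsGeodesicSpace X :=
  ⟨IsLengthSpace.exists_geodesic⟩

end LengthSpaces

/-! ### Arzelà–Ascoli for `1`-Lipschitz maps. -/

section Limits

variable {X Y : Type*} [MetricSpace X] [PseudoMetricSpace Y]

/-- A sequence of `1`-Lipschitz maps into a proper space that is bounded at a point has a
pointwise convergent subsequence. -/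
theorem exists_subseq_tendsto_of_lipschitz [ProperSpace X]
    [TopologicalSpace.SeparableSpace Y] (c : ℕ → Y → X) (hc : ∀ n, LipschitzWith 1 (c n))
    (y₀ : Y) {x₀ : X} {B : ℝ} (hB : ∀ n, dist (c n y₀) x₀ ≤ B) :
    ∃ φ : ℕ → ℕ, StrictMono φ ∧ ∃ c' : Y → X, LipschitzWith 1 c' ∧
      ∀ t, Tendsto (fun n => c (φ n) t) atTop (𝓝 (c' t)) := by
  have : Nonempty Y := ⟨y₀⟩
  set q := TopologicalSpace.denseSeq Y
  have hd (n : ℕ) (s t : Y) : dist (c n s) (c n t) ≤ dist s t := by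
    simpa using (hc n).dist_le_mul s t
  -- The values on a dense sequence lie in a countable product of compact balls; the Lipschitz bound
  -- extends convergence to all points.
  have hK : IsCompact (Set.pi univ fun k => closedBall x₀ (B + dist (q k) y₀)) :=
    isCompact_univ_pi fun k => isCompact_closedBall _ _
  obtain ⟨g, -, φ, hφ, hg⟩ := hK.tendsto_subseq (x := fun n k => c n (q k)) (fun n k _ => by
    rw [mem_closedBall]
    linarith [dist_triangle (c n (q k)) (c n y₀) x₀, hd n (q k) y₀, hB n])
  have hcau (t : Y) : CauchySeq fun n => c (φ n) t := by
    refine Metric.cauchySeq_iff'.2 fun ε hε => ?_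
    obtain ⟨k, hk⟩ := (TopologicalSpace.denseRange_denseSeq Y).exists_dist_lt t
      (show 0 < ε / 3 by positivity)
    have h1 : CauchySeq fun n => c (φ n) (q k) := ((tendsto_pi_nhds.1 hg) k).cauchySeq
    obtain ⟨N, hN⟩ := Metric.cauchySeq_iff'.1 h1 (ε / 3) (by positivity)
    refine ⟨N, fun n hn => ?_⟩
    have h2 := hN n hn
    have h3 := dist_triangle4 (c (φ n) t) (c (φ n) (q k)) (c (φ N) (q k)) (c (φ N) t)
    have h4 := hd (φ n) t (q k)
    have h5 := hd (φ N) (q k) t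
    rw [dist_comm (q k) t] at h5
    change dist t (q k) < ε / 3 at hk
    linarith
  choose c' hc' using fun t => cauchySeq_tendsto_of_complete (hcau t)
  refine ⟨φ, hφ, c', LipschitzWith.of_dist_le_mul fun s t => ?_, hc'⟩
  rw [NNReal.coe_one, one_mul]
  exact le_of_tendsto' ((hc' s).dist (hc' t)) fun n => hd (φ n) s t

theorem tendstoUniformlyOn_of_lipschitz {c : ℕ → Y → X} (hc : ∀ n, LipschitzWith 1 (c n))
    {c' : Y → X} (hc' : LipschitzWith 1 c') (h : ∀ t, Tendsto (fun n => c n t) atTop (𝓝 (c' t)))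
    {K : Set Y} (hK : IsCompact K) : TendstoUniformlyOn c c' atTop K := by
  refine Metric.tendstoUniformlyOn_iff.2 fun ε hε => ?_
  obtain ⟨s, hs, hcov⟩ := totallyBounded_iff.1 hK.totallyBounded (ε / 3) (by positivity)
  have hev : ∀ᶠ n in atTop, ∀ y ∈ s, dist (c n y) (c' y) < ε / 3 :=
    (eventually_all_finite hs).2 fun y _ => Metric.tendsto_nhds.1 (h y) (ε / 3) (by positivity)
  filter_upwards [hev] with n hn t ht
  obtain ⟨y, hy, hty⟩ := mem_iUnion₂.1 (hcov ht)
  rw [mem_ball] at hty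
  have h1 : dist (c' t) (c' y) ≤ dist t y := by simpa using hc'.dist_le_mul t y
  have h2 : dist (c n y) (c n t) ≤ dist y t := by simpa using (hc n).dist_le_mul y t
  have h3 := hn y hy
  have h4 := dist_triangle4 (c' t) (c' y) (c n y) (c n t)
  rw [dist_comm (c n y)] at h3
  rw [dist_comm y] at h2
  linarith

end Limits

/-! ### Thin triangles and the four point condition. -/

section Hyperbolicity

variable {X : Type*} [MetricSpace X]

theorem edist_eq_edist_iff_dist_eq {x y : X} {s t : ℝ} :
    edist x y = edist s t ↔ dist x y = |s - t| := by
  rw [edist_dist, edist_dist, ENNReal.ofReal_eq_ofReal_iff dist_nonneg dist_nonneg, Real.dist_eq]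

theorem isGeodesicSegment_iff {S : Set X} {x y : X} :
    IsGeodesicSegment S x y ↔ ∃ c : ℝ → X, c 0 = x ∧ c (dist x y) = y ∧
      (∀ s ∈ Icc 0 (dist x y), ∀ t ∈ Icc 0 (dist x y), dist (c s) (c t) = |s - t|) ∧
      S = c '' Icc 0 (dist x y) := by
  constructor
  · rintro ⟨L, c, hL, h0, h1, h, rfl⟩
    have : dist x y = L := by
      have := edist_eq_edist_iff_dist_eq.1 (h 0 ⟨le_rfl, hL⟩ L ⟨hL, le_rfl⟩)
      rwa [h0, h1, zero_sub, abs_neg, abs_of_nonneg hL] at this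
    rw [this]
    exact ⟨c, h0, h1, fun s hs t ht => edist_eq_edist_iff_dist_eq.1 (h s hs t ht), rfl⟩
  · rintro ⟨c, h0, h1, h, rfl⟩
    exact ⟨_, c, dist_nonneg, h0, h1,
      fun s hs t ht => edist_eq_edist_iff_dist_eq.2 (h s hs t ht), rfl⟩

theorem exists_isGeodesicSegment [IsGeodesicSpace X] (x y : X) :
    ∃ S, IsGeodesicSegment S x y := by
  obtain ⟨c, h0, h1, h⟩ := IsGeodesicSpace.exists_geodesic x y
  exact ⟨_, isGeodesicSegment_iff.2 ⟨c, h0, h1, h, rfl⟩⟩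

theorem IsGeodesicSegment.dist_add_dist {S : Set X} {x y p : X} (h : IsGeodesicSegment S x y)
    (hp : p ∈ S) : dist x p + dist p y = dist x y := by
  obtain ⟨c, h0, h1, h', rfl⟩ := isGeodesicSegment_iff.1 h
  obtain ⟨t, ht, rfl⟩ := hp
  have h2 := h' 0 ⟨le_rfl, dist_nonneg⟩ t ht
  have h3 := h' t ht _ ⟨dist_nonneg, le_rfl⟩
  rw [h0, zero_sub, abs_neg, abs_of_nonneg ht.1] at h2
  rw [h1, abs_sub_comm, abs_of_nonneg (sub_nonneg.2 ht.2)] at h3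
  rw [h2, h3]; ring

theorem IsGeodesicSegment.exists_dist_eq {S : Set X} {x y : X} (h : IsGeodesicSegment S x y)
    {s : ℝ} (hs : s ∈ Icc 0 (dist x y)) : ∃ p ∈ S, dist x p = s ∧ dist p y = dist x y - s := by
  obtain ⟨c, h0, h1, h', rfl⟩ := isGeodesicSegment_iff.1 h
  have h2 := h' 0 ⟨le_rfl, dist_nonneg⟩ s hs
  rw [h0, zero_sub, abs_neg, abs_of_nonneg hs.1] at h2
  have := h.dist_add_dist (mem_image_of_mem c hs)
  exact ⟨_, mem_image_of_mem c hs, h2, by linarith⟩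

theorem IsGeodesicSegment.left_mem {S : Set X} {x y : X} (h : IsGeodesicSegment S x y) :
    x ∈ S := by
  obtain ⟨c, h0, h1, h', rfl⟩ := isGeodesicSegment_iff.1 h
  exact ⟨0, ⟨le_rfl, dist_nonneg⟩, h0⟩

theorem IsGeodesicSegment.right_mem {S : Set X} {x y : X} (h : IsGeodesicSegment S x y) :
    y ∈ S := by
  obtain ⟨c, h0, h1, h', rfl⟩ := isGeodesicSegment_iff.1 h
  exact ⟨_, ⟨dist_nonneg, le_rfl⟩, h1⟩

theorem IsGeodesicSegment.isConnected {S : Set X} {x y : X} (h : IsGeodesicSegment S x y) :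
    IsConnected S := by
  obtain ⟨c, h0, h1, h', rfl⟩ := isGeodesicSegment_iff.1 h
  refine (isConnected_Icc dist_nonneg).image c ?_
  refine LipschitzOnWith.continuousOn (K := 1) (LipschitzOnWith.of_dist_le_mul fun s hs t ht => ?_)
  rw [h' s hs t ht, NNReal.coe_one, one_mul, Real.dist_eq]

theorem exists_dist_lt_of_infEDist_le {a : X} {S : Set X} {δ : ℝ}
    (hδ : 0 < δ) (h : infEDist a S ≤ ENNReal.ofReal δ) : ∃ p ∈ S, dist a p < δ + 1 := by
  obtain ⟨p, hp, hap⟩ := infEDist_lt_iff.1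
    (h.trans_lt ((ENNReal.ofReal_lt_ofReal_iff (by linarith)).2 (lt_add_one δ)))
  rw [edist_dist, ENNReal.ofReal_lt_ofReal_iff (by linarith)] at hap
  exact ⟨p, hp, hap⟩

variable (X) in
/-- Gromov's four point condition. -/
def FourPointCondition (δ : ℝ) : Prop :=
  ∀ x y z w : X, dist x y + dist z w ≤
    max (dist x z + dist y w) (dist x w + dist y z) + δ

/-- The connected side `[x, y]` is covered by the closed `δ`-neighborhoods of `[y, o]` and `[o, x]`,
so some `m` on it is close to both, and `d(o, m)` is nearly the Gromov product of `x, y`. Thinness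
of `x, y, z` puts `m` near a point `w` of another side, and `d(o, w)` bounds the product of the ends
of that side from above. -/
theorem IsGromovHyperbolic.fourPointCondition [IsGeodesicSpace X] (h : IsGromovHyperbolic X) :
    ∃ δ, FourPointCondition X δ := by
  obtain ⟨δ, hδ, hthin⟩ := h
  refine ⟨6 * (δ + 1), fun x y z o => ?_⟩
  obtain ⟨S, hS⟩ := exists_isGeodesicSegment x y
  obtain ⟨m, hm, hom⟩ : ∃ m ∈ S, 2 * dist o m ≤ dist o x + dist o y - dist x y + 4 * (δ + 1) := by
    obtain ⟨S₂, hS₂⟩ := exists_isGeodesicSegment y o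
    obtain ⟨S₃, hS₃⟩ := exists_isGeodesicSegment o x
    obtain ⟨m, hmS, hm2, hm3⟩ := isPreconnected_closed_iff.1 hS.isConnected.isPreconnected
      {a | infEDist a S₂ ≤ ENNReal.ofReal δ} {a | infEDist a S₃ ≤ ENNReal.ofReal δ}
      (isClosed_le continuous_infEDist continuous_const)
      (isClosed_le continuous_infEDist continuous_const)
      (fun a ha => by
        have := hthin x y o S S₂ S₃ hS hS₂ hS₃ a ha
        rw [infEDist_union] at this
        exact min_le_iff.1 this)
      ⟨y, hS.right_mem, by simp [infEDist_zero_of_mem hS₂.left_mem]⟩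
      ⟨x, hS.left_mem, by simp [infEDist_zero_of_mem hS₃.right_mem]⟩
    obtain ⟨p, hp, hmp⟩ := exists_dist_lt_of_infEDist_le hδ hm2
    obtain ⟨q, hq, hmq⟩ := exists_dist_lt_of_infEDist_le hδ hm3
    refine ⟨m, hmS, ?_⟩
    have h1 := hS₂.dist_add_dist hp
    have h2 := hS₃.dist_add_dist hq
    have h3 := hS.dist_add_dist hmS
    have := dist_triangle m p o
    have := dist_triangle y p m
    have := dist_triangle m q o
    have := dist_triangle m q x
    linarith [dist_comm p m, dist_comm q m, dist_comm m o, dist_comm m x, dist_comm q x,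
      dist_comm q o, dist_comm y m, dist_comm p o, dist_comm y o]
  obtain ⟨S₂, hS₂⟩ := exists_isGeodesicSegment y z
  obtain ⟨S₃, hS₃⟩ := exists_isGeodesicSegment z x
  obtain ⟨w, hw, hmw⟩ := exists_dist_lt_of_infEDist_le hδ (hthin x y z S S₂ S₃ hS hS₂ hS₃ m hm)
  have h1 := dist_triangle o m w
  rw [← sub_le_iff_le_add]
  rcases hw with hw | hw
  · have := hS₂.dist_add_dist hw
    have := dist_triangle o w y
    have := dist_triangle o w z
    refine le_max_of_le_right ?_
    linarith [dist_comm y o, dist_comm z o, dist_comm x o, dist_comm y w]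
  · have := hS₃.dist_add_dist hw
    have := dist_triangle o w x
    have := dist_triangle o w z
    refine le_max_of_le_left ?_
    linarith [dist_comm y o, dist_comm z o, dist_comm x o, dist_comm x z, dist_comm z w]

theorem FourPointCondition.dist_le_of_isGeodesicSegment {δ : ℝ} (h : FourPointCondition X δ)
    {S : Set X} {x z : X} (hS : IsGeodesicSegment S x z) (a : X) :
    ∃ b ∈ S, 2 * dist a b ≤ dist x a + dist a z - dist x z + 2 * δ := by
  -- The tripod point of `x, z, a` on `[x, z]`: there the two terms of the maximum coincide.
  obtain ⟨b, hb, h1, h2⟩ := hS.exists_dist_eq (s := (dist x a + dist x z - dist a z) / 2)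
    ⟨by linarith [dist_triangle a x z, dist_comm a x],
      by linarith [dist_triangle x z a, dist_comm z a]⟩
  refine ⟨b, hb, ?_⟩
  have := h x z a b
  rw [dist_comm z b, dist_comm z a, h1, h2, ← sub_le_iff_le_add, le_max_iff] at this
  rcases this with h | h <;> linarith

/-- For `a` on `[x, y]`, the condition says that `a` lies almost between `z` and one of `x, y`,
hence close to the corresponding side. -/
theorem FourPointCondition.isGromovHyperbolic {δ : ℝ} (h : FourPointCondition X δ) :
    IsGromovHyperbolic X := by
  refine ⟨2 * |δ| + 1, by positivity, fun x y z S₁ S₂ S₃ h₁ h₂ h₃ a ha => ?_⟩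
  obtain ⟨b₂, hb₂, h2⟩ := h.dist_le_of_isGeodesicSegment h₂ a
  obtain ⟨b₃, hb₃, h3⟩ := h.dist_le_of_isGeodesicSegment h₃ a
  have h1 := h₁.dist_add_dist ha
  have hδ := le_abs_self δ
  have hδ' := abs_nonneg δ
  have h4 := h x y z a
  rw [← sub_le_iff_le_add, le_max_iff] at h4
  suffices ∃ b ∈ S₂ ∪ S₃, dist a b ≤ 2 * |δ| + 1 by
    obtain ⟨b, hb, hab⟩ := this
    refine (infEDist_le_edist_of_mem hb).trans ?_
    rw [edist_dist]
    exact ENNReal.ofReal_le_ofReal hab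
  rcases h4 with h4 | h4
  · refine ⟨b₃, Or.inr hb₃, ?_⟩
    linarith [dist_comm z x, dist_comm z a, dist_comm a x, dist_comm y a]
  · refine ⟨b₂, Or.inl hb₂, ?_⟩
    linarith [dist_comm y a, dist_comm z a]

end Hyperbolicity

/-! ### Compactness of generalized rays and the Gromov topology. -/

section GeneralizedRays

/-- The arc length parameter `t` stopped at the length `R`. -/
def stoppedTime (R : ℝ≥0∞) (t : ℝ≥0) : ℝ := (min (t : ℝ≥0∞) R).toReal

theorem stoppedTime_of_le {R : ℝ≥0∞} {t : ℝ≥0} (h : (t : ℝ≥0∞) ≤ R) : stoppedTime R t = t := by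
  simp [stoppedTime, h]

theorem stoppedTime_of_ge {R : ℝ≥0∞} {t : ℝ≥0} (h : R ≤ (t : ℝ≥0∞)) :
    stoppedTime R t = R.toReal := by
  simp [stoppedTime, h]

theorem stoppedTime_zero (R : ℝ≥0∞) : stoppedTime R 0 = 0 := by simp [stoppedTime]

theorem stoppedTime_nonneg (R : ℝ≥0∞) (t : ℝ≥0) : 0 ≤ stoppedTime R t := ENNReal.toReal_nonneg

theorem stoppedTime_mono (R : ℝ≥0∞) : Monotone (stoppedTime R) := fun _ _ hst =>
  ENNReal.toReal_mono (ne_top_of_le_ne_top ENNReal.coe_ne_top (min_le_left _ _))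
    (min_le_min_right _ (ENNReal.coe_le_coe.2 hst))

theorem abs_stoppedTime_sub_le (R : ℝ≥0∞) (s t : ℝ≥0) :
    |stoppedTime R s - stoppedTime R t| ≤ |(s : ℝ) - t| := by
  wlog hst : s ≤ t generalizing s t
  · rw [abs_sub_comm, abs_sub_comm (s : ℝ)]; exact this t s (le_of_not_ge hst)
  have h1 : (s : ℝ) ≤ t := hst
  rw [abs_sub_comm, abs_of_nonneg (sub_nonneg.2 (stoppedTime_mono R hst)), abs_sub_comm,
    abs_of_nonneg (sub_nonneg.2 h1)]
  rcases le_total (s : ℝ≥0∞) R with h | h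
  · rw [stoppedTime_of_le h]
    have : stoppedTime R t ≤ t := by
      simpa [stoppedTime] using ENNReal.toReal_mono ENNReal.coe_ne_top
        (min_le_left (t : ℝ≥0∞) R)
    linarith
  · rw [stoppedTime_of_ge h, stoppedTime_of_ge (h.trans (ENNReal.coe_le_coe.2 hst))]
    linarith

theorem tendsto_stoppedTime {R : ℕ → ℝ≥0∞} {R' : ℝ≥0∞} (h : Tendsto R atTop (𝓝 R')) (t : ℝ≥0) :
    Tendsto (fun n => stoppedTime (R n) t) atTop (𝓝 (stoppedTime R' t)) :=
  (ENNReal.tendsto_toReal (ne_top_of_le_ne_top ENNReal.coe_ne_top (min_le_left _ _))).comp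
    (tendsto_const_nhds.min h)

variable {X : Type*} [MetricSpace X]

theorem GeodesicRay.dist_eq (c : GeodesicRay X) (s t : ℝ≥0) :
    dist (c.toFun s) (c.toFun t) = |(s : ℝ) - t| := by
  rw [c.isometry.dist_eq, NNReal.dist_eq]

/-- A single length `R` in `[0, ∞]` treats segments and rays alike; since `[0, ∞]` is compact,
lengths subconverge together with the curves. -/
theorem IsGeneralizedRay.exists_length {o : X} {c : ℝ≥0 → X} {z : GromovClosure X}
    (h : IsGeneralizedRay o c z) : c 0 = o ∧ ∃ R : ℝ≥0∞,
      (∀ s t, dist (c s) (c t) = |stoppedTime R s - stoppedTime R t|) ∧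
      (∀ x, z = .inner x → ∃ t : ℝ≥0, R = t ∧ c t = x) ∧
      (∀ ξ, z = .ideal ξ → R = ⊤ ∧ ∃ c' : GeodesicRay X, c'.toFun = c ∧ c'.endpoint = ξ) := by
  cases h with
  | segment _ R h0 hiso hconst =>
    refine ⟨h0, R, fun s t => ?_, ?_, by simp⟩
    · have key (t : ℝ≥0) : c t = c (min t R) := by
        rcases le_total t R with h | h
        · rw [min_eq_left h]
        · rw [min_eq_right h, hconst t h]
      have h1 (t : ℝ≥0) : stoppedTime R t = (min t R : ℝ≥0) := by
        rw [stoppedTime, ← ENNReal.coe_min, ENNReal.coe_toReal]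
      rw [key s, key t, h1, h1]
      have := hiso (min s R) (min_le_right _ _) (min t R) (min_le_right _ _)
      rw [edist_dist, edist_dist, ENNReal.ofReal_eq_ofReal_iff dist_nonneg dist_nonneg] at this
      rw [this, NNReal.dist_eq]
    · rintro x ⟨⟩
      exact ⟨R, rfl, rfl⟩
  | ray c h0 =>
    refine ⟨h0, ⊤, fun s t => ?_, by simp, ?_⟩
    · rw [c.dist_eq, stoppedTime_of_le le_top, stoppedTime_of_le le_top]
    · rintro ξ ⟨⟩
      exact ⟨rfl, c, rfl, rfl⟩

theorem IsGeneralizedRay.of_length {o : X} {c : ℝ≥0 → X} (h0 : c 0 = o) {R : ℝ≥0∞}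
    (h : ∀ s t, dist (c s) (c t) = |stoppedTime R s - stoppedTime R t|) :
    ∃ z, IsGeneralizedRay o c z := by
  induction R using ENNReal.recTopCoe with
  | top =>
    refine ⟨_, IsGeneralizedRay.ray ⟨c, Isometry.of_dist_eq fun s t => ?_⟩ h0⟩
    rw [h, stoppedTime_of_le le_top, stoppedTime_of_le le_top, NNReal.dist_eq]
  | coe R =>
    refine ⟨_, IsGeneralizedRay.segment c R h0 (fun s hs t ht => ?_) fun t ht => ?_⟩
    · rw [edist_dist, edist_dist, h, stoppedTime_of_le (ENNReal.coe_le_coe.2 hs),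
        stoppedTime_of_le (ENNReal.coe_le_coe.2 ht), NNReal.dist_eq]
    · rw [← dist_eq_zero, h, stoppedTime_of_ge (ENNReal.coe_le_coe.2 ht),
        stoppedTime_of_ge le_rfl]
      simp

theorem IsGeneralizedRay.lipschitz {o : X} {c : ℝ≥0 → X} {z : GromovClosure X}
    (h : IsGeneralizedRay o c z) : LipschitzWith 1 c := by
  obtain ⟨-, R, hR, -⟩ := h.exists_length
  refine LipschitzWith.of_dist_le_mul fun s t => ?_
  rw [hR, NNReal.coe_one, one_mul, NNReal.dist_eq]
  exact abs_stoppedTime_sub_le R s t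

theorem exists_isGeneralizedRay_inner [IsGeodesicSpace X] (o x : X) :
    ∃ c, IsGeneralizedRay o c (.inner x) := by
  obtain ⟨c, h0, h1, h⟩ := IsGeodesicSpace.exists_geodesic o x
  have h2 := IsGeneralizedRay.segment (o := o) (fun t : ℝ≥0 => c (min t (dist o x)))
    (nndist o x) (by simp [h0]) (fun s hs t ht => ?_) fun t ht => ?_
  · simp only [coe_nndist, min_self, h1] at h2
    exact ⟨_, h2⟩
  · have hs' : (s : ℝ) ≤ dist o x := hs
    have ht' : (t : ℝ) ≤ dist o x := ht
    rw [edist_dist, edist_dist, min_eq_left hs', min_eq_left ht', NNReal.dist_eq]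
    exact congrArg _ (h _ ⟨s.2, hs'⟩ _ ⟨t.2, ht'⟩)
  · have ht' : dist o x ≤ t := ht
    simp [min_eq_right ht']

/-- Generalized rays issuing from a point of a proper space subconverge. -/
theorem exists_subseq_isGeneralizedRay [ProperSpace X] {o : X} {c : ℕ → ℝ≥0 → X}
    {u : ℕ → GromovClosure X} (h : ∀ n, IsGeneralizedRay o (c n) (u n)) :
    ∃ φ : ℕ → ℕ, StrictMono φ ∧ ∃ c' z, IsGeneralizedRay o c' z ∧
      ∀ T : ℝ≥0, TendstoUniformlyOn (fun n => c (φ n)) c' atTop (Iic T) := by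
  obtain ⟨φ, hφ, c', hc', hlim⟩ := exists_subseq_tendsto_of_lipschitz c
    (fun n => (h n).lipschitz) 0 (x₀ := o) (B := 0) (fun n => by rw [(h n).exists_length.1, dist_self])
  choose R hR using fun n => (h n).exists_length.2
  obtain ⟨R', ψ, hψ, hR'⟩ := CompactSpace.tendsto_subseq (R ∘ φ)
  have h0 : c' 0 = o := tendsto_nhds_unique (hlim 0)
    (by simp [fun n => (h n).exists_length.1])
  have hdist (s t : ℝ≥0) : dist (c' s) (c' t) = |stoppedTime R' s - stoppedTime R' t| := by
    have h1 := ((hlim s).dist (hlim t)).comp hψ.tendsto_atTop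
    have h2 := ((tendsto_stoppedTime hR' s).sub (tendsto_stoppedTime hR' t)).abs
    refine tendsto_nhds_unique h1 (h2.congr fun n => ?_)
    exact ((hR (φ (ψ n))).1 s t).symm
  obtain ⟨z, hz⟩ := IsGeneralizedRay.of_length h0 hdist
  refine ⟨φ ∘ ψ, hφ.comp hψ, c', z, hz, fun T => ?_⟩
  have hcpt : IsCompact (Iic T) := by
    have : Iic T = Icc 0 T := by ext; simp
    rw [this]; exact isCompact_Icc
  exact tendstoUniformlyOn_of_lipschitz (fun n => (h _).lipschitz) hc'
    (fun t => (hlim t).comp hψ.tendsto_atTop) hcpt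

theorem gromovConverges_of_tendsto {o : X} {c : ℕ → ℝ≥0 → X}
    {u : ℕ → GromovClosure X} (h : ∀ n, IsGeneralizedRay o (c n) (u n)) {c' : ℝ≥0 → X}
    {z : GromovClosure X} (hz : IsGeneralizedRay o c' z)
    (hc : ∀ T : ℝ≥0, TendstoUniformlyOn c c' atTop (Iic T)) : GromovConverges o u z := by
  refine ⟨c, h, fun φ hφ => ⟨id, strictMono_id, c', hz, fun T => ?_⟩⟩
  have := hc T
  rw [tendstoUniformlyOn_iff_tendsto] at this ⊢
  exact this.comp (hφ.tendsto_atTop.prodMap tendsto_id)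

theorem isClosed_gromovTopology_iff {o : X} {B : Set (GromovClosure X)} :
    IsClosed[gromovTopology o] B ↔
      ∀ u z, (∀ n, u n ∈ B) → GromovConverges o u z → z ∈ B := by
  rw [← @isOpen_compl_iff _ _ (gromovTopology o)]
  change Bᶜᶜ ∈ _ ↔ _
  rw [compl_compl]
  rfl

/-- If infinitely many terms miss an open set, they form a subsequence in its complement, which is
closed under such limits by definition. -/
theorem GromovConverges.tendsto {o : X} {u : ℕ → GromovClosure X} {z : GromovClosure X}
    (h : GromovConverges o u z) : Tendsto u atTop (@nhds _ (gromovTopology o) z) := by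
  let := gromovTopology o
  refine tendsto_nhds.2 fun s hs hz => ?_
  by_contra hcon
  obtain ⟨θ, hθ, hmem⟩ := extraction_of_frequently_atTop (not_eventually.1 hcon)
  exact isClosed_gromovTopology_iff.1 hs.isClosed_compl (u ∘ θ) z hmem (h.comp hθ) hz

end GeneralizedRays

/-! ### Estimates for `tanh` and `artanh`. -/

section HyperbolicTangent

theorem Real.tanh_le_self {s : ℝ} (hs : 0 ≤ s) : Real.tanh s ≤ s := by
  have hd (t : ℝ) : HasDerivAt (fun t => t * Real.cosh t - Real.sinh t) (t * Real.sinh t) t := by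
    have := ((hasDerivAt_id' t).mul (Real.hasDerivAt_cosh t)).sub (Real.hasDerivAt_sinh t)
    exact this.congr_deriv (by ring)
  have hmono : MonotoneOn (fun t => t * Real.cosh t - Real.sinh t) (Ici 0) :=
    monotoneOn_of_deriv_nonneg (convex_Ici 0)
      (fun t _ => (hd t).continuousAt.continuousWithinAt)
      (fun t _ => (hd t).differentiableAt.differentiableWithinAt) (fun t ht => by
        rw [interior_Ici] at ht
        rw [(hd t).deriv]
        exact mul_nonneg (le_of_lt ht) (Real.sinh_nonneg_iff.2 (le_of_lt ht)))
  have := hmono (self_mem_Ici (a := (0 : ℝ))) hs hs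
  rw [Real.tanh_eq_sinh_div_cosh, div_le_iff₀ (Real.cosh_pos s)]
  simp at this
  linarith

theorem Real.tanh_strictMono : StrictMono Real.tanh := by
  intro s t hst
  by_contra! h
  have h1 := Real.artanh_le_artanh (Real.neg_one_lt_tanh t) (Real.tanh_lt_one s) h
  rw [Real.artanh_tanh, Real.artanh_tanh] at h1
  exact absurd hst h1.not_gt

theorem Real.tanh_nonneg {s : ℝ} (hs : 0 ≤ s) : 0 ≤ Real.tanh s := by
  simpa using Real.tanh_strictMono.monotone hs

theorem Real.tanh_pos {s : ℝ} (hs : 0 < s) : 0 < Real.tanh s := by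
  simpa using Real.tanh_strictMono hs

theorem Real.tanh_sub (s t : ℝ) :
    Real.tanh (t - s) = (Real.tanh t - Real.tanh s) / (1 - Real.tanh s * Real.tanh t) := by
  have h1 := (Real.cosh_pos s).ne'
  have h2 := (Real.cosh_pos t).ne'
  rw [Real.tanh_eq_sinh_div_cosh, Real.sinh_sub, Real.cosh_sub, Real.tanh_eq_sinh_div_cosh,
    Real.tanh_eq_sinh_div_cosh]
  have h3 : Real.cosh t * Real.cosh s - Real.sinh t * Real.sinh s ≠ 0 := by
    rw [← Real.cosh_sub]; exact (Real.cosh_pos _).ne'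
  have h4 : 1 - Real.sinh s / Real.cosh s * (Real.sinh t / Real.cosh t) ≠ 0 := by
    intro h
    apply h3
    field_simp at h
    linarith
  field_simp

theorem Real.artanh_le_div {q : ℝ} (h0 : 0 ≤ q) (h1 : q < 1) :
    Real.artanh q ≤ q / (1 - q) := by
  rw [Real.artanh_eq_half_log ⟨by linarith, h1.le⟩]
  have h2 : 0 < 1 - q := by linarith
  have h3 := Real.log_le_sub_one_of_pos (show 0 < (1 + q) / (1 - q) by positivity)
  have h4 : (1 + q) / (1 - q) - 1 = 2 * (q / (1 - q)) := by field_simp; ring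
  linarith

end HyperbolicTangent

/-! ### Holomorphic discs, chains, and comparison with the Euclidean distance. -/

section Discs

variable {E : Type*} [NormedAddCommGroup E] [NormedSpace ℂ E]

/-- `f` restricts to a holomorphic map from the unit disc to `Ω`. -/
def IsDisc (Ω : Set E) (f : ℂ → E) : Prop :=
  DifferentiableOn ℂ f (ball 0 1) ∧ MapsTo f (ball 0 1) Ω

/-- The right side is positive on the disc, so the Möbius map `w ↦ (a + w) / (1 + conj a * w)`
preserves it. -/
theorem normSq_one_add_sub (a w : ℂ) :
    ‖1 + (starRingEnd ℂ) a * w‖ ^ 2 - ‖a + w‖ ^ 2 = (1 - ‖a‖ ^ 2) * (1 - ‖w‖ ^ 2) := by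
  simp only [Complex.sq_norm, Complex.normSq_apply, Complex.add_re, Complex.add_im,
    Complex.mul_re, Complex.mul_im, Complex.conj_re, Complex.conj_im, Complex.one_re,
    Complex.one_im]
  ring

/-- Precomposition with a disc automorphism moves a pair of points of the disc to `0` and the
positive axis. -/
theorem IsDisc.exists_normalized {Ω : Set E} {f : ℂ → E} (hf : IsDisc Ω f) {a b : ℂ}
    (ha : ‖a‖ < 1) (hb : ‖b‖ < 1) : ∃ g, IsDisc Ω g ∧ 0 ≤ poincareDist a b ∧
      g 0 = f a ∧ g (Real.tanh (poincareDist a b)) = f b := by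
  have hden : ∀ w : ℂ, ‖w‖ < 1 → 1 + (starRingEnd ℂ) a * w ≠ 0 := by
    intro w hw h
    have h1 : ‖(starRingEnd ℂ) a * w‖ = 1 := by
      rw [eq_neg_of_add_eq_zero_right h, norm_neg, norm_one]
    rw [norm_mul, RCLike.norm_conj] at h1
    nlinarith [norm_nonneg a, norm_nonneg w]
  have hlt : ∀ w : ℂ, ‖w‖ < 1 → ‖(a + w) / (1 + (starRingEnd ℂ) a * w)‖ < 1 := by
    intro w hw
    rw [norm_div, div_lt_one (norm_pos_iff.2 (hden w hw))]
    have h1 := normSq_one_add_sub a w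
    have h2 : 0 < (1 - ‖a‖ ^ 2) * (1 - ‖w‖ ^ 2) := by
      apply mul_pos <;> nlinarith [norm_nonneg a, norm_nonneg w]
    exact lt_of_pow_lt_pow_left₀ 2 (norm_nonneg _) (by linarith)
  have hbden : 1 - (starRingEnd ℂ) a * b ≠ 0 := by
    have := hden (-b) (by simpa using hb)
    simpa [sub_eq_add_neg] using this
  set β := (b - a) / (1 - (starRingEnd ℂ) a * b) with hβ
  have hβn : ‖β‖ < 1 := by
    have h1 := normSq_one_add_sub (-a) b
    have h2 : 0 < (1 - ‖a‖ ^ 2) * (1 - ‖b‖ ^ 2) := by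
      apply mul_pos <;> nlinarith [norm_nonneg a, norm_nonneg b]
    rw [norm_neg, map_neg] at h1
    rw [hβ, norm_div, div_lt_one (norm_pos_iff.2 hbden)]
    refine lt_of_pow_lt_pow_left₀ 2 (norm_nonneg _) ?_
    rw [show -a + b = b - a by ring, show 1 + -(starRingEnd ℂ) a * b
      = 1 - (starRingEnd ℂ) a * b by ring] at h1
    linarith
  have hdist : poincareDist a b = Real.artanh ‖β‖ := by
    rw [poincareDist, hβ, norm_div, norm_sub_rev]
  have hnn : 0 ≤ poincareDist a b := by
    rw [hdist]; exact Real.artanh_nonneg (norm_nonneg _)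
  -- A rotation taking the positive axis to the direction of `β`; any rotation will do if `β = 0`.
  obtain ⟨u, hu, huβ⟩ : ∃ u : ℂ, ‖u‖ = 1 ∧ u * ‖β‖ = β := by
    by_cases h : β = 0
    · exact ⟨1, by simp, by simp [h]⟩
    · have h' : (‖β‖ : ℂ) ≠ 0 := by simpa using h
      exact ⟨β / ‖β‖, by simp [norm_pos_iff.2 h |>.ne'], by field_simp⟩
  have hmob : MapsTo (fun w => (a + u * w) / (1 + (starRingEnd ℂ) a * (u * w))) (ball 0 1)
      (ball 0 1) := by
    intro w hw
    rw [mem_ball_zero_iff] at hw ⊢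
    exact hlt _ (by rwa [norm_mul, hu, one_mul])
  refine ⟨fun w => f ((a + u * w) / (1 + (starRingEnd ℂ) a * (u * w))), ⟨?_, hf.2.comp hmob⟩,
    hnn, by simp, ?_⟩
  · refine hf.1.comp (fun w hw => ?_) hmob
    refine DifferentiableAt.differentiableWithinAt ?_
    refine DifferentiableAt.div (by fun_prop) (by fun_prop) (hden _ ?_)
    rwa [norm_mul, hu, one_mul, ← mem_ball_zero_iff]
  · simp only
    rw [hdist, Real.tanh_artanh ⟨by linarith [norm_nonneg β], hβn⟩, huβ]
    congr 1
    have h1 := hden β hβn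
    rw [div_eq_iff h1, hβ]
    generalize (starRingEnd ℂ) a = e at hbden
    have h2 : (b - a) / (1 - e * b) * (1 - e * b) = b - a := div_mul_cancel₀ _ hbden
    linear_combination h2

theorem poincareDist_zero_left (w : ℂ) : poincareDist 0 w = Real.artanh ‖w‖ := by
  simp [poincareDist]

theorem poincareDist_tanh {s t : ℝ} (hst : s ≤ t) :
    poincareDist (Real.tanh s) (Real.tanh t) = t - s := by
  have h1 : ‖(Real.tanh s : ℂ) - Real.tanh t‖ = Real.tanh t - Real.tanh s := by
    rw [← Complex.ofReal_sub, Complex.norm_real, Real.norm_eq_abs, abs_sub_comm, abs_of_nonneg]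
    exact sub_nonneg.2 (Real.tanh_strictMono.monotone hst)
  have h2 : ‖1 - (starRingEnd ℂ) (Real.tanh s : ℂ) * Real.tanh t‖
      = 1 - Real.tanh s * Real.tanh t := by
    rw [Complex.conj_ofReal, ← Complex.ofReal_mul, ← Complex.ofReal_one, ← Complex.ofReal_sub,
      Complex.norm_real, Real.norm_eq_abs, abs_of_nonneg]
    have := abs_le.1 (Real.abs_tanh_lt_one s).le
    have := abs_le.1 (Real.abs_tanh_lt_one t).le
    nlinarith
  rw [poincareDist, h1, h2, ← Real.tanh_sub, Real.artanh_tanh]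

theorem norm_tanh_lt_one (s : ℝ) : ‖(Real.tanh s : ℂ)‖ < 1 := by
  rw [Complex.norm_real]; exact Real.abs_tanh_lt_one s

theorem KobayashiChain.edist_le {Ω : Set E} {x y : E} {ℓ : ℝ≥0∞} (h : KobayashiChain Ω x y ℓ) :
    kobayashiEDist Ω x y ≤ ℓ := iInf₂_le ℓ h

theorem IsDisc.edist_le {Ω : Set E} {f : ℂ → E} (hf : IsDisc Ω f) {a b : ℂ}
    (ha : ‖a‖ < 1) (hb : ‖b‖ < 1) :
    kobayashiEDist Ω (f a) (f b) ≤ ENNReal.ofReal (poincareDist a b) := by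
  rw [← mem_ball_zero_iff] at ha hb
  simpa using (KobayashiChain.cons hf.1 hf.2 ha hb rfl rfl (.nil (hf.2 hb))).edist_le

theorem IsDisc.edist_tanh_le {Ω : Set E} {f : ℂ → E} (hf : IsDisc Ω f) {s t : ℝ} (hst : s ≤ t) :
    kobayashiEDist Ω (f (Real.tanh s)) (f (Real.tanh t)) ≤ ENNReal.ofReal (t - s) := by
  rw [← poincareDist_tanh hst]
  exact hf.edist_le (norm_tanh_lt_one s) (norm_tanh_lt_one t)

theorem IsDisc.edist_zero_tanh_le {Ω : Set E} {f : ℂ → E} (hf : IsDisc Ω f) {t : ℝ}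
    (ht : 0 ≤ t) : kobayashiEDist Ω (f 0) (f (Real.tanh t)) ≤ ENNReal.ofReal t := by
  simpa using hf.edist_tanh_le ht

theorem kobayashiEDist_triangle (Ω : Set E) (x y z : E) :
    kobayashiEDist Ω x z ≤ kobayashiEDist Ω x y + kobayashiEDist Ω y z := by
  simp only [kobayashiEDist, ENNReal.iInf_add, ENNReal.add_iInf]
  exact le_iInf₂ fun ℓ' h' => le_iInf₂ fun ℓ h => iInf₂_le _ (h.append h')

theorem kobayashiEDist_self {Ω : Set E} {x : E} (hx : x ∈ Ω) : kobayashiEDist Ω x x = 0 :=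
  le_antisymm (iInf₂_le 0 (.nil hx)) bot_le

theorem kobayashiEDist_comm (Ω : Set E) (x y : E) :
    kobayashiEDist Ω x y = kobayashiEDist Ω y x :=
  le_antisymm
    (le_iInf₂ fun ℓ h => iInf₂_le ℓ h.reverse) (le_iInf₂ fun ℓ h => iInf₂_le ℓ h.reverse)

theorem kobayashiEDist_mono {Ω Ω' : Set E} (h : Ω ⊆ Ω') (x y : E) :
    kobayashiEDist Ω' x y ≤ kobayashiEDist Ω x y := by
  refine le_iInf₂ fun ℓ hℓ => KobayashiChain.edist_le ?_
  induction hℓ with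
  | nil hx => exact .nil (h hx)
  | cons hf hm ha hb hx hx' _ ih => exact .cons hf (hm.mono_right h) ha hb hx hx' ih

/-- Induction on chains of discs in normal position. -/
theorem KobayashiChain.induction_normalized {Ω : Set E} {P : E → E → ℝ≥0∞ → Prop}
    (nil : ∀ x ∈ Ω, P x x 0)
    (cons : ∀ (f : ℂ → E) (s : ℝ) (y : E) (ℓ : ℝ≥0∞), IsDisc Ω f → 0 ≤ s →
      KobayashiChain Ω (f (Real.tanh s)) y ℓ → P (f (Real.tanh s)) y ℓ →
      P (f 0) y (ENNReal.ofReal s + ℓ))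
    {x y : E} {ℓ : ℝ≥0∞} (h : KobayashiChain Ω x y ℓ) : P x y ℓ := by
  induction h with
  | nil hx => exact nil _ hx
  | cons hf hm ha hb hx hx' htail ih =>
    rw [mem_ball_zero_iff] at ha hb
    obtain ⟨g, hg, hnn, h0, h1⟩ := IsDisc.exists_normalized ⟨hf, hm⟩ ha hb
    rw [hx] at h0
    rw [hx'] at h1
    rw [← h0]
    rw [← h1] at htail ih
    exact cons g _ _ _ hg hnn htail ih

/-- Cut the chain at arc length about `s`. The disc containing the cut is divided at a point of its
radius, along which `tanh` is the arc length parametrization. -/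
theorem KobayashiChain.exists_split {Ω : Set E} {x y : E} {ℓ : ℝ≥0∞}
    (h : KobayashiChain Ω x y ℓ) : ∀ s t : ℝ, 0 < s → 0 < t →
      ℓ < ENNReal.ofReal (s + t) → ∃ z ∈ Ω, kobayashiEDist Ω x z < ENNReal.ofReal s ∧
        kobayashiEDist Ω z y < ENNReal.ofReal t := by
  refine KobayashiChain.induction_normalized (P := fun x y ℓ => ∀ s t : ℝ, 0 < s → 0 < t →
      ℓ < ENNReal.ofReal (s + t) → ∃ z ∈ Ω, kobayashiEDist Ω x z < ENNReal.ofReal s ∧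
        kobayashiEDist Ω z y < ENNReal.ofReal t) ?_ ?_ h
  · intro x hx s t hs ht _
    exact ⟨x, hx, by simpa [kobayashiEDist_self hx], by simpa [kobayashiEDist_self hx]⟩
  · intro f p y ℓ hf hp htail ih s t hs ht hlt
    have hℓ : ℓ ≠ ⊤ := ne_top_of_lt (lt_of_le_of_lt le_add_self hlt)
    lift ℓ to ℝ≥0 using hℓ
    rw [← ENNReal.ofReal_coe_nnreal, ← ENNReal.ofReal_add hp ℓ.coe_nonneg,
      ENNReal.ofReal_lt_ofReal_iff (by positivity)] at hlt
    rw [← ENNReal.ofReal_coe_nnreal] at htail ih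
    rcases lt_or_ge p s with hps | hps
    · obtain ⟨z, hz, h1, h2⟩ := ih (s - p) t (by linarith) ht
        ((ENNReal.ofReal_lt_ofReal_iff (by linarith)).2 (by linarith))
      refine ⟨z, hz, ?_, h2⟩
      calc kobayashiEDist Ω (f 0) z ≤ _ := kobayashiEDist_triangle Ω _ (f (Real.tanh p)) _
        _ < ENNReal.ofReal p + ENNReal.ofReal (s - p) :=
          ENNReal.add_lt_add_of_le_of_lt
            (ne_top_of_le_ne_top ENNReal.ofReal_ne_top (hf.edist_zero_tanh_le hp))
            (hf.edist_zero_tanh_le hp) h1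
        _ = ENNReal.ofReal s := by rw [← ENNReal.ofReal_add hp (by linarith)]; congr 1; ring
    -- The midpoint of the admissible cuts `(p + ℓ - t, s)`, truncated at `0`.
    · set q := max 0 ((s + (p + ℓ - t)) / 2) with hq
      have hq0 : 0 ≤ q := le_max_left _ _
      have hq1 : q < s := max_lt hs (by linarith)
      have hq2 : (p - q) + ℓ < t := by
        have := le_max_right 0 ((s + (p + ℓ - t)) / 2)
        linarith
      have hℓ0 : (0 : ℝ) ≤ ℓ := ℓ.2
      refine ⟨f (Real.tanh q), hf.2 (mem_ball_zero_iff.2 (norm_tanh_lt_one q)), ?_, ?_⟩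
      · exact (hf.edist_zero_tanh_le hq0).trans_lt
          ((ENNReal.ofReal_lt_ofReal_iff hs).2 hq1)
      · calc kobayashiEDist Ω (f (Real.tanh q)) y
            ≤ _ := kobayashiEDist_triangle Ω _ (f (Real.tanh p)) _
          _ ≤ ENNReal.ofReal (p - q) + ENNReal.ofReal ℓ :=
            add_le_add (hf.edist_tanh_le (by linarith)) htail.edist_le
          _ < ENNReal.ofReal t := by
            rw [← ENNReal.ofReal_add (by linarith) hℓ0]
            exact (ENNReal.ofReal_lt_ofReal_iff ht).2 hq2

/-- The Schwarz lemma: the disc maps into a ball of radius `2 * R` about `f 0`, and `tanh s ≤ s`. -/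
theorem IsDisc.norm_sub_le {Ω : Set E} {R : ℝ} (hR : Ω ⊆ closedBall 0 R) {f : ℂ → E}
    (hf : IsDisc Ω f) {s : ℝ} (hs : 0 ≤ s) : dist (f 0) (f (Real.tanh s)) ≤ 2 * R * s := by
  have hmem : ∀ w ∈ ball (0 : ℂ) 1, ‖f w‖ ≤ R := fun w hw =>
    mem_closedBall_zero_iff.1 (hR (hf.2 hw))
  have h0 := hmem 0 (by simp)
  have h1 : MapsTo f (ball 0 1) (closedBall (f 0) (2 * R)) := fun w hw => by
    rw [mem_closedBall, dist_eq_norm]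
    linarith [_root_.norm_sub_le (f w) (f 0), hmem w hw]
  have hw : (Real.tanh s : ℂ) ∈ ball (0 : ℂ) 1 := mem_ball_zero_iff.2 (norm_tanh_lt_one s)
  have h2 := Complex.dist_le_div_mul_dist_of_mapsTo_ball hf.1 h1 hw
  rw [dist_comm]
  refine h2.trans ?_
  rw [dist_zero_right, Complex.norm_real, Real.norm_eq_abs, abs_of_nonneg (Real.tanh_nonneg hs),
    div_one]
  exact mul_le_mul_of_nonneg_left (Real.tanh_le_self hs)
    (by linarith [norm_nonneg (f 0)])

theorem edist_le_mul_kobayashiEDist {Ω : Set E} {R : ℝ} (hR : Ω ⊆ closedBall 0 R) (hR0 : 0 < R)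
    (x y : E) : edist x y ≤ ENNReal.ofReal (2 * R) * kobayashiEDist Ω x y := by
  have key : ∀ ℓ, KobayashiChain Ω x y ℓ → edist x y ≤ ENNReal.ofReal (2 * R) * ℓ := by
    intro ℓ h
    refine KobayashiChain.induction_normalized
      (P := fun x y ℓ => edist x y ≤ ENNReal.ofReal (2 * R) * ℓ) (by simp) ?_ h
    intro f s y ℓ hf hs _ ih
    rw [mul_add, ← ENNReal.ofReal_mul (by positivity)]
    refine (edist_triangle _ (f (Real.tanh s)) _).trans (add_le_add ?_ ih)
    rw [edist_dist]
    exact ENNReal.ofReal_le_ofReal (hf.norm_sub_le hR hs)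
  have hc : ENNReal.ofReal (2 * R) ≠ 0 := by simpa using hR0
  rw [mul_comm, ← ENNReal.div_le_iff_le_mul (Or.inl hc) (Or.inl ENNReal.ofReal_ne_top)]
  exact le_iInf₂ fun ℓ h => ENNReal.div_le_of_le_mul' (key ℓ h)

/-- Use the affine disc centered at `x` that passes through `y` and fills out radius `r`. -/
theorem kobayashiEDist_le_of_ball_subset {Ω : Set E} {x y : E} {r : ℝ} (hr : 0 < r)
    (hΩ : ball x r ⊆ Ω) (hy : dist y x ≤ r / 2) :
    kobayashiEDist Ω x y ≤ ENNReal.ofReal (2 * dist y x / r) := by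
  rcases eq_or_ne y x with rfl | hne
  · rw [kobayashiEDist_self (hΩ (mem_ball_self hr))]; simp
  have hd : 0 < dist y x := dist_pos.2 hne
  have hd' : (dist y x : ℂ) ≠ 0 := by exact_mod_cast hd.ne'
  set f : ℂ → E := fun w => x + (w * (r / dist y x)) • (y - x) with hf
  have hdisc : IsDisc Ω f := by
    refine ⟨by fun_prop, fun w hw => hΩ ?_⟩
    rw [mem_ball_zero_iff] at hw
    rw [hf, mem_ball, dist_eq_norm, add_sub_cancel_left, norm_smul, ← dist_eq_norm, norm_mul,
      norm_div, Complex.norm_real, Complex.norm_real, Real.norm_of_nonneg hr.le,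
      Real.norm_of_nonneg hd.le, mul_assoc, div_mul_cancel₀ _ hd.ne']
    nlinarith
  have hq : dist y x / r ≤ 1 / 2 := by rw [div_le_iff₀ hr]; linarith
  have hq0 : 0 ≤ dist y x / r := by positivity
  have hnorm : ‖((dist y x / r : ℝ) : ℂ)‖ = dist y x / r := by
    rw [Complex.norm_real, Real.norm_of_nonneg hq0]
  have h0 : f 0 = x := by simp [hf]
  have h1 : f ((dist y x / r : ℝ) : ℂ) = y := by
    have : (r : ℂ) ≠ 0 := by exact_mod_cast hr.ne'
    simp only [hf]
    push_cast
    rw [div_mul_div_cancel₀ this, div_self hd', one_smul, add_sub_cancel]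
  have := hdisc.edist_le (a := 0) (b := ((dist y x / r : ℝ) : ℂ)) (by simp)
    (by rw [hnorm]; linarith)
  rw [h0, h1, poincareDist_zero_left, hnorm] at this
  refine this.trans (ENNReal.ofReal_le_ofReal ((Real.artanh_le_div hq0 (by linarith)).trans ?_))
  rw [div_le_iff₀ (by linarith), mul_div_assoc]
  nlinarith

end Discs

/-! ### The Kobayashi metric space of a bounded domain. -/

section BoundedDomains

theorem KobayashiSpace.ext_val {F : Type*} {Ω : Set F} {x y : KobayashiSpace Ω} (h : x.val = y.val) :
    x = y := by
  cases x; cases y; simpa using h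

variable {E : Type*} [NormedAddCommGroup E] [NormedSpace ℂ E]

/-- Bounded domains: nonempty connected bounded open sets. -/
class IsBoundedDomain (D : Set E) : Prop where
  isOpen : IsOpen D
  isConnected : IsConnected D
  isBounded : Bornology.IsBounded D

/-- The Kobayashi distance as a real number. -/
noncomputable def kobayashiDist (D : Set E) (x y : E) : ℝ := (kobayashiEDist D x y).toReal

theorem kobayashiDist_nonneg (D : Set E) (x y : E) : 0 ≤ kobayashiDist D x y :=
  ENNReal.toReal_nonneg

theorem kobayashiDist_comm (D : Set E) (x y : E) : kobayashiDist D x y = kobayashiDist D y x := by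
  rw [kobayashiDist, kobayashiEDist_comm, kobayashiDist]

theorem kobayashiDist_self {D : Set E} {x : E} (hx : x ∈ D) : kobayashiDist D x x = 0 := by
  simp [kobayashiDist, kobayashiEDist_self hx]

variable {D : Set E} [hD : IsBoundedDomain D]

/-- Being at finite distance is an equivalence relation with open classes on a connected set. -/
theorem kobayashiEDist_ne_top {x y : E} (hx : x ∈ D) (hy : y ∈ D) : kobayashiEDist D x y ≠ ⊤ := by
  refine hD.isConnected.isPreconnected.induction₂ (fun x y => kobayashiEDist D x y ≠ ⊤) ?_ ?_ ?_
    hx hy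
  · intro x hx
    obtain ⟨r, hr, hsub⟩ := Metric.isOpen_iff.1 hD.isOpen x hx
    filter_upwards [mem_nhdsWithin_of_mem_nhds (closedBall_mem_nhds x (half_pos hr))] with y hy
    exact ne_top_of_le_ne_top ENNReal.ofReal_ne_top
      (kobayashiEDist_le_of_ball_subset hr hsub (mem_closedBall.1 hy))
  · intro x y z _ _ _ hxy hyz
    exact ne_top_of_le_ne_top (ENNReal.add_ne_top.2 ⟨hxy, hyz⟩) (kobayashiEDist_triangle D x y z)
  · intro x y _ _ h
    rwa [kobayashiEDist_comm]

theorem ofReal_kobayashiDist {x y : E} (hx : x ∈ D) (hy : y ∈ D) :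
    ENNReal.ofReal (kobayashiDist D x y) = kobayashiEDist D x y :=
  ENNReal.ofReal_toReal (kobayashiEDist_ne_top hx hy)

theorem kobayashiDist_le_iff {x y : E} (hx : x ∈ D) (hy : y ∈ D) {r : ℝ} (hr : 0 ≤ r) :
    kobayashiDist D x y ≤ r ↔ kobayashiEDist D x y ≤ ENNReal.ofReal r := by
  rw [← ofReal_kobayashiDist hx hy, ENNReal.ofReal_le_ofReal_iff hr]

theorem kobayashiDist_triangle {x y z : E} (hx : x ∈ D) (hy : y ∈ D) (hz : z ∈ D) :
    kobayashiDist D x z ≤ kobayashiDist D x y + kobayashiDist D y z := by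
  rw [kobayashiDist_le_iff hx hz (add_nonneg (kobayashiDist_nonneg _ _ _)
    (kobayashiDist_nonneg _ _ _)), ENNReal.ofReal_add (kobayashiDist_nonneg _ _ _)
    (kobayashiDist_nonneg _ _ _), ofReal_kobayashiDist hx hy, ofReal_kobayashiDist hy hz]
  exact kobayashiEDist_triangle _ _ _ _

theorem kobayashiDist_anti {D' : Set E} (h : D ⊆ D') {x y : E} (hx : x ∈ D) (hy : y ∈ D) :
    kobayashiDist D' x y ≤ kobayashiDist D x y :=
  ENNReal.toReal_mono (kobayashiEDist_ne_top hx hy) (kobayashiEDist_mono h x y)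

variable (D) in
theorem exists_dist_le_mul_kobayashiDist :
    ∃ M > 0, ∀ x ∈ D, ∀ y ∈ D, dist x y ≤ M * kobayashiDist D x y := by
  obtain ⟨R, hR, hsub⟩ := hD.isBounded.subset_closedBall_lt 0 0
  refine ⟨2 * R, by positivity, fun x hx y hy => ?_⟩
  have := edist_le_mul_kobayashiEDist hsub hR x y
  rw [← ofReal_kobayashiDist hx hy, ← ENNReal.ofReal_mul (by positivity), edist_dist,
    ENNReal.ofReal_le_ofReal_iff (mul_nonneg (by positivity) (kobayashiDist_nonneg _ _ _))] at this
  exact this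

theorem kobayashiDist_le_of_ball_subset {x y : E} {r : ℝ} (hr : 0 < r)
    (h : ball x r ⊆ D) (hy : dist y x ≤ r / 2) : kobayashiDist D x y ≤ 2 * dist y x / r := by
  rw [kobayashiDist_le_iff (h (mem_ball_self hr)) (h (mem_ball.2 (by linarith))) (by positivity)]
  exact kobayashiEDist_le_of_ball_subset hr h hy

variable (D) in
noncomputable instance instPseudoMetricSpaceKobayashiSpace : PseudoMetricSpace (KobayashiSpace D) :=
  PseudoEMetricSpace.toPseudoMetricSpace fun x y => kobayashiEDist_ne_top x.property y.property

variable (D) in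
noncomputable instance instMetricSpaceKobayashiSpace : MetricSpace (KobayashiSpace D) where
  eq_of_dist_eq_zero := by
    intro x y h
    obtain ⟨M, -, hM⟩ := exists_dist_le_mul_kobayashiDist D
    have h1 := hM _ x.property _ y.property
    have h2 : kobayashiDist D x.val y.val = 0 := h
    rw [h2, mul_zero] at h1
    exact KobayashiSpace.ext_val (dist_le_zero.1 h1)

theorem KobayashiSpace.dist_eq (x y : KobayashiSpace D) :
    dist x y = kobayashiDist D x.val y.val := rfl

/-- The Schwarz lemma bounds the Euclidean distance by `K_D`; inscribed balls bound `K_D` locally by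
the Euclidean distance. -/
theorem KobayashiSpace.isOpenEmbedding_val :
    IsOpenEmbedding (KobayashiSpace.val : KobayashiSpace D → E) := by
  obtain ⟨M, hM0, hM⟩ := exists_dist_le_mul_kobayashiDist D
  refine ⟨⟨isInducing_iff_nhds.2 fun x => le_antisymm ?_ ?_, fun x y => KobayashiSpace.ext_val⟩, ?_⟩
  · rw [← map_le_iff_le_comap]
    refine Metric.tendsto_nhds.2 fun ε hε => ?_
    filter_upwards [ball_mem_nhds x (show 0 < ε / M by positivity)] with y hy
    refine (hM _ y.property _ x.property).trans_lt ?_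
    rw [mem_ball, KobayashiSpace.dist_eq, lt_div_iff₀ hM0] at hy
    linarith
  · refine Metric.nhds_basis_ball.ge_iff.2 fun ε hε => ?_
    obtain ⟨r, hr, hsub⟩ := Metric.isOpen_iff.1 hD.isOpen x.val x.property
    refine ⟨ball x.val (min (r / 2) (ε * r / 2)), ball_mem_nhds _ (by positivity), fun y hy => ?_⟩
    rw [mem_preimage, mem_ball, lt_min_iff] at hy
    rw [mem_ball, dist_comm, KobayashiSpace.dist_eq]
    refine (kobayashiDist_le_of_ball_subset hr hsub hy.1.le).trans_lt ?_
    rw [div_lt_iff₀ hr]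
    linarith [hy.2]
  · convert hD.isOpen
    ext x
    exact ⟨fun ⟨y, hy⟩ => hy ▸ y.property, fun h => ⟨⟨x, h⟩, rfl⟩⟩

theorem KobayashiSpace.continuous_val : Continuous (KobayashiSpace.val : KobayashiSpace D → E) :=
  KobayashiSpace.isOpenEmbedding_val.continuous

theorem KobayashiSpace.tendsto_iff {α : Type*} {l : Filter α} {u : α → KobayashiSpace D}
    {x : KobayashiSpace D} : Tendsto u l (𝓝 x) ↔ Tendsto (fun n => (u n).val) l (𝓝 x.val) :=
  KobayashiSpace.isOpenEmbedding_val.isInducing.tendsto_nhds_iff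

theorem tendsto_kobayashiDist {α : Type*} {l : Filter α} {u : α → E} {x y : E}
    (hu : ∀ n, u n ∈ D) (hx : x ∈ D) (hy : y ∈ D) (h : Tendsto u l (𝓝 x)) :
    Tendsto (fun n => kobayashiDist D (u n) y) l (𝓝 (kobayashiDist D x y)) := by
  have h1 : Tendsto (fun n => (⟨u n, hu n⟩ : KobayashiSpace D)) l (𝓝 ⟨x, hx⟩) :=
    KobayashiSpace.tendsto_iff.2 h
  simpa only [KobayashiSpace.dist_eq] using
    h1.dist (tendsto_const_nhds (x := (⟨y, hy⟩ : KobayashiSpace D)))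

theorem IsCompact.preimage_val {K : Set E} (hK : IsCompact K) (hsub : K ⊆ D) :
    IsCompact (KobayashiSpace.val ⁻¹' K : Set (KobayashiSpace D)) := by
  refine KobayashiSpace.isOpenEmbedding_val.isInducing.isCompact_preimage' hK ?_
  intro x hx
  exact ⟨⟨x, hsub hx⟩, rfl⟩

theorem IsCompact.exists_kobayashiDist_le {K : Set E} (hK : IsCompact K) (hsub : K ⊆ D) {y : E}
    (hy : y ∈ D) : ∃ C, ∀ x ∈ K, kobayashiDist D x y ≤ C := by
  obtain ⟨C, hC⟩ := (hK.preimage_val hsub).isBounded.subset_closedBall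
    (⟨y, hy⟩ : KobayashiSpace D)
  exact ⟨C, fun x hx => hC (a := ⟨x, hsub hx⟩) hx⟩

instance : IsLengthSpace (KobayashiSpace D) where
  exists_split x y s t hs ht h := by
    have h' : kobayashiEDist D x.val y.val < ENNReal.ofReal (s + t) := by
      rw [← ofReal_kobayashiDist x.property y.property]
      exact (ENNReal.ofReal_lt_ofReal_iff (by positivity)).2 h
    simp only [kobayashiEDist, iInf_lt_iff] at h'
    obtain ⟨ℓ, hℓ, hlt⟩ := h'
    obtain ⟨z, hz, h1, h2⟩ := hℓ.exists_split s t hs ht hlt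
    refine ⟨⟨z, hz⟩, ?_, ?_⟩
    · rwa [← ofReal_kobayashiDist x.property hz, ENNReal.ofReal_lt_ofReal_iff hs] at h1
    · rwa [← ofReal_kobayashiDist hz y.property, ENNReal.ofReal_lt_ofReal_iff ht] at h2

instance [ProperSpace E] : LocallyCompactSpace (KobayashiSpace D) :=
  KobayashiSpace.isOpenEmbedding_val.locallyCompactSpace

instance [ProperSpace E] [CompleteSpace (KobayashiSpace D)] : ProperSpace (KobayashiSpace D) :=
  IsLengthSpace.properSpace

theorem IsCompleteHyperbolic.of_completeSpace (h : CompleteSpace (KobayashiSpace D)) :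
    IsCompleteHyperbolic D :=
  ⟨fun _ _ hxy => edist_eq_zero.1 hxy, h⟩

end BoundedDomains

/-! ### Royden's localization and its integrated form. -/

section Localization

variable {E : Type*} [NormedAddCommGroup E] [NormedSpace ℂ E] {Ω U : Set E}

theorem mem_of_ofReal_le_kobayashiEDist {x : E} (hx : x ∈ Ω) {r : ℝ≥0∞} (hr : r ≠ 0)
    (h : ∀ w ∈ Ω, w ∉ U → r ≤ kobayashiEDist Ω x w) : x ∈ Ω ∩ U := by
  refine ⟨hx, ?_⟩
  by_contra hU
  exact hr (le_zero_iff.1 ((h x hx hU).trans (kobayashiEDist_self hx).le))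

/-- Points with `‖w‖ < tanh u` are mapped to distance less than `u` from `f 0`, hence into `U`. So
`f`, rescaled by `tanh u`, is a disc in `Ω ∩ U`. -/
theorem IsDisc.edist_inter_le_artanh {f : ℂ → E} (hf : IsDisc Ω f) {u q : ℝ} (hu : 0 < u)
    (hq0 : 0 ≤ q) (hq : q < Real.tanh u)
    (h : ∀ w ∈ Ω, w ∉ U → ENNReal.ofReal u ≤ kobayashiEDist Ω (f 0) w) :
    kobayashiEDist (Ω ∩ U) (f 0) (f q) ≤ ENNReal.ofReal (Real.artanh (q / Real.tanh u)) := by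
  have hθ := Real.tanh_pos hu
  have hθ' : (Real.tanh u : ℂ) ≠ 0 := by exact_mod_cast hθ.ne'
  have hmaps : MapsTo (fun w : ℂ => Real.tanh u * w) (ball 0 1) (ball 0 1) := by
    intro w hw
    rw [mem_ball_zero_iff] at hw ⊢
    rw [norm_mul]
    have := norm_tanh_lt_one u
    nlinarith [norm_nonneg w, norm_nonneg (Real.tanh u : ℂ)]
  have hdisc : IsDisc (Ω ∩ U) fun w => f (Real.tanh u * w) := by
    refine ⟨hf.1.comp (by fun_prop) hmaps, fun w hw => ⟨hf.2 (hmaps hw), ?_⟩⟩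
    by_contra hU
    have h1 := h _ (hf.2 (hmaps hw)) hU
    have hw1 : ‖(Real.tanh u : ℂ) * w‖ < 1 := mem_ball_zero_iff.1 (hmaps hw)
    have h2 := h1.trans (hf.edist_le (a := 0) (by simp) hw1)
    rw [ENNReal.ofReal_le_ofReal_iff', poincareDist_zero_left] at h2
    have hw2 : ‖(Real.tanh u : ℂ) * w‖ < Real.tanh u := by
      rw [mem_ball_zero_iff] at hw
      rw [norm_mul, Complex.norm_real, Real.norm_of_nonneg hθ.le]
      nlinarith
    have h3 := Real.artanh_lt_artanh (by linarith [norm_nonneg ((Real.tanh u : ℂ) * w)])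
      (Real.tanh_lt_one u) hw2
    rw [Real.artanh_tanh] at h3
    rcases h2 with h2 | h2 <;> linarith
  have hlt : q / Real.tanh u < 1 := (div_lt_one hθ).2 hq
  have hnn : 0 ≤ q / Real.tanh u := by positivity
  have hnorm : ‖((q / Real.tanh u : ℝ) : ℂ)‖ = q / Real.tanh u := by
    rw [Complex.norm_real, Real.norm_of_nonneg hnn]
  have := hdisc.edist_le (a := 0) (b := ((q / Real.tanh u : ℝ) : ℂ)) (by simp)
    (by rw [hnorm]; exact hlt)
  rw [poincareDist_zero_left, hnorm] at this
  simp only [mul_zero, Complex.ofReal_div] at this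
  rwa [mul_div_cancel₀ _ hθ'] at this

/-- Cut the radius into `N` pieces of equal hyperbolic length and rescale the disc around each
division point. As `N → ∞` the total tends to `s / tanh u`. -/
theorem IsDisc.edist_inter_le {f : ℂ → E} (hf : IsDisc Ω f) {u s : ℝ} (hu : 0 < u) (hs : 0 ≤ s)
    (h : ∀ w ∈ Ω, w ∉ U → ENNReal.ofReal s + ENNReal.ofReal u ≤ kobayashiEDist Ω (f 0) w) :
    kobayashiEDist (Ω ∩ U) (f 0) (f (Real.tanh s)) ≤ ENNReal.ofReal (s / Real.tanh u) := by
  have hθ := Real.tanh_pos hu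
  set θ := Real.tanh u with hθdef
  have hfin : ∀ᶠ N : ℕ in atTop, 0 < (N : ℝ) ∧ s / θ / N < 1 := by
    have h1 : Tendsto (fun N : ℕ => s / θ / N) atTop (𝓝 0) := tendsto_const_div_atTop_nhds_zero_nat _
    filter_upwards [h1.eventually_lt_const one_pos, eventually_gt_atTop 0] with N h2 h3
    exact ⟨by exact_mod_cast h3, h2⟩
  have hlim : Tendsto (fun N : ℕ => ENNReal.ofReal (s / θ / (1 - s / θ / N))) atTop
      (𝓝 (ENNReal.ofReal (s / θ))) := by
    refine ENNReal.tendsto_ofReal ?_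
    have h1 : Tendsto (fun N : ℕ => s / θ / N) atTop (𝓝 0) := tendsto_const_div_atTop_nhds_zero_nat _
    have h2 := (tendsto_const_nhds (x := s / θ)).div ((tendsto_const_nhds (x := (1 : ℝ))).sub h1)
      (by norm_num)
    rw [sub_zero, div_one] at h2
    exact h2
  refine ge_of_tendsto hlim ?_
  filter_upwards [hfin] with N hN
  obtain ⟨hN0, hN1⟩ := hN
  set q := Real.tanh (s / N) with hq
  have hsN : 0 ≤ s / N := by positivity
  have hq0 : 0 ≤ q := Real.tanh_nonneg hsN
  have hqs : q ≤ s / N := Real.tanh_le_self hsN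
  have hqθ : q / θ ≤ s / θ / N := by
    rw [div_right_comm]
    gcongr
  have hqlt : q < θ := (div_lt_one hθ).1 (hqθ.trans_lt hN1)
  have hstep : ∀ j : ℕ, j ≤ N → kobayashiEDist (Ω ∩ U) (f 0) (f (Real.tanh (j * (s / N)))) ≤
      ENNReal.ofReal (j * Real.artanh (q / θ)) := by
    intro j
    induction j with
    | zero =>
      intro _
      have h0 : f 0 ∈ Ω ∩ U := mem_of_ofReal_le_kobayashiEDist (hf.2 (by simp))
        (by simp [hu]) h
      simp [kobayashiEDist_self h0]
    | succ j ih =>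
      intro hj
      have hle : (j : ℝ) * (s / N) ≤ s := by
        rw [mul_div_assoc', div_le_iff₀ hN0, mul_comm]
        have : (j : ℝ) ≤ N := by exact_mod_cast (Nat.le_of_succ_le hj)
        gcongr
      have hjs : (j : ℝ) * (s / N) ≤ (j + 1 : ℕ) * (s / N) := by push_cast; nlinarith
      -- Recenter at the `j`-th division point: it has moved by at most `s`, so the margin `u` to
      -- the complement of `U` remains.
      obtain ⟨g, hg, -, hg0, hg1⟩ := hf.exists_normalized (norm_tanh_lt_one (j * (s / N)))
        (norm_tanh_lt_one ((j + 1 : ℕ) * (s / N)))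
      rw [poincareDist_tanh hjs, show ((j + 1 : ℕ) : ℝ) * (s / N) - j * (s / N) = s / N by
        push_cast; ring] at hg1
      have h1 := hg.edist_inter_le_artanh (U := U) hu hq0 hqlt (fun w hw hwU => by
        have h2 := (h w hw hwU).trans (kobayashiEDist_triangle Ω (f 0) (g 0) w)
        rw [hg0] at h2 ⊢
        have h3 := (hf.edist_zero_tanh_le (t := j * (s / N)) (by positivity)).trans
          (ENNReal.ofReal_le_ofReal hle)
        exact (ENNReal.add_le_add_iff_left ENNReal.ofReal_ne_top).1
          (h2.trans (add_le_add_left h3 _)))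
      rw [hg0, hg1] at h1
      refine (kobayashiEDist_triangle _ _ _ _).trans ((add_le_add (ih (by omega)) h1).trans ?_)
      have hnn : 0 ≤ Real.artanh (q / θ) := Real.artanh_nonneg (by positivity)
      rw [← ENNReal.ofReal_add (by positivity) hnn]
      apply ENNReal.ofReal_le_ofReal
      push_cast
      linarith
  have hfinal := hstep N le_rfl
  rw [mul_div_cancel₀ _ hN0.ne'] at hfinal
  refine hfinal.trans (ENNReal.ofReal_le_ofReal ?_)
  have h1 := Real.artanh_le_div (show 0 ≤ q / θ by positivity) ((div_lt_one hθ).2 hqlt)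
  have h2 : q / θ / (1 - q / θ) ≤ s / θ / N / (1 - s / θ / N) :=
    div_le_div₀ (by positivity) hqθ (by linarith) (by linarith)
  calc N * Real.artanh (q / θ) ≤ N * (s / θ / N / (1 - s / θ / N)) := by gcongr; linarith
    _ = s / θ / (1 - s / θ / N) := by
      have : 1 - s / θ / N ≠ 0 := by linarith
      rw [mul_div_assoc', mul_div_cancel₀ _ hN0.ne']

/-- The hypothesis survives the induction: passing the first disc, the base point moves by at most
the length removed from `ℓ`. -/
theorem KobayashiChain.edist_inter_le {x y : E} {ℓ : ℝ≥0∞} (hc : KobayashiChain Ω x y ℓ)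
    {u : ℝ} (hu : 0 < u) :
    (∀ w ∈ Ω, w ∉ U → ℓ + ENNReal.ofReal u ≤ kobayashiEDist Ω x w) →
      kobayashiEDist (Ω ∩ U) x y ≤ ENNReal.ofReal (1 / Real.tanh u) * ℓ := by
  have hθ := Real.tanh_pos hu
  refine KobayashiChain.induction_normalized (P := fun x y ℓ =>
    (∀ w ∈ Ω, w ∉ U → ℓ + ENNReal.ofReal u ≤ kobayashiEDist Ω x w) →
      kobayashiEDist (Ω ∩ U) x y ≤ ENNReal.ofReal (1 / Real.tanh u) * ℓ) ?_ ?_ hc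
  · intro x hx h
    rw [kobayashiEDist_self (mem_of_ofReal_le_kobayashiEDist hx (by simp [hu]) h)]
    exact zero_le
  · intro f s y ℓ hf hs _ ih h
    have h1 := hf.edist_inter_le (U := U) hu hs fun w hw hwU =>
      le_trans (add_le_add_left le_self_add _) (h w hw hwU)
    have h2 := ih fun w hw hwU => by
      have h3 := (h w hw hwU).trans ((kobayashiEDist_triangle Ω (f 0) (f (Real.tanh s)) w).trans
        (add_le_add_left (hf.edist_zero_tanh_le hs) _))
      rw [add_assoc] at h3
      exact (ENNReal.add_le_add_iff_left ENNReal.ofReal_ne_top).1 h3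
    refine (kobayashiEDist_triangle _ _ _ _).trans ((add_le_add h1 h2).trans ?_)
    rw [mul_add, ← ENNReal.ofReal_mul (by positivity), one_div_mul_eq_div]

/-- Royden's localization of the Kobayashi distance for nearby points. -/
theorem kobayashiEDist_inter_le {x y : E} {h u : ℝ} (hu : 0 < u)
    (hxy : kobayashiEDist Ω x y < ENNReal.ofReal h)
    (hU : ∀ w ∈ Ω, w ∉ U → ENNReal.ofReal h + ENNReal.ofReal u ≤ kobayashiEDist Ω x w) :
    kobayashiEDist (Ω ∩ U) x y ≤ ENNReal.ofReal (1 / Real.tanh u) * kobayashiEDist Ω x y := by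
  have hθ : ENNReal.ofReal (1 / Real.tanh u) ≠ 0 := by
    have := Real.tanh_pos hu
    simpa using this
  rw [mul_comm, ← ENNReal.div_le_iff_le_mul (Or.inl hθ) (Or.inl ENNReal.ofReal_ne_top)]
  refine le_of_forall_gt_imp_ge_of_dense fun a ha => ?_
  -- A nearly optimal chain is also taken shorter than `h`, so the margin `u` persists along all of
  -- it.
  have h1 := lt_min ha hxy
  rw [kobayashiEDist] at h1
  simp only [iInf_lt_iff] at h1
  obtain ⟨ℓ, hℓ, hlt⟩ := h1
  have h2 := hℓ.edist_inter_le (U := U) hu fun w hw hwU =>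
    le_trans (add_le_add_left (hlt.le.trans (min_le_right _ _)) _) (hU w hw hwU)
  exact (ENNReal.div_le_of_le_mul' h2).trans (hlt.le.trans (min_le_left _ _))

theorem kobayashiDist_inter_le [IsBoundedDomain Ω] [IsBoundedDomain (Ω ∩ U)] {x y : E} {h u : ℝ}
    (hx : x ∈ Ω) (hy : y ∈ Ω) (hu : 0 < u) (hxy : kobayashiDist Ω x y < h)
    (hU : ∀ w ∈ Ω, w ∉ U → h + u ≤ kobayashiDist Ω x w) :
    x ∈ U ∧ y ∈ U ∧ kobayashiDist (Ω ∩ U) x y ≤ kobayashiDist Ω x y / Real.tanh u := by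
  have hh : 0 < h := (kobayashiDist_nonneg _ _ _).trans_lt hxy
  have hxU : x ∈ U := by
    by_contra hc
    have := hU x hx hc
    rw [kobayashiDist_self hx] at this
    linarith
  have hyU : y ∈ U := by
    by_contra hc
    have := hU y hy hc
    linarith
  have hθ := Real.tanh_pos hu
  refine ⟨hxU, hyU, ?_⟩
  rw [kobayashiDist_le_iff (D := Ω ∩ U) ⟨hx, hxU⟩ ⟨hy, hyU⟩ (div_nonneg (kobayashiDist_nonneg _ _ _) hθ.le)]
  have := kobayashiEDist_inter_le (Ω := Ω) (U := U) (x := x) (y := y) (h := h) hu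
    (by rwa [← ofReal_kobayashiDist hx hy, ENNReal.ofReal_lt_ofReal_iff hh])
    (fun w hw hwU => by
      rw [← ofReal_kobayashiDist hx hw, ← ENNReal.ofReal_add hh.le hu.le]
      exact ENNReal.ofReal_le_ofReal (hU w hw hwU))
  rwa [← ofReal_kobayashiDist hx hy, ← ENNReal.ofReal_mul (by positivity),
    one_div_mul_eq_div] at this

/-- With `q = exp (-2u)`, `coth u = 1 + 2q / (1 - q)`. The linear lower bound on `u` makes the
excess `O(exp (-t))`; the bound `ρ / 2` keeps `1 - q` away from `0`. -/
theorem one_div_tanh_le {ρ C t u : ℝ} (hρ : 0 < ρ) (h1 : ρ / 2 ≤ u) (h2 : t / 2 - C - ρ / 2 ≤ u) :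
    1 / Real.tanh u ≤ 1 + 2 * Real.exp (2 * C + ρ) / (1 - Real.exp (-ρ)) * Real.exp (-t) := by
  set q := Real.exp (-(2 * u)) with hq
  have hq0 : 0 < q := Real.exp_pos _
  have hq1 : q ≤ Real.exp (-ρ) := Real.exp_le_exp.2 (by linarith)
  have hq2 : q ≤ Real.exp (2 * C + ρ) * Real.exp (-t) := by
    rw [← Real.exp_add]
    exact Real.exp_le_exp.2 (by linarith)
  have hρ1 : Real.exp (-ρ) < 1 := by rw [Real.exp_lt_one_iff]; linarith
  have htanh : Real.tanh u = (1 - q) / (1 + q) := by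
    rw [Real.tanh_eq, hq, show -(2 * u) = -u + -u by ring, Real.exp_add, Real.exp_neg]
    field_simp
  have h3 : 1 / Real.tanh u = 1 + 2 * q / (1 - q) := by
    rw [htanh]
    have : 1 - q ≠ 0 := by linarith
    field_simp
    ring
  rw [h3]
  have h4 : 2 * q / (1 - q) ≤
      2 * (Real.exp (2 * C + ρ) * Real.exp (-t)) / (1 - Real.exp (-ρ)) :=
    div_le_div₀ (by positivity) (by linarith) (by linarith) (by linarith)
  have h5 : 2 * Real.exp (2 * C + ρ) / (1 - Real.exp (-ρ)) * Real.exp (-t) =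
      2 * (Real.exp (2 * C + ρ) * Real.exp (-t)) / (1 - Real.exp (-ρ)) := by ring
  linarith

/-- A curve parametrized by Kobayashi arc length which moves away from the complement of `U` at
a linear rate is short for the Kobayashi distance of `Ω ∩ U`, up to an additive constant. -/
theorem exists_kobayashiDist_inter_le_add {ρ : ℝ} (hρ : 0 < ρ) (C : ℝ) : ∃ C' : ℝ,
    ∀ (Ω U : Set E) [IsBoundedDomain Ω] [IsBoundedDomain (Ω ∩ U)] (γ : ℝ → E) (L : ℝ), 0 ≤ L →
      (∀ t ∈ Icc 0 L, γ t ∈ Ω) →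
      (∀ s ∈ Icc 0 L, ∀ t ∈ Icc 0 L, kobayashiDist Ω (γ s) (γ t) ≤ |s - t|) →
      (∀ t ∈ Icc 0 L, ∀ w ∈ Ω, w ∉ U → ρ ≤ kobayashiDist Ω (γ t) w ∧
        t / 2 - C ≤ kobayashiDist Ω (γ t) w) →
      kobayashiDist (Ω ∩ U) (γ 0) (γ L) ≤ L + C' := by
  set A := 2 * Real.exp (2 * C + ρ) / (1 - Real.exp (-ρ)) with hA
  have hρ1 : Real.exp (-ρ) < 1 := by rw [Real.exp_lt_one_iff]; linarith
  have hA0 : 0 ≤ A := div_nonneg (by positivity) (by linarith)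
  -- `B` bounds the Riemann sums of `A * exp (-t)`: for mesh `h ≤ ρ / 4`, `h ≤ (1 + ρ / 4) * (1 -
  -- exp (-h))`, so the errors telescope.
  set B := A * (1 + ρ / 4) with hB
  have hB0 : 0 ≤ B := by positivity
  refine ⟨B, fun Ω U _ _ γ L hL hγ hlip hdist => ?_⟩
  have hmemU : ∀ t ∈ Icc 0 L, γ t ∈ Ω ∩ U := by
    refine fun t ht => ⟨hγ t ht, ?_⟩
    by_contra hc
    have := (hdist t ht _ (hγ t ht) hc).1
    rw [kobayashiDist_self (hγ t ht)] at this
    linarith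
  obtain ⟨N, hN⟩ := exists_nat_gt (L / (ρ / 4))
  have hN0 : (0 : ℝ) < N := lt_of_le_of_lt (by positivity) hN
  set h := L / N with hh
  have hh0 : 0 ≤ h := by positivity
  have hh1 : h ≤ ρ / 4 := by
    rw [hh, div_le_iff₀ hN0]
    rw [div_lt_iff₀ (by positivity)] at hN
    linarith
  have hNh : N * h = L := by rw [hh]; field_simp
  have hstep : ∀ k : ℕ, k ≤ N → kobayashiDist (Ω ∩ U) (γ 0) (γ (k * h)) ≤
      k * h + B * (1 - Real.exp (-(k * h))) := by
    intro k
    induction k with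
    | zero =>
      intro _
      have := kobayashiDist_self (hmemU 0 ⟨le_rfl, hL⟩)
      simp [this]
    | succ k ih =>
      intro hk
      have hle : ∀ j : ℕ, j ≤ N → (j : ℝ) * h ∈ Icc 0 L := fun j hj =>
        ⟨by positivity, by
          have : (j : ℝ) ≤ N := by exact_mod_cast hj
          rw [← hNh]; gcongr⟩
      have hk0 := hle k (by omega)
      have hk1 := hle (k + 1) hk
      set t := (k : ℝ) * h with ht
      have hsucc : ((k + 1 : ℕ) : ℝ) * h = t + h := by push_cast; ring
      rw [hsucc] at hk1 ⊢
      have hd : kobayashiDist Ω (γ t) (γ (t + h)) ≤ h := by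
        have := hlip t hk0 (t + h) hk1
        rwa [show t - (t + h) = -h by ring, abs_neg, abs_of_nonneg hh0] at this
      -- Both lower bounds on the distance to the complement, less the `ρ / 2` reserved for the next
      -- step of the subdivision.
      set u := max (ρ / 2) (t / 2 - C - ρ / 2) with hu
      have hu1 : ρ / 2 ≤ u := le_max_left _ _
      have hu0 : 0 < u := by linarith
      have hu2 : t / 2 - C - ρ / 2 ≤ u := le_max_right _ _
      obtain ⟨-, -, hloc⟩ := kobayashiDist_inter_le (U := U) (h := ρ / 2) (hγ t hk0)
        (hγ _ hk1) hu0 (by linarith) (fun w hw hwU => by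
          obtain ⟨h1, h2⟩ := hdist t hk0 w hw hwU
          have : u ≤ kobayashiDist Ω (γ t) w - ρ / 2 := max_le (by linarith) (by linarith)
          linarith)
      have hcoth := one_div_tanh_le (t := t) hρ hu1 hu2
      rw [← hA] at hcoth
      have hθ := Real.tanh_pos hu0
      have hloc' : kobayashiDist (Ω ∩ U) (γ t) (γ (t + h)) ≤ h * (1 + A * Real.exp (-t)) := by
        refine hloc.trans ?_
        rw [div_eq_mul_one_div]
        have : 0 ≤ 1 / Real.tanh (max (ρ / 2) (t / 2 - C - ρ / 2)) := by positivity
        exact mul_le_mul hd hcoth this hh0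
      have hexp : A * h ≤ B * (1 - Real.exp (-h)) := by
        have h1 : Real.exp (-h) * (1 + h) ≤ 1 := by
          rw [Real.exp_neg, inv_mul_le_iff₀ (Real.exp_pos _), mul_one]
          linarith [Real.add_one_le_exp h]
        have h2 : Real.exp (-h) ≤ 1 := Real.exp_le_one_iff.2 (by linarith)
        have h3 : h ≤ (1 + ρ / 4) * (1 - Real.exp (-h)) := by nlinarith
        calc A * h ≤ A * ((1 + ρ / 4) * (1 - Real.exp (-h))) := by gcongr
          _ = B * (1 - Real.exp (-h)) := by rw [hB]; ring
      have hexp2 : Real.exp (-(t + h)) = Real.exp (-t) * Real.exp (-h) := by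
        rw [← Real.exp_add]; congr 1; ring
      have := kobayashiDist_triangle (hmemU 0 ⟨le_rfl, hL⟩) (hmemU t hk0) (hmemU _ hk1)
      have h4 := ih (by omega)
      rw [hexp2]
      nlinarith [Real.exp_pos (-t)]
  have hfin := hstep N le_rfl
  rw [hNh] at hfin
  have : 0 ≤ B * Real.exp (-L) := by positivity
  linarith

end Localization

/-! ### From local completeness and visibility to bounded Gromov products. -/

section LocalToGlobal

variable {E : Type*} [NormedAddCommGroup E] {Ω V : Set E}

theorem IsBoundedDomain.inter [h : IsBoundedDomain Ω] (hV : IsOpen V) (hc : IsConnected (Ω ∩ V)) :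
    IsBoundedDomain (Ω ∩ V) :=
  ⟨h.isOpen.inter hV, hc, h.isBounded.subset inter_subset_left⟩

theorem mem_frontier_of_not_mem [h : IsBoundedDomain Ω] {p : E} (hp : p ∈ closure Ω)
    (hp' : p ∉ Ω) : p ∈ frontier Ω := by
  rw [h.isOpen.frontier_eq]; exact ⟨hp, hp'⟩

theorem mem_closure_of_tendsto_val {u : ℕ → E} {p : E} (hu : ∀ n, u n ∈ Ω)
    (h : Tendsto u atTop (𝓝 p)) : p ∈ closure Ω :=
  mem_closure_of_tendsto h (Eventually.of_forall hu)

variable [NormedSpace ℂ E]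

/-- A Cauchy sequence converges in the Euclidean sense. If the limit were on the frontier, Royden's
localization would make the tail Cauchy in the complete space `Ω ∩ V`, whose limits lie inside. -/
theorem completeSpace_of_forall_frontier [ProperSpace E] [hΩ : IsBoundedDomain Ω]
    (h : ∀ p ∈ frontier Ω, ∃ V, IsOpen V ∧ p ∈ V ∧ IsConnected (Ω ∩ V) ∧
      IsCompleteHyperbolic (Ω ∩ V)) : CompleteSpace (KobayashiSpace Ω) := by
  obtain ⟨M, hM0, hM⟩ := exists_dist_le_mul_kobayashiDist Ω
  refine Metric.complete_of_cauchySeq_tendsto fun x hx => ?_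
  have hcau : CauchySeq fun n => (x n).val := by
    refine Metric.cauchySeq_iff'.2 fun ε hε => ?_
    obtain ⟨N, hN⟩ := Metric.cauchySeq_iff'.1 hx (ε / M) (by positivity)
    refine ⟨N, fun n hn => (hM _ (x n).property _ (x N).property).trans_lt ?_⟩
    have := hN n hn
    rw [KobayashiSpace.dist_eq, lt_div_iff₀ hM0] at this
    linarith
  obtain ⟨p, hp⟩ := cauchySeq_tendsto_of_complete hcau
  by_cases hpΩ : p ∈ Ω
  · exact ⟨⟨p, hpΩ⟩, KobayashiSpace.tendsto_iff.2 hp⟩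
  exfalso
  have hpcl := mem_closure_of_tendsto_val (fun n => (x n).property) hp
  obtain ⟨V, hVo, hpV, hVc, hVcomp⟩ := h p (mem_frontier_of_not_mem hpcl hpΩ)
  have := IsBoundedDomain.inter hVo hVc
  obtain ⟨R, hR, hRV⟩ := Metric.isOpen_iff.1 hVo p hpV
  -- Points within `R / 2` of `p` are at Kobayashi distance at least `2 * ρ` from `Ω \ V`: one `ρ`
  -- for the pair, one for the margin.
  set ρ := R / 2 / M / 2 with hρ
  have hρ0 : 0 < ρ := by positivity
  obtain ⟨N₁, hN₁⟩ := Metric.tendsto_atTop.1 hp (R / 2) (by positivity)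
  obtain ⟨N₂, hN₂⟩ := Metric.cauchySeq_iff.1 hx ρ hρ0
  set N := max N₁ N₂ with hN
  have hloc : ∀ m ≥ N, ∀ n ≥ N, (x m).val ∈ V ∧ (x n).val ∈ V ∧
      kobayashiDist (Ω ∩ V) (x m).val (x n).val ≤ dist (x m) (x n) / Real.tanh ρ := by
    intro m hm n hn
    refine kobayashiDist_inter_le (h := ρ) (x m).property (x n).property hρ0
      (hN₂ m (le_of_max_le_right hm) n (le_of_max_le_right hn)) fun w hw hwV => ?_
    have h1 := hM _ (x m).property w hw
    have h2 := hN₁ m (le_of_max_le_left hm)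
    have h3 : R ≤ dist w p := by
      by_contra! hc
      exact hwV (hRV hc)
    have h4 := dist_triangle w (x m).val p
    rw [dist_comm w (x m).val] at h4
    have h5 : R / 2 / M ≤ kobayashiDist Ω (x m).val w := by
      rw [div_le_iff₀ hM0]; linarith
    linarith
  let y : ℕ → KobayashiSpace (Ω ∩ V) := fun n =>
    ⟨(x (n + N)).val, (x _).property, (hloc (n + N) (by omega) (n + N) (by omega)).1⟩
  have hθ := Real.tanh_pos hρ0
  have hy : CauchySeq y := by
    refine Metric.cauchySeq_iff.2 fun ε hε => ?_
    obtain ⟨N', hN'⟩ := Metric.cauchySeq_iff.1 hx (ε * Real.tanh ρ) (by positivity)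
    refine ⟨N', fun m hm n hn => ?_⟩
    refine ((hloc (m + N) (by omega) (n + N) (by omega)).2.2).trans_lt ?_
    rw [div_lt_iff₀ hθ]
    exact hN' _ (by omega) _ (by omega)
  have := hVcomp.2
  obtain ⟨q, hq⟩ := cauchySeq_tendsto_of_complete hy
  have h1 : Tendsto (fun n => (x (n + N)).val) atTop (𝓝 q.val) := KobayashiSpace.tendsto_iff.1 hq
  have h2 := tendsto_nhds_unique h1 ((tendsto_add_atTop_iff_nat N).2 hp)
  exact hpΩ (h2 ▸ q.property.1)

theorem exists_kobayashi_geodesic [ProperSpace E] [IsBoundedDomain Ω]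
    [CompleteSpace (KobayashiSpace Ω)] {x y : E} (hx : x ∈ Ω) (hy : y ∈ Ω) :
    ∃ γ : ℝ → E, (∀ t, γ t ∈ Ω) ∧ γ 0 = x ∧ γ (kobayashiDist Ω x y) = y ∧
      (∀ s ∈ Icc 0 (kobayashiDist Ω x y), ∀ t ∈ Icc 0 (kobayashiDist Ω x y),
        kobayashiDist Ω (γ s) (γ t) = |s - t|) ∧
      ContinuousOn γ (Icc 0 (kobayashiDist Ω x y)) := by
  obtain ⟨c, h0, h1, h⟩ := IsGeodesicSpace.exists_geodesic (⟨x, hx⟩ : KobayashiSpace Ω) ⟨y, hy⟩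
  refine ⟨fun t => (c t).val, fun t => (c t).property, congrArg _ h0, congrArg _ h1, h, ?_⟩
  refine KobayashiSpace.continuous_val.comp_continuousOn ?_
  refine LipschitzOnWith.continuousOn (K := 1)
    (LipschitzOnWith.of_dist_le_mul fun s hs t ht => ?_)
  rw [h s hs t ht, NNReal.coe_one, one_mul, Real.dist_eq]

variable (Ω) in
/-- Points of `Ω` at a definite Euclidean distance have bounded Gromov products. -/
def HasBoundedProducts : Prop :=
  ∀ o ∈ Ω, ∀ ε > 0, ∃ C, ∀ x ∈ Ω, ∀ y ∈ Ω, ε ≤ dist x y →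
    kobayashiDist Ω x o + kobayashiDist Ω y o ≤ kobayashiDist Ω x y + C

/-- In a counterexample sequence `z → p` and, after extraction, `y → q ≠ p`. If `q ∈ Ω`, then `y`
stays at bounded distance from `o`; otherwise visibility makes the geodesics from `z` to `y` pass
near `o`. -/
theorem exists_local_product_bound [ProperSpace E] [hΩ : IsBoundedDomain Ω]
    [IsBoundedDomain (Ω ∩ V)] [CompleteSpace (KobayashiSpace (Ω ∩ V))] {p : E} {R : ℝ}
    (hR : 0 < R) (hRV : closedBall p R ⊆ V)
    (hvis : ∀ q ∈ frontier Ω, q ∈ closedBall p R → p ≠ q → HasVisibility (Ω ∩ V) p q)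
    {o : E} (ho : o ∈ Ω ∩ V) :
    ∃ r > 0, ∃ C, ∀ z ∈ Ω ∩ V, dist z p < r → ∀ y ∈ Ω, y ∈ closedBall p R → R / 2 ≤ dist y p →
      kobayashiDist (Ω ∩ V) z o ≤ kobayashiDist (Ω ∩ V) z y + C := by
  by_contra! hcon
  have hcon' (n : ℕ) := hcon (1 / (n + 1 : ℝ)) (by positivity) n
  choose z hz hzp y hy hyR hyp hlt using hcon'
  have hzlim : Tendsto z atTop (𝓝 p) := by
    rw [tendsto_iff_dist_tendsto_zero]
    exact squeeze_zero (fun n => dist_nonneg) (fun n => (hzp n).le)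
      tendsto_one_div_add_atTop_nhds_zero_nat
  obtain ⟨q, hq, φ, hφ, hlim⟩ := (isCompact_closedBall p R).tendsto_subseq hyR
  have hqcl := mem_closure_of_tendsto_val (fun n => hy (φ n)) hlim
  have hyV (n : ℕ) : y n ∈ Ω ∩ V := ⟨hy n, hRV (hyR n)⟩
  have hpq : R / 2 ≤ dist q p :=
    ge_of_tendsto' (hlim.dist tendsto_const_nhds) fun n => hyp (φ n)
  have hbig (C : ℝ) : ∀ᶠ n in atTop, kobayashiDist (Ω ∩ V) (z (φ n)) (y (φ n)) + C <
      kobayashiDist (Ω ∩ V) (z (φ n)) o := by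
    obtain ⟨N, hN⟩ := exists_nat_gt C
    filter_upwards [hφ.tendsto_atTop.eventually_ge_atTop N] with n hn
    have : (N : ℝ) ≤ φ n := by exact_mod_cast hn
    linarith [hlt (φ n)]
  by_cases hqΩ : q ∈ Ω
  · have h1 := tendsto_kobayashiDist (D := Ω ∩ V) (fun n => hyV (φ n)) ⟨hqΩ, hRV hq⟩ ho hlim
    obtain ⟨n, h2, h3⟩ := ((hbig (kobayashiDist (Ω ∩ V) q o + 1)).and
      (h1.eventually_lt_const (lt_add_one _))).exists
    have := kobayashiDist_triangle (hz (φ n)) (hyV (φ n)) ho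
    linarith
  · obtain ⟨Vp, Vq, K, hVp, hpVp, hVq, hqVq, -, hK, hKsub, hmeet⟩ := hvis q
      (mem_frontier_of_not_mem hqcl hqΩ) hq (by
        rintro rfl
        rw [dist_self] at hpq
        linarith)
    obtain ⟨C, hC⟩ := hK.exists_kobayashiDist_le hKsub ho
    obtain ⟨n, h1, h2, h3⟩ := ((hbig C).and
      (((hzlim.comp hφ.tendsto_atTop).eventually (hVp.mem_nhds hpVp)).and
      (hlim.eventually (hVq.mem_nhds hqVq)))).exists
    obtain ⟨S, hS⟩ := exists_isGeodesicSegment (⟨_, hz (φ n)⟩ : KobayashiSpace (Ω ∩ V))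
      ⟨_, hyV (φ n)⟩
    obtain ⟨m, hm, hmK⟩ := hmeet ⟨_, hz (φ n)⟩ ⟨_, hyV (φ n)⟩ S h2 h3 hS
    have h4 := hS.dist_add_dist hm
    simp only [KobayashiSpace.dist_eq] at h4
    have h5 := kobayashiDist_triangle (hz (φ n)) m.property ho
    have h6 := hC _ hmK
    have h7 := kobayashiDist_nonneg (Ω ∩ V) m.val (y (φ n))
    linarith

/-- Replace `w` by a point `w₀` nearest to `z` outside a small ball. The geodesic from `w₀` to `z`
recedes from the exterior at unit rate, so apart from an initial piece its length bounds the
distance in `Ω ∩ V` up to a constant, and the local bound applies. -/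
theorem exists_product_bound_of_frontier [ProperSpace E] [hΩ : IsBoundedDomain Ω]
    [CompleteSpace (KobayashiSpace Ω)] (hvis : IsLocallyVisible Ω) {p : E} (hp : p ∈ frontier Ω)
    {o : E} (ho : o ∈ Ω) {R₀ : ℝ} (hR₀ : 0 < R₀) :
    ∃ r > 0, ∃ C, ∀ z ∈ Ω, dist z p < r → ∀ w ∈ Ω, R₀ ≤ dist w p →
      kobayashiDist Ω z o ≤ kobayashiDist Ω z w + C := by
  obtain ⟨V, hVo, hpV, hVc, hVcomp, V', hVo', hpV', hVV', hpairs⟩ := hvis p hp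
  have := IsBoundedDomain.inter hVo hVc
  have := hVcomp.2
  obtain ⟨R₁, hR₁, hRV'⟩ := Metric.nhds_basis_closedBall.mem_iff.1 (hVo'.mem_nhds hpV')
  set R := min R₀ R₁ with hRdef
  have hR : 0 < R := lt_min hR₀ hR₁
  have hRsub : closedBall p R ⊆ V' := (closedBall_subset_closedBall (min_le_right _ _)).trans hRV'
  obtain ⟨o', ho'⟩ := hVc.nonempty
  obtain ⟨r₁, hr₁, C₁, hC₁⟩ := exists_local_product_bound hR (hRsub.trans hVV')
    (fun q hq hqR hpq => hpairs p ⟨hp, hpV'⟩ q ⟨hq, hRsub hqR⟩ hpq) ho'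
  obtain ⟨M, hM0, hM⟩ := exists_dist_le_mul_kobayashiDist Ω
  -- In time `τ` the geodesic moves at most `R / 2` in the Euclidean metric, so it is still in the
  -- annulus, and it has gained the margin `τ` that localization needs.
  set τ := R / 2 / M with hτ
  have hτ0 : 0 < τ := by positivity
  have hMτ : M * τ = R / 2 := by rw [hτ]; field_simp
  obtain ⟨C₂, hC₂⟩ := exists_kobayashiDist_inter_le_add (E := E) hτ0 0
  refine ⟨min r₁ (R / 2), by positivity, C₂ + C₁ + kobayashiDist Ω o' o, fun z hz hzp w hw hwp => ?_⟩
  have hzr₁ : dist z p < r₁ := hzp.trans_le (min_le_left _ _)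
  have hzR : dist z p < R / 2 := hzp.trans_le (min_le_right _ _)
  obtain ⟨w₀, hw₀, hmin⟩ : ∃ w₀ : KobayashiSpace Ω, R ≤ dist w₀.val p ∧
      ∀ w' : KobayashiSpace Ω, R ≤ dist w'.val p → dist (⟨z, hz⟩ : KobayashiSpace Ω) w₀ ≤
        dist (⟨z, hz⟩ : KobayashiSpace Ω) w' := by
    have hcl : IsClosed {w' : KobayashiSpace Ω | R ≤ dist w'.val p} :=
      isClosed_le continuous_const (KobayashiSpace.continuous_val.dist continuous_const)
    obtain ⟨w₀, hw₀, h⟩ := hcl.exists_infDist_eq_dist ⟨⟨w, hw⟩, (min_le_left _ _).trans hwp⟩ ⟨z, hz⟩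
    exact ⟨w₀, hw₀, fun w' hw' => h ▸ infDist_le_dist_of_mem hw'⟩
  simp only [KobayashiSpace.dist_eq] at hmin
  obtain ⟨σ, hσ, hσ0, hσL, hiso, -⟩ := exists_kobayashi_geodesic w₀.property hz
  set L := kobayashiDist Ω w₀.val z with hL
  have hL0 : 0 ≤ L := kobayashiDist_nonneg _ _ _
  have hfar : ∀ s ∈ Icc 0 L, ∀ w' ∈ Ω, R ≤ dist w' p → s ≤ kobayashiDist Ω (σ s) w' := by
    intro s hs w' hw' hw'p
    have h1 := hmin ⟨w', hw'⟩ hw'p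
    have h2 := kobayashiDist_triangle hz (hσ s) hw'
    have h3 := hiso L ⟨hL0, le_rfl⟩ s hs
    rw [hσL, abs_of_nonneg (sub_nonneg.2 hs.2)] at h3
    rw [kobayashiDist_comm, ← hL] at h1
    linarith
  have hτL : τ ≤ L := by
    have h1 := hM _ w₀.property z hz
    have h2 := dist_triangle w₀.val z p
    have h3 : M * τ ≤ M * L := by linarith
    exact le_of_mul_le_mul_left h3 hM0
  have hτmem : τ ∈ Icc 0 L := ⟨hτ0.le, hτL⟩
  have hyp : R / 2 ≤ dist (σ τ) p := by
    have h1 := hM _ w₀.property _ (hσ τ)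
    have h2 := hiso 0 ⟨le_rfl, hL0⟩ τ hτmem
    rw [hσ0, zero_sub, abs_neg, abs_of_nonneg hτ0.le] at h2
    rw [h2, hMτ] at h1
    linarith [dist_triangle w₀.val (σ τ) p]
  have hyR : dist (σ τ) p < R := by
    by_contra! hc
    have := hfar τ hτmem _ (hσ τ) hc
    rw [kobayashiDist_self (hσ τ)] at this
    linarith
  have hzV : z ∈ V := hVV' (hRsub (mem_closedBall.2 (by linarith)))
  have hyV : σ τ ∈ V := hVV' (hRsub hyR.le)
  have hloc := hC₂ Ω V (fun t => σ (τ + t)) (L - τ) (by linarith) (fun t _ => hσ _)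
    (fun s hs t ht => by
      have := hiso (τ + s) ⟨by linarith [hs.1], by linarith [hs.2]⟩ (τ + t)
        ⟨by linarith [ht.1], by linarith [ht.2]⟩
      rw [this, add_sub_add_left_eq_sub])
    (fun t ht w' hw' hw'V => by
      have hw'R : R ≤ dist w' p := by
        by_contra! hc
        exact hw'V (hVV' (hRsub hc.le))
      have := hfar (τ + t) ⟨by linarith [ht.1], by linarith [ht.2]⟩ w' hw' hw'R
      constructor <;> linarith [ht.1])
  simp only [add_zero, add_sub_cancel, hσL] at hloc
  have h1 := hC₁ z ⟨hz, hzV⟩ hzr₁ (σ τ) (hσ τ) (mem_closedBall.2 hyR.le) hyp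
  have h2 := kobayashiDist_triangle hz ho'.1 ho
  have h3 := kobayashiDist_anti inter_subset_left (⟨hz, hzV⟩ : z ∈ Ω ∩ V) ho'
  have h4 := hmin ⟨w, hw⟩ ((min_le_left _ _).trans hwp)
  rw [kobayashiDist_comm, ← hL] at h4
  rw [kobayashiDist_comm _ (σ τ) z] at hloc
  linarith

/-- Local visibility implies that Gromov products of distant points are bounded. -/
theorem IsLocallyVisible.hasBoundedProducts [ProperSpace E] [hΩ : IsBoundedDomain Ω]
    [CompleteSpace (KobayashiSpace Ω)] (hvis : IsLocallyVisible Ω) : HasBoundedProducts Ω := by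
  intro o ho ε hε
  by_contra! hcon
  choose x hx y hy hxy hlt using fun n : ℕ => hcon n
  have hcpt : IsCompact (closure Ω) := hΩ.isBounded.isCompact_closure
  obtain ⟨p, hp, φ, hφ, hxp⟩ := hcpt.tendsto_subseq fun n => subset_closure (hx n)
  obtain ⟨q, hq, ψ, hψ, hyq⟩ := hcpt.tendsto_subseq fun n => subset_closure (hy (φ n))
  replace hxp := hxp.comp hψ.tendsto_atTop
  set θ := φ ∘ ψ with hθ
  have hθm : StrictMono θ := hφ.comp hψ
  change Tendsto (x ∘ θ) atTop (𝓝 p) at hxp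
  change Tendsto (y ∘ θ) atTop (𝓝 q) at hyq
  have hpq : ε ≤ dist p q := ge_of_tendsto' (hxp.dist hyq) fun n => hxy (θ n)
  have hbig (C : ℝ) : ∀ᶠ n in atTop, kobayashiDist Ω (x (θ n)) (y (θ n)) + C <
      kobayashiDist Ω (x (θ n)) o + kobayashiDist Ω (y (θ n)) o := by
    obtain ⟨N, hN⟩ := exists_nat_gt C
    filter_upwards [hθm.tendsto_atTop.eventually_ge_atTop N] with n hn
    have : (N : ℝ) ≤ θ n := by exact_mod_cast hn
    linarith [hlt (θ n)]
  by_cases hpΩ : p ∈ Ω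
  · have h1 := tendsto_kobayashiDist (fun n => hx (θ n)) hpΩ ho hxp
    obtain ⟨n, h2, h3⟩ := ((hbig (2 * (kobayashiDist Ω p o + 1))).and
      (h1.eventually_lt_const (lt_add_one _))).exists
    have := kobayashiDist_triangle (hy (θ n)) (hx (θ n)) ho
    linarith [kobayashiDist_comm Ω (y (θ n)) (x (θ n))]
  by_cases hqΩ : q ∈ Ω
  · have h1 := tendsto_kobayashiDist (fun n => hy (θ n)) hqΩ ho hyq
    obtain ⟨n, h2, h3⟩ := ((hbig (2 * (kobayashiDist Ω q o + 1))).and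
      (h1.eventually_lt_const (lt_add_one _))).exists
    have := kobayashiDist_triangle (hx (θ n)) (hy (θ n)) ho
    linarith
  obtain ⟨r, hr, C, hC⟩ := exists_product_bound_of_frontier hvis
    (mem_frontier_of_not_mem hp hpΩ) ho (show 0 < ε / 3 by positivity)
  obtain ⟨r', hr', C', hC'⟩ := exists_product_bound_of_frontier hvis
    (mem_frontier_of_not_mem hq hqΩ) ho (show 0 < ε / 3 by positivity)
  obtain ⟨n, h1, h2, h3⟩ := ((hbig (C + C')).and
    ((hxp.eventually (ball_mem_nhds p (show 0 < min r (ε / 3) by positivity))).and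
    (hyq.eventually (ball_mem_nhds q (show 0 < min r' (ε / 3) by positivity))))).exists
  simp only [Function.comp_apply, lt_min_iff] at h2 h3
  obtain ⟨γ, hγ, hγ0, hγL, hiso, hcont⟩ := exists_kobayashi_geodesic (hx (θ n)) (hy (θ n))
  set L := kobayashiDist Ω (x (θ n)) (y (θ n)) with hL
  have hL0 : 0 ≤ L := kobayashiDist_nonneg _ _ _
  -- The geodesic crosses a sphere that is far from both `p` and `q`; adding the one-sided estimates
  -- at the crossing point bounds the product.
  obtain ⟨t, ht, hγt⟩ : ε / 3 ∈ (fun t => dist (γ t) p) '' Icc 0 L := by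
    refine intermediate_value_Icc hL0 ((continuous_id.dist continuous_const).comp_continuousOn hcont) ⟨?_, ?_⟩
    · change dist (γ 0) p ≤ _
      rw [hγ0]; exact h2.2.le
    · change _ ≤ dist (γ L) p
      rw [hγL]
      have := dist_triangle p (y (θ n)) q
      rw [dist_comm p (y _)] at this
      linarith [h3.2]
  have hγt' : dist (γ t) p = ε / 3 := hγt
  have h4 := hC _ (hx (θ n)) h2.1 _ (hγ t) hγt'.ge
  have h5 := hC' _ (hy (θ n)) h3.1 _ (hγ t) (by
    linarith [dist_triangle p (γ t) q, dist_comm p (γ t)])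
  have h6 := hiso 0 ⟨le_rfl, hL0⟩ t ht
  have h7 := hiso L ⟨hL0, le_rfl⟩ t ht
  rw [hγ0, zero_sub, abs_neg, abs_of_nonneg ht.1] at h6
  rw [hγL, abs_of_nonneg (sub_nonneg.2 ht.2)] at h7
  linarith

end LocalToGlobal

/-- Each of the two pairs is compared with either point of the other pair, always with base `o`; all
cases of the maxima are then linear. -/
theorem FourPointCondition.of_base {X : Type*} [MetricSpace X] {o : X} {δ : ℝ}
    (h : ∀ x y z : X, dist x y + dist z o ≤
      max (dist x z + dist y o) (dist x o + dist y z) + δ) : FourPointCondition X (2 * δ) := by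
  intro x y z w
  have h1 := h x y z
  have h2 := h x y w
  have h3 := h z w x
  have h4 := h z w y
  rw [dist_comm w x, dist_comm z x] at h3
  rw [dist_comm w y, dist_comm z y] at h4
  by_contra! hcon
  rw [← lt_sub_iff_add_lt, max_lt_iff] at hcon
  obtain ⟨c1, c2⟩ := hcon
  rw [← sub_le_iff_le_add, le_max_iff] at h1 h2 h3 h4
  rcases h1 with h1 | h1 <;> rcases h2 with h2 | h2 <;> rcases h3 with h3 | h3 <;>
    rcases h4 with h4 | h4 <;> linarith

theorem ContinuousOn.exists_first_eq {f : ℝ → ℝ} {L R : ℝ} (hf : ContinuousOn f (Icc 0 L))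
    (h0 : f 0 < R) {t : ℝ} (ht : t ∈ Icc 0 L) (htR : R ≤ f t) :
    ∃ t₁ ∈ Icc 0 L, f t₁ = R ∧ ∀ s ∈ Icc 0 t₁, f s ≤ R := by
  set A := Icc 0 L ∩ f ⁻¹' Ici R with hA
  have hcl : IsClosed A := hf.preimage_isClosed_of_isClosed isClosed_Icc isClosed_Ici
  have hcpt : IsCompact A := isCompact_Icc.of_isClosed_subset hcl inter_subset_left
  have hmem : sInf A ∈ A := hcpt.sInf_mem ⟨t, ht, htR⟩
  set t₁ := sInf A with ht₁
  have hmin : ∀ s ∈ A, t₁ ≤ s := fun s hs => csInf_le hcpt.bddBelow hs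
  obtain ⟨s, hs, hsR⟩ : R ∈ f '' Icc 0 t₁ :=
    intermediate_value_Icc hmem.1.1 (hf.mono (Icc_subset_Icc_right hmem.1.2)) ⟨h0.le, hmem.2⟩
  have hst : s = t₁ := le_antisymm hs.2 (hmin s ⟨⟨hs.1, hs.2.trans hmem.1.2⟩, hsR.ge⟩)
  refine ⟨t₁, hmem.1, hst ▸ hsR, fun s hs => ?_⟩
  by_contra! hc
  have := hmin s ⟨⟨hs.1, hs.2.trans hmem.1.2⟩, hc.le⟩
  rw [le_antisymm hs.2 this, ← hst] at hc
  exact hc.ne' hsR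

/-! ### Additive localization near a boundary point. -/

section AdditiveLocalization

variable {E : Type*} [NormedAddCommGroup E] [NormedSpace ℂ E] {Ω U : Set E}

theorem isCompact_setOf_kobayashiDist_le [ProperSpace E] [IsBoundedDomain Ω] [CompleteSpace (KobayashiSpace Ω)]
    {o : E} (ho : o ∈ Ω) (C : ℝ) : IsCompact {z | z ∈ Ω ∧ kobayashiDist Ω z o ≤ C} := by
  have h := (isCompact_closedBall (⟨o, ho⟩ : KobayashiSpace Ω) C).image
    KobayashiSpace.continuous_val
  convert h using 1
  ext z
  constructor
  · rintro ⟨hz, hzC⟩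
    exact ⟨⟨z, hz⟩, hzC, rfl⟩
  · rintro ⟨z, hz, rfl⟩
    exact ⟨z.property, hz⟩

/-- Split the geodesic at its point `γ t₀` nearest to `o`. Bounded products turn the distance to `o`
into a lower bound for the distance to `Ω \ U`, which therefore grows linearly along both halves. -/
theorem exists_geodesic_length_bound [IsBoundedDomain Ω] [IsBoundedDomain (Ω ∩ U)]
    (hG : HasBoundedProducts Ω) {p : E} {R : ℝ} (hR : 0 < R) (hRU : closedBall p (2 * R) ⊆ U) :
    ∃ C, ∀ (γ : ℝ → E) (L : ℝ), 0 ≤ L → (∀ t, γ t ∈ Ω) →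
      (∀ s ∈ Icc 0 L, ∀ t ∈ Icc 0 L, kobayashiDist Ω (γ s) (γ t) = |s - t|) →
      (∀ t ∈ Icc 0 L, dist (γ t) p ≤ R) → kobayashiDist (Ω ∩ U) (γ 0) (γ L) ≤ L + C := by
  obtain ⟨M, hM0, hM⟩ := exists_dist_le_mul_kobayashiDist Ω
  obtain ⟨o, ho⟩ := (IsBoundedDomain.isConnected (D := Ω)).nonempty
  obtain ⟨C₁, hC₁⟩ := hG o ho R hR
  set ρ := R / M with hρ
  have hρ0 : 0 < ρ := by positivity
  obtain ⟨C₂, hC₂⟩ := exists_kobayashiDist_inter_le_add (E := E) hρ0 C₁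
  refine ⟨2 * C₂, fun γ L hL hγ hiso hball => ?_⟩
  have hmemU : ∀ t ∈ Icc 0 L, γ t ∈ Ω ∩ U := fun t ht =>
    ⟨hγ t, hRU (mem_closedBall.2 (by linarith [hball t ht]))⟩
  have hcont : ContinuousOn (fun t => kobayashiDist Ω (γ t) o) (Icc 0 L) := by
    refine LipschitzOnWith.continuousOn (K := 1) (LipschitzOnWith.of_le_add fun s hs t ht => ?_)
    have h1 := kobayashiDist_triangle (hγ s) (hγ t) ho
    rw [hiso s hs t ht] at h1
    rw [Real.dist_eq]
    linarith
  obtain ⟨t₀, ht₀, hmin⟩ := isCompact_Icc.exists_isMinOn ⟨0, ⟨le_rfl, hL⟩⟩ hcont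
  -- Go from `γ t` to `γ t₀` through `o`; by minimality the second leg is no longer than the first.
  have hlow : ∀ t ∈ Icc 0 L, |t - t₀| / 2 ≤ kobayashiDist Ω (γ t) o := by
    intro t ht
    have h1 := kobayashiDist_triangle (hγ t) ho (hγ t₀)
    rw [hiso t ht t₀ ht₀, kobayashiDist_comm Ω o] at h1
    have h2 : kobayashiDist Ω (γ t₀) o ≤ kobayashiDist Ω (γ t) o := hmin ht
    linarith
  have hfar : ∀ t ∈ Icc 0 L, ∀ w ∈ Ω, w ∉ U → ρ ≤ kobayashiDist Ω (γ t) w ∧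
      |t - t₀| / 2 - C₁ ≤ kobayashiDist Ω (γ t) w := by
    intro t ht w hw hwU
    have h1 : 2 * R ≤ dist w p := by
      by_contra! hc
      exact hwU (hRU hc.le)
    have h2 : R ≤ dist (γ t) w := by
      linarith [dist_triangle w (γ t) p, hball t ht, dist_comm w (γ t)]
    have h3 := hM _ (hγ t) w hw
    have h4 := hC₁ _ (hγ t) w hw h2
    constructor
    · rw [hρ, div_le_iff₀ hM0]; linarith
    · linarith [hlow t ht, kobayashiDist_nonneg Ω w o]
  have hleft := hC₂ Ω U (fun s => γ (t₀ - s)) t₀ ht₀.1 (fun t _ => hγ _)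
    (fun s hs t ht => by
      rw [hiso _ ⟨by linarith [hs.2], by linarith [hs.1, ht₀.2]⟩ _
        ⟨by linarith [ht.2], by linarith [ht.1, ht₀.2]⟩, sub_sub_sub_cancel_left, abs_sub_comm])
    (fun t ht w hw hwU => by
      have := hfar (t₀ - t) ⟨by linarith [ht.2], by linarith [ht.1, ht₀.2]⟩ w hw hwU
      rwa [sub_sub_cancel_left, abs_neg, abs_of_nonneg ht.1] at this)
  have hright := hC₂ Ω U (fun s => γ (t₀ + s)) (L - t₀) (sub_nonneg.2 ht₀.2) (fun t _ => hγ _)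
    (fun s hs t ht => by
      rw [hiso _ ⟨by linarith [hs.1, ht₀.1], by linarith [hs.2]⟩ _
        ⟨by linarith [ht.1, ht₀.1], by linarith [ht.2]⟩, add_sub_add_left_eq_sub])
    (fun t ht w hw hwU => by
      have := hfar (t₀ + t) ⟨by linarith [ht.1, ht₀.1], by linarith [ht.2]⟩ w hw hwU
      rwa [add_sub_cancel_left, abs_of_nonneg ht.1] at this)
  simp only [sub_zero, sub_self, add_zero, add_sub_cancel] at hleft hright
  have h1 := kobayashiDist_triangle (hmemU 0 ⟨le_rfl, hL⟩) (hmemU t₀ ht₀) (hmemU L ⟨hL, le_rfl⟩)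
  rw [kobayashiDist_comm _ (γ 0) (γ t₀)] at h1
  linarith

/-- Additive localization of the Kobayashi distance near a boundary point. -/
theorem HasBoundedProducts.exists_inter_le_add [ProperSpace E] [hΩ : IsBoundedDomain Ω]
    [CompleteSpace (KobayashiSpace Ω)] (hG : HasBoundedProducts Ω) {p : E} (hU : IsOpen U)
    (hpU : p ∈ U) [hΩU : IsBoundedDomain (Ω ∩ U)] :
    ∃ r > 0, ball p r ⊆ U ∧ ∃ C, ∀ x ∈ Ω, dist x p < r → ∀ y ∈ Ω, dist y p < r →
      kobayashiDist (Ω ∩ U) x y ≤ kobayashiDist Ω x y + C := by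
  obtain ⟨R', hR', hRU'⟩ := Metric.nhds_basis_closedBall.mem_iff.1 (hU.mem_nhds hpU)
  set R := R' / 2 with hRdef
  have hR : 0 < R := by positivity
  have hRU : closedBall p (2 * R) ⊆ U := by rwa [hRdef, mul_div_cancel₀ _ two_ne_zero]
  have hRU₁ : closedBall p R ⊆ U := (closedBall_subset_closedBall (by linarith)).trans hRU
  obtain ⟨o, ho⟩ := hΩU.isConnected.nonempty
  obtain ⟨C₂, hC₂⟩ := exists_geodesic_length_bound hG hR hRU
  obtain ⟨C₃, hC₃⟩ := hG o ho.1 (R / 2) (by positivity)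
  -- Possible exit points fill a compact subset of `Ω ∩ U`, on which the distance to `o` in `Ω ∩ U`
  -- is bounded.
  obtain ⟨C₄, hC₄⟩ := ((isCompact_setOf_kobayashiDist_le ho.1 C₃).inter_right
    (isClosed_closedBall (x := p) (ε := R))).exists_kobayashiDist_le (D := Ω ∩ U)
    (fun z hz => ⟨hz.1.1, hRU₁ hz.2⟩) ho
  refine ⟨R / 2, by positivity, (ball_subset_closedBall.trans
    (closedBall_subset_closedBall (by linarith))).trans hRU₁, |C₂| + |C₂| + 4 * |C₃| + 2 * |C₄|,
    fun x hx hxp y hy hyp => ?_⟩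
  have hxU : x ∈ Ω ∩ U := ⟨hx, hRU₁ (mem_closedBall.2 (by linarith))⟩
  have hyU : y ∈ Ω ∩ U := ⟨hy, hRU₁ (mem_closedBall.2 (by linarith))⟩
  have a2 := le_abs_self C₂
  have a3 := le_abs_self C₃
  have a4 := le_abs_self C₄
  have b2 := abs_nonneg C₂
  have b3 := abs_nonneg C₃
  have b4 := abs_nonneg C₄
  -- Either a geodesic stays in the ball, or it exits at a point close to `o`.
  have key : ∀ x ∈ Ω, dist x p < R / 2 → ∀ y ∈ Ω, dist y p < R / 2 →
      ∀ γ : ℝ → E, (∀ t, γ t ∈ Ω) → γ 0 = x → γ (kobayashiDist Ω x y) = y →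
      (∀ s ∈ Icc 0 (kobayashiDist Ω x y), ∀ t ∈ Icc 0 (kobayashiDist Ω x y),
        kobayashiDist Ω (γ s) (γ t) = |s - t|) →
      ContinuousOn γ (Icc 0 (kobayashiDist Ω x y)) →
      (∃ t ∈ Icc 0 (kobayashiDist Ω x y), R < dist (γ t) p) →
      ∃ m ∈ Ω, dist m p = R ∧ kobayashiDist Ω m o ≤ C₃ ∧
        kobayashiDist Ω x o + kobayashiDist Ω y o ≤ kobayashiDist Ω x y + 2 * C₃ ∧
        kobayashiDist (Ω ∩ U) x m ≤ kobayashiDist Ω x m + C₂ := by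
    intro x hx hxp y hy hyp γ hγ hγ0 hγL hiso hcont ⟨t, ht, htR⟩
    set L := kobayashiDist Ω x y with hL
    have hL0 : 0 ≤ L := kobayashiDist_nonneg _ _ _
    obtain ⟨t₁, ht₁, hR₁, hle⟩ := ContinuousOn.exists_first_eq
      ((continuous_id.dist continuous_const).comp_continuousOn hcont)
      (show dist (γ 0) p < R by rw [hγ0]; linarith) ht htR.le
    change dist (γ t₁) p = R at hR₁
    have h1 := hC₃ x hx _ (hγ t₁) (by linarith [dist_triangle (γ t₁) x p, dist_comm x (γ t₁)])
    have h2 := hC₃ y hy _ (hγ t₁) (by linarith [dist_triangle (γ t₁) y p, dist_comm y (γ t₁)])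
    have h3 := hiso 0 ⟨le_rfl, hL0⟩ t₁ ht₁
    have h4 := hiso L ⟨hL0, le_rfl⟩ t₁ ht₁
    rw [hγ0, zero_sub, abs_neg, abs_of_nonneg ht₁.1] at h3
    rw [hγL, abs_of_nonneg (sub_nonneg.2 ht₁.2)] at h4
    have h5 := kobayashiDist_triangle hx ho.1 hy
    rw [kobayashiDist_comm Ω o y] at h5
    have h6 := kobayashiDist_nonneg Ω (γ t₁) o
    refine ⟨γ t₁, hγ _, hR₁, by linarith, by linarith, ?_⟩
    · have h1 := hC₂ γ t₁ ht₁.1 hγ (fun s hs t ht => hiso s ⟨hs.1, hs.2.trans ht₁.2⟩ t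
        ⟨ht.1, ht.2.trans ht₁.2⟩) hle
      have h3 := hiso 0 ⟨le_rfl, hL0⟩ t₁ ht₁
      rw [hγ0, zero_sub, abs_neg, abs_of_nonneg ht₁.1] at h3
      rw [hγ0] at h1
      rwa [h3]
  obtain ⟨γ, hγ, hγ0, hγL, hiso, hcont⟩ := exists_kobayashi_geodesic hx hy
  have hL0 : 0 ≤ kobayashiDist Ω x y := kobayashiDist_nonneg _ _ _
  by_cases hex : ∃ t ∈ Icc 0 (kobayashiDist Ω x y), R < dist (γ t) p
  · obtain ⟨m, hm, hmp, hmo, hxyo, hxm⟩ := key x hx hxp y hy hyp γ hγ hγ0 hγL hiso hcont hex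
    have hLs := kobayashiDist_comm Ω y x
    have hmap : MapsTo (fun t => kobayashiDist Ω x y - t) (Icc 0 (kobayashiDist Ω x y))
        (Icc 0 (kobayashiDist Ω x y)) := fun t ht => ⟨by linarith [ht.2], by linarith [ht.1]⟩
    -- The reversed geodesic gives the exit point seen from `y`; the distance is then estimated
    -- along `x, m, o, m', y`.
    obtain ⟨m', hm', hmp', hmo', -, hym⟩ := key y hy hyp x hx hxp
      (fun t => γ (kobayashiDist Ω x y - t)) (fun t => hγ _) (by simpa using hγL)
      (by simpa [hLs] using hγ0)
      (by
        rw [hLs]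
        intro s hs t ht
        rw [hiso _ (hmap hs) _ (hmap ht), sub_sub_sub_cancel_left, abs_sub_comm])
      (by
        rw [hLs]
        exact hcont.comp (by fun_prop) hmap)
      (by
        rw [hLs]
        obtain ⟨t, ht, htR⟩ := hex
        exact ⟨_, hmap ht, by simpa using htR⟩)
    have hmU : m ∈ Ω ∩ U := ⟨hm, hRU₁ hmp.le⟩
    have hmU' : m' ∈ Ω ∩ U := ⟨hm', hRU₁ hmp'.le⟩
    have h1 := hC₄ m ⟨⟨hm, hmo⟩, hmp.le⟩
    have h2 := hC₄ m' ⟨⟨hm', hmo'⟩, hmp'.le⟩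
    have h3 := kobayashiDist_triangle hxU hmU hyU
    have h4 := kobayashiDist_triangle hmU ho hyU
    have h5 := kobayashiDist_triangle ho hmU' hyU
    have h6 := kobayashiDist_triangle hx ho.1 hm
    have h7 := kobayashiDist_triangle hy ho.1 hm'
    linarith [kobayashiDist_comm (Ω ∩ U) o m', kobayashiDist_comm (Ω ∩ U) m' y,
      kobayashiDist_comm Ω o m, kobayashiDist_comm Ω o m']
  · push Not at hex
    have := hC₂ γ _ hL0 hγ hiso hex
    rw [hγ0, hγL] at this
    linarith

end AdditiveLocalization

/-! ### Global Gromov hyperbolicity. -/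

section GlobalHyperbolicity

variable {E : Type*} [NormedAddCommGroup E] [NormedSpace ℂ E] [ProperSpace E] {Ω : Set E}

/-- Additive localization changes each distance by a bounded amount, and passing from a base point
`o'` near `p` to `o` costs another constant. -/
theorem exists_fourPoint_near_frontier [hΩ : IsBoundedDomain Ω] [CompleteSpace (KobayashiSpace Ω)]
    (hG : HasBoundedProducts Ω) (hloc : IsLocallyGromovHyperbolic Ω) {o : E} (ho : o ∈ Ω) {p : E}
    (hp : p ∈ frontier Ω) : ∃ r > 0, ∃ C, ∀ x ∈ Ω, dist x p < r → ∀ y ∈ Ω, dist y p < r →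
      ∀ z ∈ Ω, dist z p < r → kobayashiDist Ω x y + kobayashiDist Ω z o ≤
        max (kobayashiDist Ω x z + kobayashiDist Ω y o)
          (kobayashiDist Ω x o + kobayashiDist Ω y z) + C := by
  obtain ⟨U, hU, hpU, hUc, hUcomp, hUG⟩ := hloc p hp
  have := IsBoundedDomain.inter hU hUc
  have := hUcomp.2
  obtain ⟨δ, hδ⟩ := hUG.fourPointCondition
  obtain ⟨r, hr, hrU, C, hC⟩ := hG.exists_inter_le_add hU hpU
  obtain ⟨o', ho', ho'r⟩ : ∃ o' ∈ Ω, dist o' p < r := by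
    obtain ⟨o', h1, h2⟩ := Metric.mem_closure_iff.1 (frontier_subset_closure hp) r hr
    exact ⟨o', h1, by rwa [dist_comm]⟩
  refine ⟨r, hr, δ + 2 * C + 2 * kobayashiDist Ω o o', fun x hx hxr y hy hyr z hz hzr => ?_⟩
  have hU' : ∀ a ∈ Ω, dist a p < r → a ∈ Ω ∩ U := fun a ha har => ⟨ha, hrU har⟩
  have h4 := hδ ⟨x, hU' x hx hxr⟩ ⟨y, hU' y hy hyr⟩ ⟨z, hU' z hz hzr⟩ ⟨o', hU' o' ho' ho'r⟩
  simp only [KobayashiSpace.dist_eq] at h4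
  have h1 := kobayashiDist_anti inter_subset_left (hU' x hx hxr) (hU' y hy hyr)
  have h2 := kobayashiDist_anti inter_subset_left (hU' z hz hzr) (hU' o' ho' ho'r)
  have h3 := hC x hx hxr z hz hzr
  have h5 := hC y hy hyr o' ho' ho'r
  have h6 := hC x hx hxr o' ho' ho'r
  have h7 := hC y hy hyr z hz hzr
  have h8 := kobayashiDist_triangle hz ho' ho
  have h9 := kobayashiDist_triangle hy ho ho'
  have h10 := kobayashiDist_triangle hx ho ho'
  have h11 := kobayashiDist_comm Ω o o'
  rw [← sub_le_iff_le_add, le_max_iff] at h4 ⊢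
  rcases h4 with h4 | h4
  · left; linarith
  · right; linarith

/-- Local Gromov hyperbolicity and bounded products imply Gromov's four point condition. -/
theorem HasBoundedProducts.fourPointCondition [hΩ : IsBoundedDomain Ω]
    [CompleteSpace (KobayashiSpace Ω)] (hG : HasBoundedProducts Ω)
    (hloc : IsLocallyGromovHyperbolic Ω) : ∃ δ, FourPointCondition (KobayashiSpace Ω) δ := by
  obtain ⟨o, ho⟩ := hΩ.isConnected.nonempty
  suffices ∃ C, ∀ x ∈ Ω, ∀ y ∈ Ω, ∀ z ∈ Ω, kobayashiDist Ω x y + kobayashiDist Ω z o ≤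
        max (kobayashiDist Ω x z + kobayashiDist Ω y o)
          (kobayashiDist Ω x o + kobayashiDist Ω y z) + C by
    obtain ⟨C, hC⟩ := this
    refine ⟨2 * C, FourPointCondition.of_base (o := ⟨o, ho⟩) fun x y z => ?_⟩
    simp only [KobayashiSpace.dist_eq]
    exact hC _ x.property _ y.property _ z.property
  by_contra! hcon
  choose x hx y hy z hz hlt using fun n : ℕ => hcon n
  have hbig (C : ℝ) : ∀ᶠ n in atTop,
      kobayashiDist Ω (x n) (z n) + kobayashiDist Ω (y n) o + C <
        kobayashiDist Ω (x n) (y n) + kobayashiDist Ω (z n) o ∧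
      kobayashiDist Ω (x n) o + kobayashiDist Ω (y n) (z n) + C <
        kobayashiDist Ω (x n) (y n) + kobayashiDist Ω (z n) o := by
    obtain ⟨N, hN⟩ := exists_nat_gt C
    filter_upwards [eventually_ge_atTop N] with n hn
    have h1 : (N : ℝ) ≤ n := by exact_mod_cast hn
    have h2 := hlt n
    rw [← lt_sub_iff_add_lt, max_lt_iff] at h2
    constructor <;> linarith
  -- If `z` stays apart from `x` or `y`, their product is bounded and the triangle inequality
  -- already gives the condition; so bad triples coalesce.
  have hxz : ∀ ε > 0, ∀ᶠ n in atTop, dist (x n) (z n) < ε ∧ dist (y n) (z n) < ε := by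
    intro ε hε
    obtain ⟨C, hC⟩ := hG o ho ε hε
    filter_upwards [hbig C] with n hn
    have h1 := kobayashiDist_triangle (hx n) ho (hy n)
    have h2 := kobayashiDist_comm Ω o (y n)
    constructor
    · by_contra! hc
      linarith [hC _ (hx n) _ (hz n) hc]
    · by_contra! hc
      linarith [hC _ (hy n) _ (hz n) hc]
  obtain ⟨p, hp, φ, hφ, hzp⟩ := hΩ.isBounded.isCompact_closure.tendsto_subseq
    fun n => subset_closure (hz n)
  by_cases hpΩ : p ∈ Ω
  · have h1 := tendsto_kobayashiDist (fun n => hz (φ n)) hpΩ ho hzp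
    obtain ⟨n, h2, h3⟩ := ((hφ.tendsto_atTop.eventually
      (hbig (2 * (kobayashiDist Ω p o + 1)))).and (h1.eventually_lt_const (lt_add_one _))).exists
    have h4 := kobayashiDist_triangle (hx (φ n)) (hz (φ n)) (hy (φ n))
    have h5 := kobayashiDist_triangle (hz (φ n)) ho (hy (φ n))
    have h6 := kobayashiDist_comm Ω o (y (φ n))
    linarith [h2.1]
  · obtain ⟨r, hr, C, hC⟩ := exists_fourPoint_near_frontier hG hloc ho
      (mem_frontier_of_not_mem hp hpΩ)
    obtain ⟨n, h1, h2, h3⟩ := ((hφ.tendsto_atTop.eventually (hbig C)).and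
      ((hφ.tendsto_atTop.eventually (hxz (r / 2) (by positivity))).and
      (hzp.eventually (ball_mem_nhds p (show 0 < r / 2 by positivity))))).exists
    have h3' : dist (z (φ n)) p < r / 2 := h3
    have h4 := hC _ (hx (φ n)) (by linarith [dist_triangle (x (φ n)) (z (φ n)) p, h2.1])
      _ (hy (φ n)) (by linarith [dist_triangle (y (φ n)) (z (φ n)) p, h2.2])
      _ (hz (φ n)) (by linarith)
    rw [← sub_le_iff_le_add, le_max_iff] at h4
    rcases h4 with h4 | h4 <;> linarith [h1.1, h1.2]

end GlobalHyperbolicity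

/-! ### The extension of the identity to the Gromov closure. -/

section BoundaryMap

variable {E : Type*} [NormedAddCommGroup E] [NormedSpace ℂ E] {Ω : Set E}

/-- Before stopping, points at times `s ≤ t` of a generalized ray from `o` have Gromov product `s`,
so beyond a time depending only on `ε` they must be Euclidean close; after stopping they coincide.
-/
theorem HasBoundedProducts.exists_dist_lt [IsBoundedDomain Ω] (hG : HasBoundedProducts Ω)
    (o : KobayashiSpace Ω) {ε : ℝ} (hε : 0 < ε) : ∃ T : ℝ≥0, ∀ c z, IsGeneralizedRay o c z →
      ∀ s ≥ T, ∀ t ≥ T, dist (c s).val (c t).val < ε := by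
  obtain ⟨C, hC⟩ := hG o.val o.property ε hε
  refine ⟨⟨|C| + 1, by positivity⟩, fun c z hc => ?_⟩
  obtain ⟨h0, R, hR, -⟩ := hc.exists_length
  have key : ∀ s t : ℝ≥0, |C| + 1 ≤ s → s ≤ t → dist (c s).val (c t).val < ε := by
    intro s t hs hst
    by_contra! hcon
    have h1 := hC _ (c s).property _ (c t).property hcon
    have h2 := hR s 0
    have h3 := hR t 0
    have h4 := hR s t
    rw [h0, stoppedTime_zero, sub_zero, abs_of_nonneg (stoppedTime_nonneg _ _),
      KobayashiSpace.dist_eq] at h2 h3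
    rw [abs_sub_comm, abs_of_nonneg (sub_nonneg.2 (stoppedTime_mono R hst)),
      KobayashiSpace.dist_eq] at h4
    rw [h2, h3, h4] at h1
    rcases le_total (s : ℝ≥0∞) R with h | h
    · rw [stoppedTime_of_le h] at h1
      linarith [le_abs_self C, abs_nonneg C]
    · have h5 := hR s t
      rw [stoppedTime_of_ge h, stoppedTime_of_ge (h.trans (ENNReal.coe_le_coe.2 hst)), sub_self,
        abs_zero, dist_eq_zero] at h5
      rw [h5, dist_self] at hcon
      linarith
  intro s hs t ht
  rcases le_total s t with h | h
  · exact key s t hs h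
  · rw [dist_comm]; exact key t s ht h

theorem GeodesicRay.isGeneralizedRay {X : Type*} [MetricSpace X] (c : GeodesicRay X) :
    IsGeneralizedRay (c.toFun 0) c.toFun (.ideal c.endpoint) := .ray c rfl

theorem GeodesicRay.exists_dist_le_of_endpoint_eq {X : Type*} [MetricSpace X]
    {c c' : GeodesicRay X} (h : c.endpoint = c'.endpoint) :
    ∃ C : ℝ, ∀ t, dist (c.toFun t) (c'.toFun t) ≤ C := by
  obtain ⟨C, hC⟩ : ∃ C : ℝ≥0, ∀ t, edist (c.toFun t) (c'.toFun t) ≤ C := Quotient.exact h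
  exact ⟨C, fun t => by rw [dist_edist]; simpa using ENNReal.toReal_mono ENNReal.coe_ne_top (hC t)⟩

theorem GeodesicRay.endpoint_eq_of_dist_le {X : Type*} [MetricSpace X]
    {c c' : GeodesicRay X} {C : ℝ} (h : ∀ t, dist (c.toFun t) (c'.toFun t) ≤ C) :
    c.endpoint = c'.endpoint :=
  Quotient.sound ⟨C.toNNReal, fun t => by
    rw [edist_dist]; exact ENNReal.ofReal_le_ofReal (h t)⟩

theorem GeodesicRay.dist_zero {X : Type*} [MetricSpace X] (c : GeodesicRay X) (t : ℝ≥0) :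
    dist (c.toFun t) (c.toFun 0) = t := by
  rw [c.dist_eq, NNReal.coe_zero, sub_zero, abs_of_nonneg t.coe_nonneg]

theorem GeodesicRay.not_mem_of_tendsto [IsBoundedDomain Ω] (c : GeodesicRay (KobayashiSpace Ω))
    {p : E} (h : Tendsto (fun t => (c.toFun t).val) atTop (𝓝 p)) : p ∉ Ω := by
  intro hp
  have h1 := (KobayashiSpace.tendsto_iff (x := ⟨p, hp⟩)).2 h
  have h2 := h1.dist (tendsto_const_nhds (x := c.toFun 0))
  simp only [c.dist_zero] at h2
  exact not_tendsto_nhds_of_tendsto_atTop (NNReal.tendsto_coe_atTop.2 tendsto_id) _ h2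

theorem HasBoundedProducts.exists_limit [ProperSpace E] [hΩ : IsBoundedDomain Ω]
    (hG : HasBoundedProducts Ω) (c : GeodesicRay (KobayashiSpace Ω)) :
    ∃ p ∈ frontier Ω, Tendsto (fun t => (c.toFun t).val) atTop (𝓝 p) := by
  have hcau : CauchySeq fun t => (c.toFun t).val := by
    refine Metric.cauchySeq_iff.2 fun ε hε => ?_
    obtain ⟨T, hT⟩ := hG.exists_dist_lt (c.toFun 0) hε
    exact ⟨T, hT _ _ c.isGeneralizedRay⟩
  obtain ⟨p, hp⟩ := cauchySeq_tendsto_of_complete hcau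
  have hpcl := mem_closure_of_tendsto hp (Eventually.of_forall fun t => (c.toFun t).property)
  exact ⟨p, mem_frontier_of_not_mem hpcl (c.not_mem_of_tendsto hp), hp⟩

/-- Asymptotic rays have unbounded products at equal times, which is impossible at a definite
Euclidean distance. -/
theorem HasBoundedProducts.limit_unique [hΩ : IsBoundedDomain Ω]
    (hG : HasBoundedProducts Ω) {c c' : GeodesicRay (KobayashiSpace Ω)}
    (h : c.endpoint = c'.endpoint) {p p' : E}
    (hp : Tendsto (fun t => (c.toFun t).val) atTop (𝓝 p))
    (hp' : Tendsto (fun t => (c'.toFun t).val) atTop (𝓝 p')) : p = p' := by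
  by_contra hne
  obtain ⟨C, hC⟩ := GeodesicRay.exists_dist_le_of_endpoint_eq h
  have hd : 0 < dist p p' := dist_pos.2 hne
  obtain ⟨C', hC'⟩ := hG _ (c.toFun 0).property (dist p p' / 2) (by positivity)
  have h1 := (hp.dist hp').eventually_const_lt (half_lt_self hd)
  obtain ⟨t, h2, h3⟩ := (h1.and (eventually_gt_atTop (C + C').toNNReal)).exists
  have h4 := hC' _ (c.toFun t).property _ (c'.toFun t).property h2.le
  have h5 := c.dist_zero t
  have h6 := hC t
  rw [KobayashiSpace.dist_eq] at h5 h6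
  have h7 : C + C' < t := (Real.le_coe_toNNReal _).trans_lt (NNReal.coe_lt_coe.2 h3)
  have := kobayashiDist_nonneg Ω (c'.toFun t).val (c.toFun 0).val
  linarith

/-- `Φ` extends the identity of `Ω` and maps a point at infinity to the limit of its rays. -/
def IsBoundaryExtension (Φ : GromovClosure (KobayashiSpace Ω) → closure Ω) : Prop :=
  (∀ x : KobayashiSpace Ω, (Φ (.inner x) : E) = x.val) ∧
    ∀ c : GeodesicRay (KobayashiSpace Ω),
      Tendsto (fun t => (c.toFun t).val) atTop (𝓝 (Φ (.ideal c.endpoint) : E))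

theorem HasBoundedProducts.exists_isBoundaryExtension [ProperSpace E] [hΩ : IsBoundedDomain Ω]
    (hG : HasBoundedProducts Ω) :
    ∃ Φ : GromovClosure (KobayashiSpace Ω) → closure Ω, IsBoundaryExtension Φ := by
  have hex (z : GromovClosure (KobayashiSpace Ω)) : ∃ p : closure Ω,
      (∀ x, z = .inner x → (p : E) = x.val) ∧
      ∀ c : GeodesicRay (KobayashiSpace Ω), z = .ideal c.endpoint →
        Tendsto (fun t => (c.toFun t).val) atTop (𝓝 (p : E)) := by
    cases z with
    | inner x =>
      refine ⟨⟨x.val, subset_closure x.property⟩, ?_, by simp⟩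
      rintro y ⟨⟩
      rfl
    | ideal ξ =>
      obtain ⟨c, rfl⟩ : ∃ c : GeodesicRay (KobayashiSpace Ω), c.endpoint = ξ :=
        Quotient.exists_rep ξ
      obtain ⟨p, hp, hlim⟩ := hG.exists_limit c
      refine ⟨⟨p, frontier_subset_closure hp⟩, by simp, fun c' hc' => ?_⟩
      obtain ⟨p', -, hlim'⟩ := hG.exists_limit c'
      rw [GromovClosure.ideal.injEq] at hc'
      exact hG.limit_unique hc' hlim hlim' ▸ hlim'
  choose Φ hΦ using hex
  exact ⟨Φ, fun x => (hΦ _).1 x rfl, fun c => (hΦ _).2 c rfl⟩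

variable {Φ : GromovClosure (KobayashiSpace Ω) → closure Ω}

theorem IsBoundaryExtension.tendsto [IsBoundedDomain Ω] (hΦ : IsBoundaryExtension Φ)
    {o : KobayashiSpace Ω} {c : ℝ≥0 → KobayashiSpace Ω} {z : GromovClosure (KobayashiSpace Ω)}
    (hc : IsGeneralizedRay o c z) : Tendsto (fun t => (c t).val) atTop (𝓝 (Φ z : E)) := by
  cases hc with
  | segment _ R h0 hiso hconst =>
    rw [hΦ.1]
    refine tendsto_const_nhds.congr' ?_
    filter_upwards [eventually_ge_atTop R] with t ht
    rw [hconst t ht]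
  | ray c h0 => exact hΦ.2 c

/-- The tail estimate is uniform over rays from `o`, so convergence of the endpoints reduces to
convergence at a single time `T`. -/
theorem IsBoundaryExtension.tendsto_of_tendstoUniformlyOn [IsBoundedDomain Ω]
    (hΦ : IsBoundaryExtension Φ) (hG : HasBoundedProducts Ω) {o : KobayashiSpace Ω}
    {c : ℕ → ℝ≥0 → KobayashiSpace Ω} {u : ℕ → GromovClosure (KobayashiSpace Ω)}
    (hc : ∀ n, IsGeneralizedRay o (c n) (u n)) {c' : ℝ≥0 → KobayashiSpace Ω}
    {z : GromovClosure (KobayashiSpace Ω)} (hc' : IsGeneralizedRay o c' z)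
    (h : ∀ T : ℝ≥0, TendstoUniformlyOn c c' atTop (Iic T)) :
    Tendsto (fun n => Φ (u n)) atTop (𝓝 (Φ z)) := by
  refine Metric.tendsto_nhds.2 fun ε hε => ?_
  obtain ⟨T, hT⟩ := hG.exists_dist_lt o (show 0 < ε / 3 by positivity)
  have hle : ∀ c z, IsGeneralizedRay o c z → dist (c T).val (Φ z : E) ≤ ε / 3 := by
    intro c z hcz
    refine le_of_tendsto (tendsto_const_nhds.dist (hΦ.tendsto hcz)) ?_
    filter_upwards [eventually_ge_atTop T] with t ht using (hT c z hcz T le_rfl t ht).le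
  have h1 : Tendsto (fun n => (c n T).val) atTop (𝓝 (c' T).val) :=
    KobayashiSpace.tendsto_iff.1 ((h T).tendsto_at (mem_Iic.2 le_rfl))
  filter_upwards [Metric.tendsto_nhds.1 h1 (ε / 3) (by positivity)] with n hn
  rw [Subtype.dist_eq]
  have h2 := hle _ _ (hc n)
  have h3 := hle _ _ hc'
  have h4 := dist_triangle4 (Φ (u n) : E) (c n T).val (c' T).val (Φ z : E)
  rw [dist_comm] at h2
  linarith

theorem IsBoundaryExtension.isHomeomorph [ProperSpace E] [hΩ : IsBoundedDomain Ω]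
    [CompleteSpace (KobayashiSpace Ω)] (hΦ : IsBoundaryExtension Φ) (hG : HasBoundedProducts Ω)
    (hinj : Function.Injective Φ) (o : KobayashiSpace Ω) :
    @IsHomeomorph _ _ (gromovTopology o) _ Φ := by
  let := gromovTopology o
  -- For an ideal point, segments from `o` to the points of a ray subconverge; the limit has the
  -- same image under `Φ`, so injectivity identifies its endpoint.
  have hray (z : GromovClosure (KobayashiSpace Ω)) : ∃ c, IsGeneralizedRay o c z := by
    cases z with
    | inner x => exact exists_isGeneralizedRay_inner o x
    | ideal ξ =>
      obtain ⟨c, rfl⟩ : ∃ c : GeodesicRay (KobayashiSpace Ω), c.endpoint = ξ :=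
        Quotient.exists_rep ξ
      choose σ hσ using fun n : ℕ => exists_isGeneralizedRay_inner o (c.toFun n)
      obtain ⟨φ, hφ, c', z, hz, hlim⟩ := exists_subseq_isGeneralizedRay hσ
      have h1 := hΦ.tendsto_of_tendstoUniformlyOn hG (fun n => hσ (φ n)) hz hlim
      rw [tendsto_subtype_rng] at h1
      simp only [hΦ.1] at h1
      have h2 := (hΦ.2 c).comp (tendsto_natCast_atTop_atTop.comp hφ.tendsto_atTop)
      have h3 : z = .ideal c.endpoint := hinj (Subtype.ext (tendsto_nhds_unique h1 h2))
      exact ⟨c', h3 ▸ hz⟩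
  have hcont : Continuous Φ := by
    refine continuous_iff_isClosed.2 fun F hF => isClosed_gromovTopology_iff.2 ?_
    rintro u z hu ⟨c, hc, hsub⟩
    obtain ⟨ψ, hψ, c', hc', hlim⟩ := hsub id strictMono_id
    exact hF.mem_of_tendsto (hΦ.tendsto_of_tendstoUniformlyOn hG (fun n => hc (ψ n)) hc' hlim)
      (Eventually.of_forall fun n => hu (ψ n))
  have hclosed : IsClosedMap Φ := by
    intro B hB
    refine isSeqClosed_iff_isClosed.1 fun w p hw hp => ?_
    choose u hu hΦu using hw
    choose c hc using fun n => hray (u n)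
    obtain ⟨φ, hφ, c', z, hz, hlim⟩ := exists_subseq_isGeneralizedRay hc
    have h1 := hΦ.tendsto_of_tendstoUniformlyOn hG (fun n => hc (φ n)) hz hlim
    simp only [hΦu] at h1
    have h2 := tendsto_nhds_unique h1 (hp.comp hφ.tendsto_atTop)
    exact ⟨z, isClosed_gromovTopology_iff.1 hB _ z (fun n => hu (φ n))
      (gromovConverges_of_tendsto (fun n => hc (φ n)) hz hlim), h2⟩
  -- The range is closed and contains `Ω`, which is dense in its closure.
  have hsurj : Function.Surjective Φ := by
    rw [← range_eq_univ]
    have h1 : IsClosed (range Φ) := hclosed.isClosed_range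
    refine eq_univ_of_univ_subset fun p _ => ?_
    rw [← h1.closure_eq]
    have hp := p.2
    rw [Metric.mem_closure_iff] at hp ⊢
    intro ε hε
    obtain ⟨x, hx, hxp⟩ := hp ε hε
    exact ⟨_, ⟨.inner ⟨x, hx⟩, rfl⟩, by rwa [Subtype.dist_eq, hΦ.1]⟩
  exact isHomeomorph_iff_continuous_isClosedMap_bijective.2 ⟨hcont, hclosed, hinj, hsurj⟩

end BoundaryMap

/-- If the products were unbounded, then for each `t` some time `n` would have product above `t`,
and the four point condition would keep the rays uniformly close at time `t`, making them
asymptotic. -/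
theorem GeodesicRay.exists_dist_add_dist_le {X : Type*} [MetricSpace X] {δ : ℝ}
    (h4 : FourPointCondition X δ) {c c' : GeodesicRay X} (hne : c.endpoint ≠ c'.endpoint) :
    ∃ B, ∀ n : ℝ≥0, dist (c.toFun n) (c.toFun 0) + dist (c'.toFun n) (c.toFun 0) ≤
      dist (c.toFun n) (c'.toFun n) + B := by
  by_contra! hcon
  refine hne (GeodesicRay.endpoint_eq_of_dist_le
    (C := dist (c'.toFun 0) (c.toFun 0) + 2 * |δ|) fun t => ?_)
  obtain ⟨n, hn⟩ := hcon (2 * t)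
  set o := c.toFun 0 with ho
  have hδ := le_abs_self δ
  have hδ' := abs_nonneg δ
  have hcn := c.dist_zero n
  have hct := c.dist_zero t
  have htn : (t : ℝ) ≤ n := by
    have := dist_triangle (c'.toFun n) (c.toFun n) o
    linarith [dist_comm (c'.toFun n) (c.toFun n)]
  have hctn := c.dist_eq t n
  have hctn' := c'.dist_eq t n
  rw [abs_sub_comm, abs_of_nonneg (sub_nonneg.2 htn)] at hctn hctn'
  have hct' := c'.dist_zero t
  have hcn' := c'.dist_zero n
  have h1 := h4 (c.toFun t) (c'.toFun n) (c.toFun n) o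
  have h2 := h4 (c.toFun t) (c'.toFun t) (c'.toFun n) o
  have h3 := dist_triangle (c'.toFun n) (c'.toFun 0) o
  have h5 := dist_triangle (c'.toFun t) (c'.toFun 0) o
  have h6 := dist_triangle (c'.toFun n) o (c'.toFun 0)
  rw [dist_comm o (c'.toFun 0)] at h6
  have h7 := dist_comm (c'.toFun n) (c.toFun n)
  have h8 : dist (c.toFun t) (c'.toFun n) ≤ dist (c'.toFun n) o - t + δ := by
    rw [← sub_le_iff_le_add, le_max_iff] at h1
    rcases h1 with h1 | h1 <;> linarith
  rw [← sub_le_iff_le_add, le_max_iff] at h2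
  rcases h2 with h2 | h2 <;> linarith

theorem clusterSetAlong_eq_singleton {E : Type*} [NormedAddCommGroup E] {Ω : Set E}
    {γ : ℝ → KobayashiSpace Ω} {l : Filter ℝ} [l.NeBot] {p : E}
    (h : Tendsto (fun t => (γ t).val) l (𝓝 p)) : clusterSetAlong γ l = {p} := by
  ext z
  constructor
  · intro hz
    have hz' : (𝓝 z ⊓ map (fun t => (γ t).val) l).NeBot := hz
    exact eq_of_nhds_neBot (hz'.mono (inf_le_inf_left _ h))
  · rintro rfl
    exact h.mapClusterPt

/-! ### Construction of geodesic loops and injectivity at infinity. -/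

section GeodesicLoops

variable {E : Type*} [NormedAddCommGroup E] [NormedSpace ℂ E] [ProperSpace E] {Ω W : Set E}

/-- Geodesics of `K_{Ω ∩ W}` between two sequences converging to `p` whose Gromov products stay
bounded subconverge to a geodesic loop with vertex `{p}`. -/
theorem exists_isGeodesicLoop [hΩ : IsBoundedDomain Ω] [CompleteSpace (KobayashiSpace Ω)]
    [hΩW : IsBoundedDomain (Ω ∩ W)] [CompleteSpace (KobayashiSpace (Ω ∩ W))]
    (hG : HasBoundedProducts Ω) {δ : ℝ} (h4 : FourPointCondition (KobayashiSpace Ω) δ)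
    (hW : IsOpen W) {p o : E} (hpW : p ∈ W) (ho : o ∈ Ω) {x y : ℕ → E}
    (hx : ∀ n, x n ∈ Ω ∩ W) (hy : ∀ n, y n ∈ Ω ∩ W) (hxp : Tendsto x atTop (𝓝 p))
    (hyp : Tendsto y atTop (𝓝 p)) {B C : ℝ}
    (hB : ∀ n, kobayashiDist Ω (x n) o + kobayashiDist Ω (y n) o ≤ kobayashiDist Ω (x n) (y n) + B)
    (hC : ∀ n, kobayashiDist (Ω ∩ W) (x n) (y n) ≤ kobayashiDist Ω (x n) (y n) + C)
    (hxo : Tendsto (fun n => kobayashiDist Ω (x n) o) atTop atTop)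
    (hyo : Tendsto (fun n => kobayashiDist Ω (y n) o) atTop atTop) :
    ∃ (γ : ℝ → KobayashiSpace (Ω ∩ W)) (Γ : Set E), IsGeodesicLoop γ Γ ∧ p ∈ Γ := by
  set X : ℕ → KobayashiSpace (Ω ∩ W) := fun n => ⟨x n, hx n⟩ with hX
  set Y : ℕ → KobayashiSpace (Ω ∩ W) := fun n => ⟨y n, hy n⟩ with hY
  choose c hc0 hcL hiso using fun n => IsGeodesicSpace.exists_geodesic (X n) (Y n)
  set L : ℕ → ℝ := fun n => dist (X n) (Y n) with hL
  have hL0 : ∀ n, 0 ≤ L n := fun n => dist_nonneg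
  set a : ℕ → ℝ := fun n => kobayashiDist Ω (x n) o with ha
  set b : ℕ → ℝ := fun n => kobayashiDist Ω (y n) o with hb
  have ha0 : ∀ n, 0 ≤ a n := fun n => kobayashiDist_nonneg _ _ _
  have hb0 : ∀ n, 0 ≤ b n := fun n => kobayashiDist_nonneg _ _ _
  have hLxy : ∀ n, kobayashiDist Ω (x n) (y n) ≤ L n := fun n =>
    kobayashiDist_anti inter_subset_left (hx n) (hy n)
  have hLlow : ∀ n, a n + b n - B ≤ L n := fun n => by linarith [hB n, hLxy n]
  have hLup : ∀ n, L n ≤ a n + b n + |C| := fun n => by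
    have h1 := kobayashiDist_triangle (hx n).1 ho (hy n).1
    rw [kobayashiDist_comm Ω o (y n)] at h1
    have h2 : L n ≤ kobayashiDist Ω (x n) (y n) + C := hC n
    linarith [le_abs_self C]
  -- The new time origin: about `K_Ω(x n, o)` after leaving `x n`, where the geodesic passes near
  -- `o`. The minimum keeps it in the domain.
  set s : ℕ → ℝ := fun n => min (a n) (L n) with hs
  have hs0 : ∀ n, 0 ≤ s n := fun n => le_min (ha0 n) (hL0 n)
  have hsa : ∀ n, s n ≤ a n := fun n => min_le_left _ _
  have hsL : ∀ n, s n ≤ L n := fun n => min_le_right _ _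
  have hLs : ∀ n, L n - s n ≤ b n + |C| := fun n => by
    rcases min_choice (a n) (L n) with h | h
    · have : s n = a n := h
      linarith [hLup n]
    · have : s n = L n := h
      linarith [hb0 n, abs_nonneg C]
  -- Constant extension to `ℝ`, so that Arzelà–Ascoli applies to one common domain.
  set clamp : ℕ → ℝ → ℝ := fun n t => max 0 (min (s n + t) (L n)) with hclamp
  have hclamp_mem : ∀ n t, clamp n t ∈ Icc 0 (L n) := fun n t =>
    ⟨le_max_left _ _, max_le (hL0 n) (min_le_right _ _)⟩
  have hclamp_eq : ∀ n t, -s n ≤ t → t ≤ L n - s n → clamp n t = s n + t := fun n t h1 h2 => by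
    simp only [hclamp]
    rw [min_eq_left (by linarith), max_eq_right (by linarith)]
  set g : ℕ → ℝ → KobayashiSpace (Ω ∩ W) := fun n t => c n (clamp n t) with hg
  have hg_dist : ∀ n t t', dist (g n t) (g n t') = |clamp n t - clamp n t'| := fun n t t' =>
    hiso n _ (hclamp_mem n t) _ (hclamp_mem n t')
  have hg_lip : ∀ n, LipschitzWith 1 (g n) := by
    refine fun n => LipschitzWith.of_dist_le_mul fun t t' => ?_
    rw [hg_dist, NNReal.coe_one, one_mul, Real.dist_eq]
    refine (abs_max_sub_max_le_max _ _ _ _).trans ?_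
    rw [sub_self, abs_zero, max_eq_right (abs_nonneg _)]
    refine (abs_min_sub_min_le_max _ _ _ _).trans ?_
    rw [sub_self, abs_zero, max_eq_left (abs_nonneg _), add_sub_add_left_eq_sub]
  have hg_x : ∀ n t, kobayashiDist Ω (x n) (g n t).val ≤ clamp n t := fun n t => by
    have h1 := hiso n 0 ⟨le_rfl, hL0 n⟩ _ (hclamp_mem n t)
    rw [hc0, zero_sub, abs_neg, abs_of_nonneg (hclamp_mem n t).1, KobayashiSpace.dist_eq] at h1
    exact (kobayashiDist_anti inter_subset_left (hx n) (g n t).property).trans h1.le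
  have hg_y : ∀ n t, kobayashiDist Ω (g n t).val (y n) ≤ L n - clamp n t := fun n t => by
    have h1 := hiso n _ (hclamp_mem n t) _ ⟨hL0 n, le_rfl⟩
    rw [hcL, abs_sub_comm, abs_of_nonneg (sub_nonneg.2 (hclamp_mem n t).2),
      KobayashiSpace.dist_eq] at h1
    exact (kobayashiDist_anti inter_subset_left (g n t).property (hy n)).trans h1.le
  -- The curves pass at bounded distance from `o` at time `0`.
  have hmid : ∀ n, kobayashiDist Ω (g n 0).val o ≤ B + |C| + δ := by
    intro n
    have h0 : clamp n 0 = s n := by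
      rw [hclamp_eq n 0 (by linarith [hs0 n]) (by linarith [hsL n]), add_zero]
    have h1 := h4 ⟨x n, (hx n).1⟩ ⟨y n, (hy n).1⟩ ⟨(g n 0).val, (g n 0).property.1⟩ ⟨o, ho⟩
    simp only [KobayashiSpace.dist_eq] at h1
    have h2 := hg_x n 0
    have h3 := hg_y n 0
    rw [h0] at h2 h3
    have h5 := kobayashiDist_comm Ω (g n 0).val (y n)
    have h6 := hB n
    have h7 := hLs n
    have h8 := hsa n
    have h9 := abs_nonneg C
    rw [← sub_le_iff_le_add, le_max_iff] at h1
    rcases h1 with h1 | h1 <;> linarith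
  -- For large `|t|` the product with `y n` or `x n` is large, so the curve is Euclidean close to
  -- that endpoint, hence to `p`, uniformly in `n`.
  have hfar : ∀ ε > 0, ∃ T, 0 ≤ T ∧ ∀ᶠ n in atTop, ∀ t, T ≤ |t| → -s n ≤ t → t ≤ L n - s n →
      dist (g n t).val p < ε := by
    intro ε hε
    obtain ⟨C', hC'⟩ := hG o ho (ε / 2) (by positivity)
    refine ⟨|C| + |C'| + 1, by positivity, ?_⟩
    filter_upwards [Metric.tendsto_nhds.1 hxp (ε / 2) (by positivity),
      Metric.tendsto_nhds.1 hyp (ε / 2) (by positivity)] with n hxn hyn t ht h1 h2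
    by_contra! hcon
    have h3 := hclamp_eq n t h1 h2
    have h5 := kobayashiDist_nonneg Ω (g n t).val o
    have h6 := le_abs_self C'
    have h7 := abs_nonneg C
    rcases le_abs.1 ht with ht | ht
    · have h8 := hC' _ (g n t).property.1 _ (hy n).1
        (by linarith [dist_triangle (g n t).val (y n) p])
      have h9 := hg_y n t
      rw [h3] at h9
      linarith [hLs n]
    · have h8 := hC' _ (hx n).1 _ (g n t).property.1
        (by linarith [dist_triangle (g n t).val (x n) p, dist_comm (g n t).val (x n)])
      have h9 := hg_x n t
      rw [h3] at h9
      linarith [hsa n]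
  have hs_lim : Tendsto s atTop atTop := by
    refine tendsto_atTop_mono (fun n => ?_) (tendsto_atTop_add_const_right _ (-|B|) hxo)
    refine le_min ?_ ?_
    · linarith [abs_nonneg B]
    · linarith [hLlow n, hb0 n, le_abs_self B]
  have hLs_lim : Tendsto (fun n => L n - s n) atTop atTop := by
    refine tendsto_atTop_mono (fun n => ?_) (tendsto_atTop_add_const_right _ (-|B|) hyo)
    linarith [hLlow n, hsa n, le_abs_self B]
  -- The curves stay in a compact set at time `0`.
  obtain ⟨r, hr, hrW⟩ := Metric.nhds_basis_closedBall.mem_iff.1 (hW.mem_nhds hpW)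
  -- A bound on `K_Ω` does not keep `g n 0` away from the boundary of `W`, but at time `T₀` the
  -- curve is in a ball inside `W`. Going back to time `0` costs at most `T₀` in `Ω ∩ W`.
  obtain ⟨T₀, hT₀, hevT₀⟩ := hfar r hr
  obtain ⟨o', ho'⟩ := hΩW.isConnected.nonempty
  obtain ⟨C₄, hC₄⟩ := ((isCompact_setOf_kobayashiDist_le ho (B + |C| + δ + T₀)).inter_right
    (isClosed_closedBall (x := p) (ε := r))).exists_kobayashiDist_le (D := Ω ∩ W)
    (fun z hz => ⟨hz.1.1, hrW hz.2⟩) ho'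
  have hbdd : ∀ᶠ n in atTop, dist (g n 0) ⟨o', ho'⟩ ≤ T₀ + C₄ := by
    filter_upwards [hevT₀, hLs_lim.eventually_ge_atTop T₀] with n h1 h2
    have h3 := h1 T₀ (le_abs_self _) (by linarith [hs0 n]) h2
    have h5 : dist (g n 0) (g n T₀) ≤ T₀ := by
      have := (hg_lip n).dist_le_mul 0 T₀
      rwa [NNReal.coe_one, one_mul, Real.dist_eq, zero_sub, abs_neg, abs_of_nonneg hT₀] at this
    have h6 : kobayashiDist Ω (g n T₀).val o ≤ B + |C| + δ + T₀ := by
      have h7 := kobayashiDist_triangle (g n T₀).property.1 (g n 0).property.1 ho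
      have h8 := kobayashiDist_anti (D := Ω ∩ W) (D' := Ω) inter_subset_left
        (g n 0).property (g n T₀).property
      rw [KobayashiSpace.dist_eq] at h5
      linarith [hmid n, kobayashiDist_comm Ω (g n T₀).val (g n 0).val]
    have h7 : dist (g n T₀) ⟨o', ho'⟩ ≤ C₄ := hC₄ _ ⟨⟨(g n T₀).property.1, h6⟩, h3.le⟩
    linarith [dist_triangle (g n 0) (g n T₀) ⟨o', ho'⟩]
  obtain ⟨N, hN⟩ := eventually_atTop.1 hbdd
  obtain ⟨φ, hφ, γ, -, hlim⟩ := exists_subseq_tendsto_of_lipschitz (fun n => g (n + N))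
    (fun n => hg_lip _) 0 (fun n => hN (n + N) (Nat.le_add_left _ _))
  have hθ : Tendsto (fun n => φ n + N) atTop atTop :=
    (tendsto_add_atTop_nat N).comp hφ.tendsto_atTop
  have hmem : ∀ t, ∀ᶠ n in atTop, -s (φ n + N) ≤ t ∧ t ≤ L (φ n + N) - s (φ n + N) := by
    intro t
    filter_upwards [(hs_lim.comp hθ).eventually_ge_atTop (-t),
      (hLs_lim.comp hθ).eventually_ge_atTop t] with n h1 h2
    simp only [Function.comp_apply] at h1 h2
    exact ⟨by linarith, h2⟩
  have hisoγ : Isometry γ := by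
    refine Isometry.of_dist_eq fun t t' => ?_
    refine tendsto_nhds_unique ((hlim t).dist (hlim t')) (tendsto_const_nhds.congr' ?_)
    filter_upwards [hmem t, hmem t'] with n h1 h2
    rw [hg_dist, hclamp_eq _ t h1.1 h1.2, hclamp_eq _ t' h2.1 h2.2, add_sub_add_left_eq_sub,
      Real.dist_eq]
  have hγp : ∀ ε > 0, ∃ T, ∀ t, T ≤ |t| → dist (γ t).val p < ε := by
    intro ε hε
    obtain ⟨T, -, hT⟩ := hfar (ε / 2) (by positivity)
    refine ⟨T, fun t ht => lt_of_le_of_lt ?_ (half_lt_self hε)⟩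
    refine le_of_tendsto ((KobayashiSpace.tendsto_iff.1 (hlim t)).dist tendsto_const_nhds) ?_
    filter_upwards [hθ.eventually hT, hmem t] with n h1 h2 using (h1 t ht h2.1 h2.2).le
  refine ⟨γ, {p}, ⟨hisoγ, clusterSetAlong_eq_singleton ?_, clusterSetAlong_eq_singleton ?_⟩, rfl⟩
  · refine Metric.tendsto_nhds.2 fun ε hε => ?_
    obtain ⟨T, hT⟩ := hγp ε hε
    filter_upwards [eventually_ge_atTop T] with t ht using hT t (ht.trans (le_abs_self t))
  · refine Metric.tendsto_nhds.2 fun ε hε => ?_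
    obtain ⟨T, hT⟩ := hγp ε hε
    filter_upwards [eventually_le_atBot (-T)] with t ht
    exact hT t (by linarith [neg_le_abs t])

/-- Limits of rays are not in `Ω`, so only two ideal points can collide. Distinct ones come from
rays with bounded products, and a common limit would yield a forbidden loop. -/
theorem IsBoundaryExtension.injective [hΩ : IsBoundedDomain Ω] [CompleteSpace (KobayashiSpace Ω)]
    (hG : HasBoundedProducts Ω) {δ : ℝ} (h4 : FourPointCondition (KobayashiSpace Ω) δ)
    (hloop : HasNoLocalGeodesicLoops Ω) {Φ : GromovClosure (KobayashiSpace Ω) → closure Ω}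
    (hΦ : IsBoundaryExtension Φ) : Function.Injective Φ := by
  have hideal : ∀ ξ : GromovBoundary (KobayashiSpace Ω), (Φ (.ideal ξ) : E) ∉ Ω := by
    intro ξ
    obtain ⟨c, rfl⟩ : ∃ c : GeodesicRay (KobayashiSpace Ω), c.endpoint = ξ := Quotient.exists_rep ξ
    exact c.not_mem_of_tendsto (hΦ.2 c)
  intro z z' hzz'
  have hval : (Φ z : E) = Φ z' := congrArg _ hzz'
  cases z with
  | inner x =>
    cases z' with
    | inner x' =>
      rw [hΦ.1, hΦ.1] at hval
      rw [KobayashiSpace.ext_val hval]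
    | ideal ξ =>
      rw [hΦ.1] at hval
      exact absurd (hval ▸ x.property) (hideal ξ)
  | ideal ξ =>
    cases z' with
    | inner x =>
      rw [hΦ.1] at hval
      exact absurd (hval ▸ x.property) (hideal ξ)
    | ideal ξ' =>
      obtain ⟨c, rfl⟩ : ∃ c : GeodesicRay (KobayashiSpace Ω), c.endpoint = ξ :=
        Quotient.exists_rep ξ
      obtain ⟨c', rfl⟩ : ∃ c : GeodesicRay (KobayashiSpace Ω), c.endpoint = ξ' :=
        Quotient.exists_rep ξ'
      by_contra hne
      have hne' : c.endpoint ≠ c'.endpoint := fun h => hne (by rw [h])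
      obtain ⟨B, hB⟩ := GeodesicRay.exists_dist_add_dist_le h4 hne'
      set p : E := ((Φ (.ideal c.endpoint) : closure Ω) : E) with hp
      have hpf : p ∈ frontier Ω := mem_frontier_of_not_mem (Φ _).2 (hideal _)
      obtain ⟨W, hW, hpW, hWc, hWcomp, hno⟩ := hloop p hpf
      have := IsBoundedDomain.inter hW hWc
      have := hWcomp.2
      obtain ⟨r, hr, hrW, C, hC⟩ := hG.exists_inter_le_add hW hpW
      have hcast : Tendsto (fun n : ℕ => (n : ℝ≥0)) atTop atTop := tendsto_natCast_atTop_atTop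
      have hx := (hΦ.2 c).comp hcast
      have hy := (hΦ.2 c').comp hcast
      rw [← hval] at hy
      obtain ⟨N, hN⟩ := eventually_atTop.1 ((Metric.tendsto_nhds.1 hx r hr).and
        (Metric.tendsto_nhds.1 hy r hr))
      simp only [Function.comp_apply] at hN
      have hNr : ∀ n : ℕ, dist (c.toFun ((n + N : ℕ) : ℝ≥0)).val p < r ∧
        dist (c'.toFun ((n + N : ℕ) : ℝ≥0)).val p < r := fun n => hN _ (Nat.le_add_left _ _)
      have hshift : Tendsto (fun n : ℕ => ((n + N : ℕ) : ℝ≥0)) atTop atTop :=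
        hcast.comp (tendsto_add_atTop_nat N)
      have hshift' : Tendsto (fun n : ℕ => (((n + N : ℕ) : ℝ≥0) : ℝ)) atTop atTop :=
        NNReal.tendsto_coe_atTop.2 hshift
      refine hno (exists_isGeodesicLoop hG h4 hW hpW (c.toFun 0).property
        (x := fun n => (c.toFun ((n + N : ℕ) : ℝ≥0)).val)
        (y := fun n => (c'.toFun ((n + N : ℕ) : ℝ≥0)).val)
        (fun n => ⟨(c.toFun _).property, hrW (hNr n).1⟩)
        (fun n => ⟨(c'.toFun _).property, hrW (hNr n).2⟩)
        ((hΦ.2 c).comp hshift) ?_ (B := B) (C := C) (fun n => hB _)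
        (fun n => hC _ (c.toFun _).property (hNr n).1 _ (c'.toFun _).property (hNr n).2) ?_ ?_)
      · rw [hval]
        exact (hΦ.2 c').comp hshift
      · refine hshift'.congr fun n => ?_
        rw [← c.dist_zero, KobayashiSpace.dist_eq]
      · refine tendsto_atTop_mono (fun n => ?_)
          (tendsto_atTop_add_const_right _ (-dist (c.toFun 0) (c'.toFun 0)) hshift')
        have h1 := c'.dist_zero ((n + N : ℕ) : ℝ≥0)
        have h2 := dist_triangle (c'.toFun ((n + N : ℕ) : ℝ≥0)) (c.toFun 0) (c'.toFun 0)
        rw [← KobayashiSpace.dist_eq]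
        linarith

end GeodesicLoops

/-! ### Properties of model domains and the equivalence. -/

section ModelDomains

/-- Truncations of the ray agree with it on any bounded interval from some index on. -/
theorem GeodesicRay.tendsto_inner {X : Type*} [MetricSpace X] (c : GeodesicRay X) :
    Tendsto (fun t => GromovClosure.inner (c.toFun t)) atTop
      (@nhds _ (gromovTopology (c.toFun 0)) (.ideal c.endpoint)) := by
  let := gromovTopology (c.toFun 0)
  refine tendsto_of_seq_tendsto fun t ht => (gromovConverges_of_tendsto
    (c := fun n s => c.toFun (min s (t n))) (fun n => ?_) c.isGeneralizedRay fun T => ?_).tendsto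
  · have h := IsGeneralizedRay.segment (o := c.toFun 0) (fun s => c.toFun (min s (t n))) (t n)
      (by simp) (fun s hs s' hs' => ?_) fun s hs => ?_
    · rwa [min_self] at h
    · rw [min_eq_left hs, min_eq_left hs', c.isometry.edist_eq]
    · rw [min_eq_right hs, min_self]
  · refine Metric.tendstoUniformlyOn_iff.2 fun ε hε => ?_
    filter_upwards [ht.eventually_ge_atTop T] with n hn s hs
    rwa [min_eq_left ((mem_Iic.1 hs).trans hn), dist_self]

theorem IsGeneralizedRay.dist_of_inner {X : Type*} [MetricSpace X] {o x : X} {c : ℝ≥0 → X}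
    (h : IsGeneralizedRay o c (.inner x)) {t : ℝ≥0} (ht : (t : ℝ) ≤ dist x o) :
    dist (c t) o = t ∧ dist (c t) x = dist x o - t := by
  obtain ⟨h0, R, hR, hinner, -⟩ := h.exists_length
  obtain ⟨r, rfl, rfl⟩ := hinner x rfl
  have h1 : dist (c r) o = r := by
    rw [← h0, hR, stoppedTime_zero, stoppedTime_of_le le_rfl, sub_zero,
      abs_of_nonneg r.coe_nonneg]
  rw [h1] at ht ⊢
  have h2 : (t : ℝ≥0∞) ≤ r := ENNReal.coe_le_coe.2 ht
  constructor
  · rw [← h0, hR, stoppedTime_zero, stoppedTime_of_le h2, sub_zero, abs_of_nonneg t.coe_nonneg]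
  · rw [hR, stoppedTime_of_le h2, stoppedTime_of_le le_rfl, abs_sub_comm,
      abs_of_nonneg (sub_nonneg.2 ht)]

/-- Points at distance `t` from `o` on geodesics from `o` to `x` and `y` are close if the Gromov
product of `x` and `y` is at least `t`. -/
theorem FourPointCondition.dist_le_of_product {X : Type*} [MetricSpace X] {δ : ℝ}
    (h4 : FourPointCondition X δ) {o x y a b : X} {t : ℝ} (hao : dist a o = t)
    (hax : dist a x = dist x o - t) (hbo : dist b o = t) (hby : dist b y = dist y o - t)
    (ht : 2 * t ≤ dist x o + dist y o - dist x y) : dist a b ≤ 2 * |δ| := by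
  have h1 := h4 a y x o
  have h2 := h4 a b y o
  have hδ := le_abs_self δ
  have hδ' := abs_nonneg δ
  rw [dist_comm y x] at h1
  have h3 : dist a y ≤ dist y o - t + |δ| := by
    rw [← sub_le_iff_le_add, le_max_iff] at h1
    rcases h1 with h1 | h1 <;> linarith
  rw [← sub_le_iff_le_add, le_max_iff] at h2
  rcases h2 with h2 | h2 <;> linarith

variable {E : Type*} [NormedAddCommGroup E] [NormedSpace ℂ E] {Ω : Set E}

/-- Both halves of the line converge to the images of their ideal endpoints. Equal cluster sets
force equal endpoints, yet at time `t` the halves are `2 * t` apart. -/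
theorem not_isGeodesicLoop_of_isHomeomorph [hΩ : IsBoundedDomain Ω]
    (hΦ : ∀ o : KobayashiSpace Ω, ∃ Φ : GromovClosure (KobayashiSpace Ω) → closure Ω,
      @IsHomeomorph _ _ (gromovTopology o) _ Φ ∧
        ∀ x : KobayashiSpace Ω, (Φ (.inner x) : E) = x.val)
    {γ : ℝ → KobayashiSpace Ω} {Γ : Set E} : ¬ IsGeodesicLoop γ Γ := by
  rintro ⟨hγ, htop, hbot⟩
  obtain ⟨Φ, hhom, hin⟩ := hΦ (γ 0)
  let := gromovTopology (γ 0)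
  let c : GeodesicRay (KobayashiSpace Ω) :=
    ⟨fun t => γ t, hγ.comp (isometry_subtype_coe (s := {t : ℝ | 0 ≤ t}))⟩
  let c' : GeodesicRay (KobayashiSpace Ω) :=
    ⟨fun t => γ (-t), hγ.comp ((IsometryEquiv.neg ℝ).isometry.comp
      (isometry_subtype_coe (s := {t : ℝ | 0 ≤ t})))⟩
  have hc0 : c.toFun 0 = γ 0 := by simp [c]
  have hc0' : c'.toFun 0 = γ 0 := by simp [c']
  have hlim : ∀ c : GeodesicRay (KobayashiSpace Ω), c.toFun 0 = γ 0 →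
      Tendsto (fun t => (c.toFun t).val) atTop (𝓝 (Φ (.ideal c.endpoint) : E)) := by
    intro c hc
    have h := c.tendsto_inner
    rw [hc] at h
    have h1 := (continuous_subtype_val.comp hhom.continuous).tendsto (.ideal c.endpoint) |>.comp h
    exact h1.congr fun t => hin _
  have h1 : Tendsto (fun t => (γ t).val) atTop (𝓝 (Φ (.ideal c.endpoint) : E)) := by
    refine ((hlim c hc0).comp tendsto_real_toNNReal_atTop).congr' ?_
    filter_upwards [eventually_ge_atTop 0] with t ht
    simp only [Function.comp_apply, c, Real.coe_toNNReal t ht]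
  have h2 : Tendsto (fun t => (γ t).val) atBot (𝓝 (Φ (.ideal c'.endpoint) : E)) := by
    refine (((hlim c' hc0').comp tendsto_real_toNNReal_atTop).comp
      tendsto_neg_atBot_atTop).congr' ?_
    filter_upwards [eventually_le_atBot 0] with t ht
    simp only [Function.comp_apply, c', Real.coe_toNNReal (-t) (neg_nonneg.2 ht), neg_neg]
  rw [clusterSetAlong_eq_singleton h1] at htop
  rw [clusterSetAlong_eq_singleton h2, ← htop, singleton_eq_singleton_iff] at hbot
  have h3 := hhom.injective (Subtype.ext hbot)
  rw [GromovClosure.ideal.injEq] at h3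
  obtain ⟨C, hC⟩ := GeodesicRay.exists_dist_le_of_endpoint_eq h3
  have h4 := hC (C.toNNReal + 1)
  simp only [c, c'] at h4
  rw [hγ.dist_eq, Real.dist_eq] at h4
  push_cast at h4
  have h5 := le_abs_self (-((C.toNNReal : ℝ) + 1) - ((C.toNNReal : ℝ) + 1))
  have h6 := neg_le_abs (-((C.toNNReal : ℝ) + 1) - ((C.toNNReal : ℝ) + 1))
  have h7 := Real.le_coe_toNNReal C
  have h8 := C.toNNReal.coe_nonneg
  linarith

/-- Without visibility there are points tending to `p` and `q` with products tending to infinity.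
Segments from `o` to them fellow-travel, so their limit rays are asymptotic although they end at `p`
and `q`. -/
theorem hasVisibility_of_isHomeomorph [ProperSpace E] [hΩ : IsBoundedDomain Ω]
    [CompleteSpace (KobayashiSpace Ω)] {δ : ℝ} (h4 : FourPointCondition (KobayashiSpace Ω) δ)
    {o : KobayashiSpace Ω} {Φ : GromovClosure (KobayashiSpace Ω) → closure Ω}
    (hhom : @IsHomeomorph _ _ (gromovTopology o) _ Φ)
    (hin : ∀ x : KobayashiSpace Ω, (Φ (.inner x) : E) = x.val) {p q : E}
    (hp : p ∉ Ω) (hq : q ∉ Ω) (hpq : p ≠ q) : HasVisibility Ω p q := by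
  let := gromovTopology o
  have hd : 0 < dist p q := dist_pos.2 hpq
  set ε : ℕ → ℝ := fun n => dist p q / 2 * (1 / ((n : ℝ) + 1)) with hε
  have hε0 : ∀ n, 0 < ε n := fun n => mul_pos (half_pos hd) Nat.one_div_pos_of_nat
  have hε1 : ∀ n, ε n ≤ dist p q / 2 := fun n => by
    refine mul_le_of_le_one_right (half_pos hd).le ?_
    rw [div_le_one (Nat.cast_add_one_pos n)]
    linarith [(Nat.cast_nonneg n : (0 : ℝ) ≤ n)]
  have hεlim : Tendsto ε atTop (𝓝 0) := by
    simpa [hε] using tendsto_one_div_add_atTop_nhds_zero_nat.const_mul (dist p q / 2)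
  by_contra hcon
  -- If all products were below `n - δ`, every geodesic between the two balls would meet the compact
  -- ball of radius `n` about `o`.
  have hex : ∀ n : ℕ, ∃ x y : KobayashiSpace Ω, dist x.val p < ε n ∧ dist y.val q < ε n ∧
      2 * (n : ℝ) ≤ dist x o + dist y o - dist x y + 2 * δ := by
    intro n
    by_contra! hn
    refine hcon ⟨ball p (ε n), ball q (ε n), KobayashiSpace.val '' closedBall o n, isOpen_ball,
      mem_ball_self (hε0 n), isOpen_ball, mem_ball_self (hε0 n),
      ball_disjoint_ball (by linarith [hε1 n]),
      (isCompact_closedBall o n).image KobayashiSpace.continuous_val, ?_, ?_⟩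
    · rintro _ ⟨x, -, rfl⟩
      exact x.property
    · intro x y S hx hy hS
      obtain ⟨b, hb, hob⟩ := h4.dist_le_of_isGeodesicSegment hS o
      have h1 := hn x y hx hy
      rw [dist_comm o y] at hob
      refine ⟨b, hb, b, ?_, rfl⟩
      rw [mem_closedBall, dist_comm]
      linarith
  choose x y hx hy hxy using hex
  have hlim : ∀ {r : E} {w : ℕ → KobayashiSpace Ω}, r ∉ Ω → (∀ n, dist (w n).val r < ε n) →
      ∃ c : ℕ → ℝ≥0 → KobayashiSpace Ω, (∀ n, IsGeneralizedRay o (c n) (.inner (w n))) ∧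
        ∀ φ : ℕ → ℕ, StrictMono φ → ∃ ψ : ℕ → ℕ, StrictMono ψ ∧ ∃ c' : GeodesicRay _,
          (Φ (.ideal c'.endpoint) : E) = r ∧
          ∀ t, Tendsto (fun n => c (φ (ψ n)) t) atTop (𝓝 (c'.toFun t)) := by
    intro r w hr hw
    choose c hc using fun n => exists_isGeneralizedRay_inner o (w n)
    refine ⟨c, hc, fun φ hφ => ?_⟩
    obtain ⟨ψ, hψ, c', z, hz, hlim⟩ := exists_subseq_isGeneralizedRay fun n => hc (φ n)
    have h1 := (gromovConverges_of_tendsto (fun n => hc (φ (ψ n))) hz hlim).tendsto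
    have h2 := ((continuous_subtype_val.comp hhom.continuous).tendsto z).comp h1
    have h3 : Tendsto (fun n => (w n).val) atTop (𝓝 r) :=
      tendsto_iff_dist_tendsto_zero.2 (squeeze_zero (fun _ => dist_nonneg)
        (fun n => (hw n).le) hεlim)
    have h5 : (Φ z : E) = r := tendsto_nhds_unique (h2.congr fun n => hin _)
      (h3.comp (hφ.comp hψ).tendsto_atTop)
    refine ⟨ψ, hψ, ?_⟩
    cases z with
    | inner v =>
      rw [hin] at h5
      exact absurd (h5 ▸ v.property) hr
    | ideal ξ =>
      obtain ⟨-, R, -, -, hR⟩ := hz.exists_length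
      obtain ⟨-, c'', rfl, rfl⟩ := hR ξ rfl
      exact ⟨c'', h5, fun t => (hlim t).tendsto_at (mem_Iic.2 le_rfl)⟩
  obtain ⟨c, hc, hcsub⟩ := hlim hp hx
  obtain ⟨c', hc', hcsub'⟩ := hlim hq hy
  obtain ⟨φ, hφ, r, hrp, hr⟩ := hcsub id strictMono_id
  obtain ⟨ψ, hψ, r', hrq, hr'⟩ := hcsub' φ hφ
  refine hpq ?_
  rw [← hrp, ← hrq, GeodesicRay.endpoint_eq_of_dist_le (C := 2 * |δ|) fun t => ?_]
  refine le_of_tendsto (((hr t).comp hψ.tendsto_atTop).dist (hr' t)) ?_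
  filter_upwards [(tendsto_natCast_atTop_atTop.comp
    (hφ.comp hψ).tendsto_atTop).eventually_ge_atTop ((t : ℝ) + δ)] with n hn
  simp only [Function.comp_apply, id] at hn ⊢
  set m := φ (ψ n)
  have h1 := hxy m
  have h2 := dist_triangle (y m) (x m) o
  have h3 := dist_triangle (x m) (y m) o
  rw [dist_comm (y m) (x m)] at h2
  have h5 := (hc m).dist_of_inner (t := t) (by linarith)
  have h6 := (hc' m).dist_of_inner (t := t) (by linarith)
  exact h4.dist_le_of_product h5.1 h5.2 h6.1 h6.2 (by linarith)

variable [ProperSpace E]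

theorem isGromovModelDomain_of_local [hΩ : IsBoundedDomain Ω] (hloc : IsLocallyGromovHyperbolic Ω)
    (hvis : IsLocallyVisible Ω) (hloop : HasNoLocalGeodesicLoops Ω) : IsGromovModelDomain Ω := by
  have : CompleteSpace (KobayashiSpace Ω) := completeSpace_of_forall_frontier fun p hp => by
    obtain ⟨U, hU, hpU, hc, hcomp, -⟩ := hloc p hp
    exact ⟨U, hU, hpU, hc, hcomp⟩
  have hG := hvis.hasBoundedProducts
  obtain ⟨δ, h4⟩ := hG.fourPointCondition hloc
  obtain ⟨Φ, hΦ⟩ := hG.exists_isBoundaryExtension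
  exact ⟨.of_completeSpace this, h4.isGromovHyperbolic, fun o =>
    ⟨Φ, hΦ.isHomeomorph hG (hΦ.injective hG h4 hloop) o, hΦ.1⟩⟩

/-- The neighborhood `univ` works in all three conditions. -/
theorem IsGromovModelDomain.local [hΩ : IsBoundedDomain Ω] (h : IsGromovModelDomain Ω) :
    IsLocallyGromovHyperbolic Ω ∧ IsLocallyVisible Ω ∧ HasNoLocalGeodesicLoops Ω := by
  have : CompleteSpace (KobayashiSpace Ω) := h.1.2
  obtain ⟨δ, h4⟩ := h.2.1.fourPointCondition
  obtain ⟨o, ho⟩ := hΩ.isConnected.nonempty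
  obtain ⟨Φ, hhom, hin⟩ := h.2.2 ⟨o, ho⟩
  have hfr : ∀ q ∈ frontier Ω, q ∉ Ω := fun q hq => by
    rw [hΩ.isOpen.frontier_eq] at hq
    exact hq.2
  refine ⟨fun p _ => ⟨univ, isOpen_univ, mem_univ p, ?_⟩,
    fun p _ => ⟨univ, isOpen_univ, mem_univ p, ?_⟩,
    fun p _ => ⟨univ, isOpen_univ, mem_univ p, ?_⟩⟩
  all_goals rw [inter_univ]
  · exact ⟨hΩ.isConnected, h.1, h.2.1⟩
  · exact ⟨hΩ.isConnected, h.1, univ, isOpen_univ, mem_univ p, subset_rfl,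
      fun q hq q' hq' hne => hasVisibility_of_isHomeomorph h4 hhom hin (hfr q hq.1)
        (hfr q' hq'.1) hne⟩
  · exact ⟨hΩ.isConnected, h.1,
      fun ⟨_, _, hγ, _⟩ => not_isGeodesicLoop_of_isHomeomorph h.2.2 hγ⟩

end ModelDomains

theorem theorem1p5 (d : ℕ) (Ω : Set (EuclideanSpace ℂ (Fin d)))
    (hopen : IsOpen Ω) (hconn : IsConnected Ω) (hbdd : Bornology.IsBounded Ω) :
    IsGromovModelDomain Ω ↔
      IsLocallyGromovHyperbolic Ω ∧ IsLocallyVisible Ω ∧ HasNoLocalGeodesicLoops Ω := by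
  have : IsBoundedDomain Ω := ⟨hopen, hconn, hbdd⟩
  exact ⟨IsGromovModelDomain.local, fun h => isGromovModelDomain_of_local h.1 h.2.1 h.2.2⟩
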